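/- Let $(M,g)$ be a smooth 4-dimensional Lorentzian manifold of signature $(+,-,-,-)$ that is asymptotically flat at null infinity: there are coordinates $(u,r,x)$, $x\in S^2$, with $u$ in an open interval $I$, covering a neighbourhood of null infinity (for each compact $K\subset I$, all $u\in K$, $x\in S^2$ and $r>R_K$), in which $g(\partial_r,\cdot)=du$ and in which $g$ tends to the Minkowski metric $du^2+2\,du\,dr-r^2 g_{S^2}$; more precisely, in the coordinates $(u,y)$, $y=rx\in\mathbb R^3$, the components of $g-g_{\rm Mink}$ are polyhomogeneous of order $-1$. Here a function $f$ is polyhomogeneous of order $m$ if it has an asymptotic expansion $$f\sim\sum_{k\ge 0} r^{m-k}\sum_{j\le N_k} f_{kj}(u,x)\,(\ln r)^j ,\qquad r\to\infty ,$$ with smooth $f_{kj}$, which may be differentiated term by term, uniformly in $x$ and locally uniformly in $u$. Null infinity is $\mathscr I=I\times S^2$. Assume that it is complete, i.e. $I=\mathbb R$. Let $\xi$ be a smooth Killing vector field of $(M,g)$ whose components in the coordinates $(u,y)$ are polyhomogeneous of order $1$. Let $\xi|_{\mathscr I}$ be the limit, as $r\to\infty$, of the components of $\xi$ with respect to $(u,x)$.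 Assume that $\xi$ is not supertranslational, i.e. $\xi|_{\mathscr I}$ is not of the form $\alpha(x)\,\partial_u$. Then $\xi|_{\mathscr I}$ exists, its $S^2$-component does not depend on $u$, and through each point of $\mathscr I$ there is an orbit (integral curve) of $\xi|_{\mathscr I}$ defined for all parameter values $t\in\mathbb R$. Regard the orbits as curves on $S^2$ by projecting $\mathbb R\times S^2\to S^2$; call the points of $S^2$ at which the $S^2$-component of $\xi|_{\mathscr I}$ vanishes critical, and the orbits starting at other points regular. Then exactly one of the following holds. 1. (Spirals) There are exactly two critical points $p\ne q$, and each regular orbit tends to $p$ as $t\to-\infty$ and to $q$ as $t\to+\infty$, winding around each of them infinitely often (the polar angle around $p$, resp. $q$, tends to $+\infty$ or $-\infty$). 2. ("Electric dipole") There are exactly two critical points $p\neq q$, and each regular orbit tends to $p$ as $t\to-\infty$ and to $q$ as $t\to+\infty$, and lies on a circle on $S^2$ (of positive radius, so that the circle passes through $p$ and $q$). 3. (Periodic orbits) There are exactly two critical points $p\neq q$, and each regular orbit is periodic and its image is a circle on $S^2$ that separates $p$ from $q$. 4. (Tangent closed orbits) There is exactly one critical point $p$; each regular orbit tends to $p$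 as $t\to\pm\infty$ and together with $p$ forms a circle on $S^2$ through $p$, and all these circles have the same tangent line at $p$. -/

import Mathlib

open Filter Topology Set
open scoped Manifold ContDiff RealInnerProductSpace

noncomputable section

/-- Euclidean 3-space; the unit sphere of it is the sphere of directions at null infinity. -/
abbrev E3 : Type := EuclideanSpace ℝ (Fin 3)

/-- The model space of spacetimes, of dimension 4. Near null infinity a point `(u, y)` stands for
retarded time `u`, radius `r = ‖y‖` and direction `x = y / ‖y‖`; that is, the coordinates
`(u, r, θ, φ)` with the polar coordinates `(r, θ, φ)` rewritten as the vector `y = r • x`. -/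
abbrev E4 : Type := ℝ × E3

/-- The unit 2-sphere. -/
def S2 : Set E3 := Metric.sphere 0 1

/-! ### Spacetimes and Killing fields -/

section Spacetime

variable {M : Type*} [TopologicalSpace M] [ChartedSpace E4 M]

/-- The coordinate expression, on the target of the chart `e`, of a vector field. -/
def vectorInChart (e : OpenPartialHomeomorph M E4) (ξ : (p : M) → TangentSpace 𝓘(ℝ, E4) p)
    (z : E4) : E4 :=
  mfderiv 𝓘(ℝ, E4) 𝓘(ℝ, E4) e (e.symm z) (ξ (e.symm z))

/-- The coordinate expression, on the target of the chart `e`, of a field of bilinear forms. -/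
def formInChart (e : OpenPartialHomeomorph M E4)
    (g : (p : M) → TangentSpace 𝓘(ℝ, E4) p →L[ℝ] TangentSpace 𝓘(ℝ, E4) p →L[ℝ] ℝ)
    (z : E4) : E4 →L[ℝ] E4 →L[ℝ] ℝ :=
  let B : E4 →L[ℝ] E4 →L[ℝ] ℝ := g (e.symm z)
  let J : E4 →L[ℝ] E4 := mfderiv 𝓘(ℝ, E4) 𝓘(ℝ, E4) e.symm z
  B.bilinearComp J J

variable (M) in
/-- A smooth Lorentzian metric of signature `(+,-,-,-)`. -/
structure LorentzMetric where
  form : (p : M) → TangentSpace 𝓘(ℝ, E4) p →L[ℝ] TangentSpace 𝓘(ℝ, E4) p →L[ℝ] ℝ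
  symm : ∀ p v w, form p v w = form p w v
  signature : ∀ p, ∃ τ, 0 < form p τ τ ∧ ∀ v, form p τ v = 0 → v ≠ 0 → form p v v < 0
  smooth : ∀ e ∈ IsManifold.maximalAtlas 𝓘(ℝ, E4) ∞ M,
    ContDiffOn ℝ ∞ (formInChart e form) e.target

/-- `ξ` is a smooth Killing field: the Lie derivative
`(L_ξ g)(v, w) = (∂_ξ g)(v, w) + g(∂_v ξ, w) + g(v, ∂_w ξ)` vanishes in all coordinates. -/
def IsKilling (g : LorentzMetric M) (ξ : (p : M) → TangentSpace 𝓘(ℝ, E4) p) : Prop :=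
  (∀ e ∈ IsManifold.maximalAtlas 𝓘(ℝ, E4) ∞ M, ContDiffOn ℝ ∞ (vectorInChart e ξ) e.target) ∧
  ∀ e ∈ IsManifold.maximalAtlas 𝓘(ℝ, E4) ∞ M, ∀ z ∈ e.target, ∀ v w : E4,
    fderiv ℝ (formInChart e g.form) z (vectorInChart e ξ z) v w
      + formInChart e g.form z (fderiv ℝ (vectorInChart e ξ) z v) w
      + formInChart e g.form z v (fderiv ℝ (vectorInChart e ξ) z w) = 0

end Spacetime

/-! ### Polyhomogeneous functions near null infinity -/

/-- `f = O(bound r)` as `r → ∞`, uniformly in the direction and locally uniformly in `u ∈ I`,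
together with all its derivatives along `∂_u`, `r ∂_r` and the angular directions: these are the
derivatives at `‖y‖ = 1` of the rescaled functions `(u, y) ↦ f (u, r • y)`. -/
def IsConormalBigO {F : Type*} [NormedAddCommGroup F] [NormedSpace ℝ F] (I : Set ℝ)
    (f : E4 → F) (bound : ℝ → ℝ) : Prop :=
  ∀ (n : ℕ) (K : Set ℝ), K ⊆ I → IsCompact K → ∃ C : ℝ, ∀ᶠ r : ℝ in atTop,
    ∀ u ∈ K, ∀ x ∈ S2,
      ‖iteratedFDeriv ℝ n (fun z : E4 => f (z.1, r • z.2)) (u, x)‖ ≤ C * bound r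

/-- `f` has, near the null infinity `I × S²`, a polyhomogeneous expansion
`f ~ ∑_{k ≥ 0} r ^ (m - k) ∑_{j ≤ N k} c_{k j}(u, x) (ln r) ^ j`
that may be differentiated term by term. The coefficients, smooth functions on `I × S²`, are
written as functions of `(u, y)` that are constant along the rays `y = r • x`, `r > 0`. -/
def IsPolyhomogeneous {F : Type*} [NormedAddCommGroup F] [NormedSpace ℝ F] (I : Set ℝ)
    (m : ℤ) (f : E4 → F) : Prop :=
  ∃ (N : ℕ → ℕ) (c : ℕ → ℕ → E4 → F),
    (∀ k j, ContDiffOn ℝ ∞ (c k j) (I ×ˢ {0}ᶜ)) ∧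
    (∀ k j u y, ∀ s : ℝ, 0 < s → c k j (u, s • y) = c k j (u, y)) ∧
    ∀ n : ℕ, IsConormalBigO I
      (fun z => f z - ∑ k ∈ Finset.range n, ‖z.2‖ ^ (m - (k : ℤ)) •
        ∑ j ∈ Finset.range (N k + 1), Real.log ‖z.2‖ ^ j • c k j z)
      (fun r => r ^ (m - (n : ℤ)) * Real.log r ^ N n)

/-! ### Asymptotically flat spacetimes -/

/-- The Minkowski metric `du² + 2 du dr - r² (dθ² + sin² θ dφ²)` in the coordinates `(u, y)`. With
`x = y / ‖y‖`, `dr = ⟪x, dy⟫` and the last term is `‖dy‖² - dr²`. -/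
def minkowskiForm (z : E4) : E4 →L[ℝ] E4 →L[ℝ] ℝ :=
  let du : E4 →L[ℝ] ℝ := ContinuousLinearMap.fst ℝ ℝ E3
  let dy : Fin 3 → E4 →L[ℝ] ℝ := fun i =>
    (EuclideanSpace.proj i : E3 →L[ℝ] ℝ).comp (ContinuousLinearMap.snd ℝ ℝ E3)
  let dr : E4 →L[ℝ] ℝ := ∑ i, (‖z.2‖⁻¹ * z.2 i) • dy i
  du.smulRight du + du.smulRight dr + dr.smulRight du
    - ((∑ i, (dy i).smulRight (dy i)) - dr.smulRight dr)

section AsymptoticallyFlat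

variable {M : Type*} [TopologicalSpace M] [ChartedSpace E4 M]

/-- Asymptotic flatness of `(M, g)` at (future) null infinity: coordinates `(u, r, x)`, with `u` a
retarded time that labels null hypersurfaces, `r` an affine parameter of their generators, and `x`
constant along these, in which `g` is polyhomogeneous and tends to the Minkowski metric.
Null infinity is `times × S²`. -/
structure AsymptoticallyFlat (g : LorentzMetric M) where
  chart : OpenPartialHomeomorph M E4
  chart_mem : chart ∈ IsManifold.maximalAtlas 𝓘(ℝ, E4) ∞ M
  /-- the range of the retarded time on null infinity, an open interval -/
  times : Set ℝ
  times_open : IsOpen times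
  times_interval : times.OrdConnected
  times_nonempty : times.Nonempty
  /-- the coordinates cover a neighbourhood of null infinity -/
  covers : ∀ K ⊆ times, IsCompact K → ∃ R : ℝ, ∀ u ∈ K, ∀ y : E3, R < ‖y‖ →
    (u, y) ∈ chart.target
  /-- `∂_r` is null, orthogonal to the angular directions, and `g(∂_r, ∂_u) = 1`;
  in short `g(∂_r, ·) = du`, where `r ∂_r = (0, y)` -/
  gauge : ∀ z ∈ chart.target, ∀ v : E4,
    formInChart chart g.form z (0, z.2) v = ‖z.2‖ * v.1
  /-- `g = g_Minkowski + O(r⁻¹ (ln r)^N)`, with a polyhomogeneous expansion -/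
  flat : IsPolyhomogeneous times (-1) (fun z => formInChart chart g.form z - minkowskiForm z)

namespace AsymptoticallyFlat

variable {g : LorentzMetric M} (A : AsymptoticallyFlat g)

/-- Null infinity is complete: the retarded time, which is an affine parameter of the generators
`ℝ × {x}` of null infinity, takes all real values. -/
def IsComplete : Prop := A.times = univ

/-- The coordinate components of `ξ` with respect to `(u, x)` at the point with retarded time `u`,
radius `r` and direction `x`: the `u`-component and the velocity of the direction `x = y / ‖y‖`. -/
def boundaryComponents (ξ : (p : M) → TangentSpace 𝓘(ℝ, E4) p) (u : ℝ) (x : E3) (r : ℝ) : E4 :=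
  let v := vectorInChart A.chart ξ (u, r • x)
  (v.1, r⁻¹ • (v.2 - ⟪x, v.2⟫ • x))

/-- The vector field `X` on null infinity (of which only the values at points `(u, x)` with
`u ∈ times`, `x ∈ S²` matter) is the restriction of `ξ` to null infinity. -/
def IsRestriction (ξ : (p : M) → TangentSpace 𝓘(ℝ, E4) p) (X : E4 → E4) : Prop :=
  ∀ u ∈ A.times, ∀ x ∈ S2, Tendsto (A.boundaryComponents ξ u x) atTop (𝓝 (X (u, x)))

/-- `ξ` is supertranslational: on null infinity it has the form `α(x) ∂_u`. -/
def IsSupertranslational (ξ : (p : M) → TangentSpace 𝓘(ℝ, E4) p) : Prop :=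
  ∃ α : E3 → ℝ, A.IsRestriction ξ (fun z => (α z.2, 0))

end AsymptoticallyFlat

end AsymptoticallyFlat

/-! ### The orbits on the sphere -/

/-- The complete integral curves `t ↦ (u(t), x(t))` on `ℝ × S²` of the vector field `X`. -/
def IsOrbit (X : E4 → E4) (γ : ℝ → E4) : Prop :=
  ∀ t, (γ t).2 ∈ S2 ∧ HasDerivAt γ (X (γ t)) t

/-- The curves on `S²` obtained from the orbits on `ℝ × S²` by forgetting `u`. -/
def IsProjectedOrbit (X : E4 → E4) (σ : ℝ → E3) : Prop :=
  ∃ γ, IsOrbit X γ ∧ ∀ t, σ t = (γ t).2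

/-- The points of `S²` at which the angular part of `X` vanishes. -/
def criticalPoints (X : E4 → E4) : Set E3 := {x | x ∈ S2 ∧ ∀ u, (X (u, x)).2 = 0}

/-- The orbits of `X` that start at points of `S²` which are not critical, as curves on `S²`. -/
def IsRegularOrbit (X : E4 → E4) (σ : ℝ → E3) : Prop :=
  IsProjectedOrbit X σ ∧ σ 0 ∉ criticalPoints X

/-- The circle on `S²` cut out by the plane `⟪n, x⟫ = c`; of positive radius if `‖n‖ = 1`
and `|c| < 1`. -/
def circleOnSphere (n : E3) (c : ℝ) : Set E3 := {x | x ∈ S2 ∧ ⟪n, x⟫ = c}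

/-- As `t → ∞` the curve `σ` on `S²` tends to `p` and winds around `p` infinitely often: the polar
angle of its projection to the plane orthogonal to `p` is unbounded, with limit `±∞`. -/
def SpiralsInto (σ : ℝ → E3) (p : E3) : Prop :=
  Tendsto σ atTop (𝓝 p) ∧
  ∃ (e₁ e₂ : E3) (T : ℝ) (ρ θ : ℝ → ℝ),
    ‖e₁‖ = 1 ∧ ‖e₂‖ = 1 ∧ ⟪e₁, e₂⟫ = 0 ∧ ⟪p, e₁⟫ = 0 ∧ ⟪p, e₂⟫ = 0 ∧
    ContinuousOn θ (Ici T) ∧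
    (∀ t ≥ T, 0 < ρ t ∧
      σ t - ⟪p, σ t⟫ • p = ρ t • (Real.cos (θ t) • e₁ + Real.sin (θ t) • e₂)) ∧
    Tendsto (fun t => |θ t|) atTop atTop

/-- The four kinds of behaviour of the orbits. -/
inductive OrbitClass where
  | spiral
  | dipole
  | periodic
  | tangent

/-- The orbits of `X`, as curves on `S²`, behave as the class says. -/
def OrbitClass.Describes (X : E4 → E4) : OrbitClass → Prop
  /- two critical points; the other orbits spiral out of one of them and into the other -/
  | .spiral => ∃ p q : E3, p ≠ q ∧ criticalPoints X = {p, q} ∧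
      ∀ σ, IsRegularOrbit X σ → SpiralsInto (fun t => σ (-t)) p ∧ SpiralsInto σ q
  /- two critical points; the other orbits run from one to the other along arcs of circles -/
  | .dipole => ∃ p q : E3, p ≠ q ∧ criticalPoints X = {p, q} ∧
      ∀ σ, IsRegularOrbit X σ → Tendsto σ atBot (𝓝 p) ∧ Tendsto σ atTop (𝓝 q) ∧
        ∃ (n : E3) (c : ℝ), ‖n‖ = 1 ∧ |c| < 1 ∧ range σ ⊆ circleOnSphere n c
  /- two critical points; the other orbits are periodic and trace circles that separate the two -/
  | .periodic => ∃ p q : E3, p ≠ q ∧ criticalPoints X = {p, q} ∧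
      ∀ σ, IsRegularOrbit X σ → (∃ T : ℝ, 0 < T ∧ Function.Periodic σ T) ∧
        ∃ (n : E3) (c : ℝ), ‖n‖ = 1 ∧ |c| < 1 ∧ range σ = circleOnSphere n c ∧
          c < ⟪n, p⟫ ∧ ⟪n, q⟫ < c
  /- one critical point `p`; every other orbit is closed up by `p` to a circle through `p`, and all
  these circles have the same tangent line at `p`, spanned by `τ` -/
  | .tangent => ∃ p : E3, criticalPoints X = {p} ∧ ∃ τ : E3, τ ≠ 0 ∧ ⟪p, τ⟫ = 0 ∧
      ∀ σ, IsRegularOrbit X σ → Tendsto σ atBot (𝓝 p) ∧ Tendsto σ atTop (𝓝 p) ∧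
        ∃ (n : E3) (c : ℝ), ‖n‖ = 1 ∧ |c| < 1 ∧ insert p (range σ) = circleOnSphere n c ∧
          ⟪n, τ⟫ = 0

end

noncomputable section

/-! ### Functions of polylogarithmic growth -/

/-- `f` grows at most like a power of the logarithm. -/
def IsPolylog {F : Type*} [NormedAddCommGroup F] (f : ℝ → F) : Prop :=
  ∃ k : ℕ, f =O[atTop] fun r : ℝ => Real.log r ^ k

namespace IsPolylog

variable {F F' : Type*} [NormedAddCommGroup F] [NormedAddCommGroup F']

theorem log_pow_isBigO {k l : ℕ} (h : k ≤ l) :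
    (fun r : ℝ => Real.log r ^ k) =O[atTop] fun r : ℝ => Real.log r ^ l := by
  refine Asymptotics.IsBigO.of_bound 1 ?_
  filter_upwards [Real.tendsto_log_atTop.eventually_ge_atTop (1 : ℝ)] with r hr
  rw [one_mul, Real.norm_of_nonneg (by positivity), Real.norm_of_nonneg (by positivity)]
  exact pow_le_pow_right₀ hr h

theorem const (c : F) : IsPolylog fun _ => c :=
  ⟨0, by simpa using Asymptotics.isBigO_const_const c (one_ne_zero (α := ℝ)) atTop⟩

theorem log_pow (k : ℕ) : IsPolylog fun r : ℝ => Real.log r ^ k :=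
  ⟨k, Asymptotics.isBigO_refl _ _⟩

theorem add {f g : ℝ → F} (hf : IsPolylog f) (hg : IsPolylog g) :
    IsPolylog fun r => f r + g r := by
  obtain ⟨k, hk⟩ := hf
  obtain ⟨l, hl⟩ := hg
  exact ⟨max k l, (hk.trans (log_pow_isBigO (le_max_left k l))).add
    (hl.trans (log_pow_isBigO (le_max_right k l)))⟩

theorem sum {ι : Type*} {s : Finset ι} {f : ι → ℝ → F} (hf : ∀ i ∈ s, IsPolylog (f i)) :
    IsPolylog fun r => ∑ i ∈ s, f i r := by
  classical
  induction s using Finset.induction_on with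
  | empty => simpa using const (0 : F)
  | insert a s ha ih =>
    simp only [Finset.sum_insert ha]
    exact (hf a (by simp)).add (ih fun i hi => hf i (by simp [hi]))

theorem mul {f g : ℝ → ℝ} (hf : IsPolylog f) (hg : IsPolylog g) :
    IsPolylog fun r => f r * g r := by
  obtain ⟨k, hk⟩ := hf
  obtain ⟨l, hl⟩ := hg
  exact ⟨k + l, by simpa only [pow_add] using hk.mul hl⟩

theorem norm {f : ℝ → F} (hf : IsPolylog f) : IsPolylog fun r => ‖f r‖ := by
  obtain ⟨k, hk⟩ := hf
  exact ⟨k, hk.norm_left⟩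

theorem of_le {f : ℝ → F} {g : ℝ → ℝ} (hg : IsPolylog g) (h : ∀ᶠ r in atTop, ‖f r‖ ≤ g r) :
    IsPolylog f := by
  obtain ⟨k, hk⟩ := hg
  refine ⟨k, (Asymptotics.IsBigO.of_bound 1 ?_).trans hk⟩
  filter_upwards [h] with r hr
  simpa using hr.trans (le_abs_self _)

theorem congr {f g : ℝ → F} (hf : IsPolylog f) (h : ∀ᶠ r in atTop, g r = f r) :
    IsPolylog g :=
  hf.norm.of_le (h.mono fun r hr => by rw [hr])

theorem smul [NormedSpace ℝ F] {f : ℝ → ℝ} {g : ℝ → F} (hf : IsPolylog f) (hg : IsPolylog g) :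
    IsPolylog fun r => f r • g r :=
  (hf.norm.mul hg.norm).of_le (Eventually.of_forall fun r => by rw [norm_smul])

theorem clm_apply [NormedSpace ℝ F] [NormedSpace ℝ F'] {f : ℝ → F →L[ℝ] F'} {g : ℝ → F}
    (hf : IsPolylog f) (hg : IsPolylog g) : IsPolylog fun r => f r (g r) :=
  (hf.norm.mul hg.norm).of_le (Eventually.of_forall fun r => (f r).le_opNorm _)

theorem prodMk {f : ℝ → F} {g : ℝ → F'} (hf : IsPolylog f) (hg : IsPolylog g) :
    IsPolylog fun r => (f r, g r) :=
  (hf.norm.add hg.norm).of_le (Eventually.of_forall fun r => by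
    rw [Prod.norm_def]
    exact max_le_add_of_nonneg (norm_nonneg _) (norm_nonneg _))

theorem tendsto_inv_smul [NormedSpace ℝ F] {f : ℝ → F} (hf : IsPolylog f) :
    Tendsto (fun r : ℝ => r⁻¹ • f r) atTop (𝓝 0) := by
  obtain ⟨k, hk⟩ := hf
  have h : f =o[atTop] (id : ℝ → ℝ) := hk.trans_isLittleO Real.isLittleO_pow_log_id_atTop
  have h2 := (Asymptotics.isBigO_refl (fun r : ℝ => r⁻¹) atTop).smul_isLittleO h
  refine (Asymptotics.isLittleO_one_iff ℝ).1 (h2.trans_isBigO ?_)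
  refine Asymptotics.IsBigO.of_bound 1 ?_
  filter_upwards [eventually_gt_atTop 0] with r hr
  simp [hr.ne']

end IsPolylog

/-! ### Radial rescaling -/

/-- The rescaling `(u, y) ↦ (u, r y)`. -/
def radialScale (r : ℝ) : E4 →L[ℝ] E4 :=
  (ContinuousLinearMap.fst ℝ ℝ E3).prod (r • ContinuousLinearMap.snd ℝ ℝ E3)

@[simp] theorem radialScale_apply (r : ℝ) (z : E4) : radialScale r z = (z.1, r • z.2) := rfl

section Conormal

variable {F : Type*} [NormedAddCommGroup F] [NormedSpace ℝ F]

theorem fderiv_radialScale {h : E4 → F} {r u : ℝ} {x : E3}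
    (hh : DifferentiableAt ℝ h (u, r • x)) :
    fderiv ℝ (fun z : E4 => h (z.1, r • z.2)) (u, x)
      = (fderiv ℝ h (u, r • x)).comp (radialScale r) := by
  have h1 : HasFDerivAt (fun z : E4 => radialScale r z) (radialScale r) (u, x) :=
    (radialScale r).hasFDerivAt
  exact (HasFDerivAt.comp (g := h) (u, x) hh.hasFDerivAt h1).fderiv

theorem differentiableAt_radialScale {h : E4 → F} {r u : ℝ} {x : E3}
    (hh : DifferentiableAt ℝ h (u, r • x)) :
    DifferentiableAt ℝ (fun z : E4 => h (z.1, r • z.2)) (u, x) := by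
  have h1 : DifferentiableAt ℝ (fun z : E4 => radialScale r z) (u, x) :=
    (radialScale r).differentiableAt
  exact DifferentiableAt.comp (g := h) (u, x) hh h1

theorem IsConormalBigO.exists_bound {I : Set ℝ} {f : E4 → F} {bound : ℝ → ℝ}
    (h : IsConormalBigO I f bound) {u : ℝ} (hu : u ∈ I) {x : E3} (hx : x ∈ S2) :
    ∃ C : ℝ, ∀ᶠ r : ℝ in atTop, ‖f (u, r • x)‖ ≤ C * |bound r| ∧
      ‖fderiv ℝ (fun z : E4 => f (z.1, r • z.2)) (u, x)‖ ≤ C * |bound r| := by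
  obtain ⟨C0, h0⟩ := h 0 {u} (by simpa using hu) isCompact_singleton
  obtain ⟨C1, h1⟩ := h 1 {u} (by simpa using hu) isCompact_singleton
  refine ⟨|C0| + |C1|, ?_⟩
  filter_upwards [h0, h1] with r a b
  have a := a u rfl x hx
  have b := b u rfl x hx
  rw [norm_iteratedFDeriv_zero] at a
  rw [norm_iteratedFDeriv_one] at b
  have key : ∀ t c D : ℝ, t ≤ c * bound r → |c| ≤ D → t ≤ D * |bound r| := by
    intro t c D h1 h2
    calc t ≤ |c * bound r| := h1.trans (le_abs_self _)
      _ = |c| * |bound r| := abs_mul _ _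
      _ ≤ D * |bound r| := by gcongr
  exact ⟨key _ _ _ a (by simp), key _ _ _ b (by simp)⟩

theorem IsConormalBigO.isPolylog {f : E4 → F} {m : ℤ} {N : ℕ}
    (h : IsConormalBigO univ f fun r => r ^ m * Real.log r ^ N) (u : ℝ) {x : E3} (hx : x ∈ S2) :
    IsPolylog (fun r : ℝ => r ^ (-m) • f (u, r • x)) ∧
      IsPolylog fun r : ℝ => r ^ (-m) • fderiv ℝ (fun z : E4 => f (z.1, r • z.2)) (u, x) := by
  obtain ⟨C, hC⟩ := h.exists_bound (mem_univ u) hx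
  have key : ∀ r : ℝ, 0 < r → ∀ t : ℝ, t ≤ C * |r ^ m * Real.log r ^ N| →
      ‖r ^ (-m)‖ * t ≤ C * ‖Real.log r ^ N‖ := by
    intro r hr t ht
    have hp : 0 < r ^ m := zpow_pos hr m
    have hp' : 0 < r ^ (-m) := zpow_pos hr _
    have h1 : r ^ (-m) * r ^ m = 1 := by rw [← zpow_add₀ hr.ne']; simp
    calc ‖r ^ (-m)‖ * t ≤ ‖r ^ (-m)‖ * (C * |r ^ m * Real.log r ^ N|) := by gcongr
      _ = (r ^ (-m) * r ^ m) * (C * ‖Real.log r ^ N‖) := by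
        rw [Real.norm_of_nonneg hp'.le, abs_mul, abs_of_pos hp, Real.norm_eq_abs]; ring
      _ = _ := by rw [h1, one_mul]
  have hbd : IsPolylog fun r : ℝ => C * ‖Real.log r ^ N‖ :=
    (IsPolylog.const C).mul (IsPolylog.log_pow N).norm
  constructor
  · refine hbd.of_le ?_
    filter_upwards [hC, eventually_gt_atTop 0] with r h1 hr
    rw [norm_smul]
    exact key r hr _ h1.1
  · refine hbd.of_le ?_
    filter_upwards [hC, eventually_gt_atTop 0] with r h1 hr
    rw [norm_smul]
    exact key r hr _ h1.2

theorem IsPolyhomogeneous.isPolylog {f : E4 → F} {m : ℤ} (h : IsPolyhomogeneous univ m f)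
    (u : ℝ) {x : E3} (hx : x ∈ S2) :
    IsPolylog (fun r : ℝ => r ^ (-m) • f (u, r • x)) ∧
      IsPolylog fun r : ℝ => r ^ (-m) • fderiv ℝ (fun z : E4 => f (z.1, r • z.2)) (u, x) := by
  obtain ⟨N, c, -, -, h⟩ := h
  have h := h 0
  simp only [Finset.range_zero, Finset.sum_empty, sub_zero, Nat.cast_zero] at h
  exact h.isPolylog u hx

/-- The leading term of a polyhomogeneous function of order one. -/
theorem IsPolyhomogeneous.exists_leading {f : E4 → F} (h : IsPolyhomogeneous univ 1 f) :
    ∃ (N : ℕ) (c : ℕ → E4 → F),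
      (∀ j, ∀ z : E4, z.2 ≠ 0 → DifferentiableAt ℝ (c j) z) ∧
      (∀ j u y, ∀ s : ℝ, 0 < s → c j (u, s • y) = c j (u, y)) ∧
      ∀ u, ∀ x ∈ S2,
        IsPolylog (fun r : ℝ => (fun z : E4 => f z - ‖z.2‖ •
          ∑ j ∈ Finset.range (N + 1), Real.log ‖z.2‖ ^ j • c j z) (u, r • x)) ∧
        IsPolylog fun r : ℝ => fderiv ℝ (fun z : E4 => (fun z : E4 => f z - ‖z.2‖ •
          ∑ j ∈ Finset.range (N + 1), Real.log ‖z.2‖ ^ j • c j z) (z.1, r • z.2)) (u, x) := by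
  obtain ⟨N, c, hc, hhom, h⟩ := h
  refine ⟨N 0, c 0, ?_, hhom 0, ?_⟩
  · intro j z hz
    have hopen : IsOpen ((univ : Set ℝ) ×ˢ ({0}ᶜ : Set E3)) :=
      isOpen_univ.prod isOpen_compl_singleton
    exact ((hc 0 j).contDiffAt (hopen.mem_nhds ⟨trivial, hz⟩)).differentiableAt (by simp)
  · intro u x hx
    have h := (h 1).isPolylog u hx
    simpa using h

end Conormal

/-! ### Polynomials in the logarithm -/

theorem Polynomial.tendsto_eval_of_tendsto_eval_log {Q : Polynomial ℝ} {c : ℝ}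
    (h : Tendsto (fun r : ℝ => Q.eval (Real.log r)) atTop (𝓝 c)) : Q = Polynomial.C c := by
  have h2 : Tendsto (fun x : ℝ => Q.eval x) atTop (𝓝 c) := by
    simpa [Function.comp_def] using h.comp Real.tendsto_exp_atTop
  obtain ⟨h3, h4⟩ := Q.tendsto_nhds_iff.1 h2
  rw [Polynomial.eq_C_of_degree_le_zero h4]
  congr 1
  rw [← h3, Polynomial.leadingCoeff, Polynomial.natDegree_eq_zero_iff_degree_le_zero.2 h4]

/-- The polynomial with coefficients `p 0, …, p N`. -/
def logPolynomial (N : ℕ) (p : ℕ → ℝ) : Polynomial ℝ :=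
  ∑ j ∈ Finset.range (N + 1), Polynomial.C (p j) * Polynomial.X ^ j

theorem logPolynomial_coeff (N : ℕ) (p : ℕ → ℝ) {j : ℕ} (hj : j < N + 1) :
    (logPolynomial N p).coeff j = p j := by
  rw [logPolynomial, Polynomial.finsetSum_coeff, Finset.sum_eq_single j]
  · simp
  · intro i _ hi
    rw [Polynomial.coeff_C_mul_X_pow, if_neg hi.symm]
  · intro h
    exact absurd (Finset.mem_range.2 hj) h

theorem logPolynomial_eval (N : ℕ) (p : ℕ → ℝ) (x : ℝ) :
    (logPolynomial N p).eval x = ∑ j ∈ Finset.range (N + 1), x ^ j * p j := by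
  simp only [logPolynomial, Polynomial.eval_finsetSum, Polynomial.eval_mul, Polynomial.eval_C,
    Polynomial.eval_pow, Polynomial.eval_X]
  exact Finset.sum_congr rfl fun j _ => mul_comm _ _

theorem logPolynomial_derivative_eval (N : ℕ) (p : ℕ → ℝ) (x : ℝ) :
    (Polynomial.derivative (logPolynomial N p)).eval x
      = ∑ j ∈ Finset.range (N + 1), (j * x ^ (j - 1)) * p j := by
  simp only [logPolynomial, Polynomial.derivative_sum, Polynomial.derivative_C_mul_X_pow,
    Polynomial.eval_finsetSum, Polynomial.eval_mul, Polynomial.eval_C,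
    Polynomial.eval_pow, Polynomial.eval_X]
  exact Finset.sum_congr rfl fun j _ => by ring

theorem coeff_eq_zero_of_tendsto_derivative {N : ℕ} {p : ℕ → ℝ}
    (h : Tendsto (fun r : ℝ => ∑ j ∈ Finset.range (N + 1), (j * Real.log r ^ (j - 1)) * p j)
      atTop (𝓝 0)) {j : ℕ} (hj : j < N + 1) (hj0 : j ≠ 0) : p j = 0 := by
  simp only [← logPolynomial_derivative_eval] at h
  have h2 := Polynomial.tendsto_eval_of_tendsto_eval_log h
  rw [Polynomial.C_0] at h2
  have h3 := Polynomial.derivative_eq_zero.1 h2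
  rw [← logPolynomial_coeff N p hj]
  exact Polynomial.coeff_eq_zero_of_natDegree_lt (by omega)

theorem coeff_eq_of_tendsto_add_derivative {N : ℕ} {p : ℕ → ℝ} {c : ℝ}
    (h : Tendsto (fun r : ℝ => ∑ j ∈ Finset.range (N + 1),
      (Real.log r ^ j + j * Real.log r ^ (j - 1)) * p j) atTop (𝓝 c)) :
    p 0 = c ∧ ∀ j < N + 1, j ≠ 0 → p j = 0 := by
  set P := logPolynomial N p with hP
  have h1 : Tendsto (fun r : ℝ => (P + Polynomial.derivative P).eval (Real.log r))
      atTop (𝓝 c) := by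
    refine h.congr fun r => ?_
    rw [Polynomial.eval_add, hP, logPolynomial_eval, logPolynomial_derivative_eval,
      ← Finset.sum_add_distrib]
    exact Finset.sum_congr rfl fun j _ => by ring
  have h2 := Polynomial.tendsto_eval_of_tendsto_eval_log h1
  have h3 : P.natDegree = 0 := by
    by_contra hne
    have hd : (Polynomial.derivative P).natDegree < P.natDegree :=
      Polynomial.natDegree_derivative_lt hne
    have h4 := Polynomial.natDegree_add_eq_left_of_natDegree_lt hd
    rw [h2, Polynomial.natDegree_C] at h4
    exact hne h4.symm
  have h5 : Polynomial.derivative P = 0 := by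
    rw [Polynomial.eq_C_of_natDegree_eq_zero h3, Polynomial.derivative_C]
  rw [h5, add_zero] at h2
  refine ⟨?_, fun j hj hj0 => ?_⟩
  · rw [← logPolynomial_coeff N p (Nat.succ_pos N), ← hP, h2, Polynomial.coeff_C_zero]
  · rw [← logPolynomial_coeff N p hj]
    exact Polynomial.coeff_eq_zero_of_natDegree_lt (by rw [← hP]; omega)

/-! ### Killing fields in coordinates adapted to null infinity -/

theorem minkowskiForm_apply (z v w : E4) :
    minkowskiForm z v w = v.1 * w.1 + v.1 * (‖z.2‖⁻¹ * ⟪z.2, w.2⟫)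
      + (‖z.2‖⁻¹ * ⟪z.2, v.2⟫) * w.1
      - (⟪v.2, w.2⟫ - (‖z.2‖⁻¹ * ⟪z.2, v.2⟫) * (‖z.2‖⁻¹ * ⟪z.2, w.2⟫)) := by
  simp only [minkowskiForm, PiLp.inner_apply, Fin.sum_univ_three]
  simp
  ring

theorem hasFDerivAt_norm_of_ne_zero {y : E3} (hy : y ≠ 0) :
    HasFDerivAt (fun y : E3 => ‖y‖) (‖y‖⁻¹ • innerSL ℝ y) y := by
  have := (hasStrictFDerivAt_norm_sq y).hasFDerivAt.sqrt (by positivity)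
  simp only [Real.sqrt_sq (norm_nonneg _)] at this
  refine this.congr_fderiv ?_
  ext v
  simp
  field_simp

/-- A Killing field `V` of a metric `G`, both given in the coordinates `(u, y)` on a
neighbourhood `T` of a complete null infinity. -/
structure IsKillingNearInfinity (T : Set E4) (G : E4 → E4 →L[ℝ] E4 →L[ℝ] ℝ) (V : E4 → E4) :
    Prop where
  isOpen : IsOpen T
  covers : ∀ K : Set ℝ, IsCompact K → ∃ R : ℝ, ∀ u ∈ K, ∀ y : E3, R < ‖y‖ → (u, y) ∈ T
  diffG : ∀ z ∈ T, DifferentiableAt ℝ G z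
  diffV : ∀ z ∈ T, DifferentiableAt ℝ V z
  symm : ∀ z v w, G z v w = G z w v
  killing : ∀ z ∈ T, ∀ v w, fderiv ℝ G z (V z) v w + G z (fderiv ℝ V z v) w
    + G z v (fderiv ℝ V z w) = 0
  gauge : ∀ z ∈ T, ∀ v : E4, G z (0, z.2) v = ‖z.2‖ * v.1
  flat : IsPolyhomogeneous univ (-1) fun z => G z - minkowskiForm z
  poly : IsPolyhomogeneous univ 1 V

namespace IsKillingNearInfinity

variable {T : Set E4} {G : E4 → E4 →L[ℝ] E4 →L[ℝ] ℝ} {V : E4 → E4}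

theorem eventually_mem (h : IsKillingNearInfinity T G V) (u : ℝ) {x : E3} (hx : x ≠ 0) :
    ∀ᶠ r : ℝ in atTop, (u, r • x) ∈ T := by
  obtain ⟨R, hR⟩ := h.covers {u} isCompact_singleton
  filter_upwards [eventually_gt_atTop (R / ‖x‖), eventually_gt_atTop 0] with r hr hr0
  refine hR u rfl _ ?_
  rw [norm_smul, Real.norm_of_nonneg hr0.le]
  exact (div_lt_iff₀ (norm_pos_iff.2 hx)).1 hr

theorem radial_equation (h : IsKillingNearInfinity T G V) {z : E4} (hz : z ∈ T) (hz0 : z.2 ≠ 0)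
    (w : E4) :
    G z (fderiv ℝ V z (0, z.2) - (0, (V z).2)) w + ‖z.2‖⁻¹ * ⟪z.2, (V z).2⟫ * w.1
      + ‖z.2‖ * (fderiv ℝ V z w).1 = 0 := by
  have hin : HasFDerivAt (fun z : E4 => ((0 : ℝ), z.2))
      ((0 : E4 →L[ℝ] ℝ).prod (ContinuousLinearMap.snd ℝ ℝ E3)) z :=
    (hasFDerivAt_const (0 : ℝ) z).prodMk hasFDerivAt_snd
  have h1 := ((h.diffG z hz).hasFDerivAt.clm_apply hin).clm_apply (hasFDerivAt_const w z)
  have h2 : HasFDerivAt (fun z : E4 => ‖z.2‖ * w.1)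
      (w.1 • (‖z.2‖⁻¹ • (innerSL ℝ z.2)).comp (ContinuousLinearMap.snd ℝ ℝ E3)) z := by
    have hn := hasFDerivAt_norm_of_ne_zero hz0
    exact (hn.comp z hasFDerivAt_snd).mul_const w.1
  have h3 : (fun z : E4 => G z (0, z.2) w) =ᶠ[𝓝 z] fun z => ‖z.2‖ * w.1 := by
    filter_upwards [h.isOpen.mem_nhds hz] with z' hz'
    exact h.gauge z' hz' w
  have h4 := congrArg (fun L : E4 →L[ℝ] ℝ => L (V z)) ((h2.congr_of_eventuallyEq h3).unique h1)
  have h5 := h.killing z hz (0, z.2) w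
  have h6 := h.gauge z hz (fderiv ℝ V z w)
  simp at h4
  rw [map_sub, sub_apply]
  linarith

theorem fderiv_radial_fst (h : IsKillingNearInfinity T G V) {z : E4} (hz : z ∈ T)
    (hz0 : z.2 ≠ 0) : (fderiv ℝ V z (0, z.2)).1 = 0 := by
  have h1 := h.radial_equation hz hz0 (0, z.2)
  rw [h.symm, h.gauge z hz] at h1
  simp at h1
  tauto

theorem exists_boundary_time (h : IsKillingNearInfinity T G V) :
    ∃ F : E4 → ℝ, ∀ z : E4, z.2 ≠ 0 → ∀ᶠ r : ℝ in atTop, ∀ᶠ z' in 𝓝 z,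
      (V (z'.1, r • z'.2)).1 = F z' := by
  have key : ∀ z : E4, z.2 ≠ 0 → ∃ r₀ : ℝ, ∀ᶠ z' in 𝓝 z, ∀ r ≥ r₀,
      (V (z'.1, r • z'.2)).1 = (V (z'.1, r₀ • z'.2)).1 := by
    rintro ⟨u, y⟩ hy
    have hy : 0 < ‖y‖ := norm_pos_iff.2 hy
    obtain ⟨R, hR⟩ := h.covers (Icc (u - 1) (u + 1)) isCompact_Icc
    refine ⟨(|R| + 1) / (‖y‖ / 2), ?_⟩
    have hr0 : 0 < (|R| + 1) / (‖y‖ / 2) := by positivity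
    have e1 : ∀ᶠ z' : E4 in 𝓝 (u, y), z'.1 ∈ Icc (u - 1) (u + 1) :=
      (continuous_fst.tendsto (u, y)).eventually (Icc_mem_nhds (by simp) (by simp))
    have e2 : ∀ᶠ z' : E4 in 𝓝 (u, y), ‖y‖ / 2 < ‖z'.2‖ :=
      ((continuous_norm.comp continuous_snd).tendsto (u, y)).eventually
        (lt_mem_nhds (by simp; positivity))
    filter_upwards [e1, e2] with z' h1 h2 r hr
    have hmem : ∀ s ≥ (|R| + 1) / (‖y‖ / 2), (z'.1, s • z'.2) ∈ T ∧ 0 < s ∧ z'.2 ≠ 0 := by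
      intro s hs
      have hs0 : 0 < s := hr0.trans_le hs
      have hz' : 0 < ‖z'.2‖ := (half_pos hy).trans h2
      refine ⟨hR _ h1 _ ?_, hs0, norm_pos_iff.1 hz'⟩
      rw [norm_smul, Real.norm_of_nonneg hs0.le]
      have h3 : |R| + 1 ≤ s * (‖y‖ / 2) := (div_le_iff₀ (by positivity)).1 hs
      have h4 : s * (‖y‖ / 2) ≤ s * ‖z'.2‖ := by gcongr
      linarith [le_abs_self R]
    have hder : ∀ s ≥ (|R| + 1) / (‖y‖ / 2),
        HasDerivAt (fun s : ℝ => (V (z'.1, s • z'.2)).1) 0 s := by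
      intro s hs
      obtain ⟨a, b, c⟩ := hmem s hs
      have g1 : HasDerivAt (fun s : ℝ => (z'.1, s • z'.2)) ((0 : ℝ), z'.2) s := by
        simpa using (hasDerivAt_const s z'.1).prodMk ((hasDerivAt_id s).smul_const z'.2)
      have g2 := (hasFDerivAt_fst.comp _ (h.diffV _ a).hasFDerivAt).comp_hasDerivAt s g1
      have g3 := h.fderiv_radial_fst a (smul_ne_zero b.ne' c)
      have g4 : ((0 : ℝ), s • z'.2) = s • ((0 : ℝ), z'.2) := by simp
      simp only [g4, map_smul, Prod.smul_fst, smul_eq_mul, mul_eq_zero, b.ne', false_or] at g3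
      exact g2.congr_deriv g3
    exact constant_of_has_deriv_right_zero
      (fun s hs => (hder s hs.1).continuousAt.continuousWithinAt)
      (fun s hs => (hder s hs.1).hasDerivWithinAt) r ⟨hr, le_rfl⟩
  refine ⟨fun z => limUnder atTop fun r : ℝ => (V (z.1, r • z.2)).1, fun z hz => ?_⟩
  obtain ⟨r₀, hr₀⟩ := key z hz
  filter_upwards [eventually_ge_atTop r₀] with r hr
  filter_upwards [hr₀] with z' h'
  have hlim : Tendsto (fun r : ℝ => (V (z'.1, r • z'.2)).1) atTop
      (𝓝 (V (z'.1, r₀ • z'.2)).1) := by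
    refine tendsto_const_nhds.congr' ?_
    filter_upwards [eventually_ge_atTop r₀] with s hs using (h' s hs).symm
  rw [hlim.limUnder_eq, h' r hr]

end IsKillingNearInfinity

theorem norm_of_mem_S2 {x : E3} (hx : x ∈ S2) : ‖x‖ = 1 := by
  simpa [S2] using hx

theorem inner_self_of_mem_S2 {x : E3} (hx : x ∈ S2) : ⟪x, x⟫ = 1 := by
  rw [real_inner_self_eq_norm_sq, norm_of_mem_S2 hx, one_pow]

theorem ne_zero_of_mem_S2 {x : E3} (hx : x ∈ S2) : x ≠ 0 := by
  rintro rfl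
  simpa using norm_of_mem_S2 hx

theorem minkowskiForm_radial {u r : ℝ} (hr : 0 < r) {x : E3} (hx : x ∈ S2) (v w : E4) :
    minkowskiForm (u, r • x) v w = v.1 * w.1 + v.1 * ⟪x, w.2⟫ + ⟪x, v.2⟫ * w.1
      - (⟪v.2, w.2⟫ - ⟪x, v.2⟫ * ⟪x, w.2⟫) := by
  have h : ∀ y : E3, ‖r • x‖⁻¹ * ⟪r • x, y⟫ = ⟪x, y⟫ := by
    intro y
    rw [norm_smul, Real.norm_of_nonneg hr.le, norm_of_mem_S2 hx, real_inner_smul_left]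
    field_simp
  rw [minkowskiForm_apply]
  simp only [h]

namespace IsPolylog

variable {F : Type*} [NormedAddCommGroup F]

theorem neg {f : ℝ → F} (hf : IsPolylog f) : IsPolylog fun r => -f r :=
  hf.norm.of_le (Eventually.of_forall fun r => (norm_neg (f r)).le)

/-- A polynomial in the logarithm. -/
theorem log_sum [NormedSpace ℝ F] (N : ℕ) (a : ℕ → ℝ) (k : ℕ → ℕ) (c : ℕ → F) :
    IsPolylog fun r : ℝ => ∑ j ∈ Finset.range N, (a j * Real.log r ^ k j) • c j :=
  IsPolylog.sum fun j _ => ((IsPolylog.const (a j)).mul (IsPolylog.log_pow (k j))).smul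
    (IsPolylog.const (c j))

end IsPolylog

namespace IsKillingNearInfinity

variable {T : Set E4} {G : E4 → E4 →L[ℝ] E4 →L[ℝ] ℝ} {V : E4 → E4}

theorem leading_value {N : ℕ} {c : ℕ → E4 → E4}
    (hom : ∀ j u y, ∀ s : ℝ, 0 < s → c j (u, s • y) = c j (u, y)) {u : ℝ} {x : E3} (hx : x ∈ S2)
    (h1 : IsPolylog fun r : ℝ => (fun z : E4 => V z - ‖z.2‖ •
          ∑ j ∈ Finset.range (N + 1), Real.log ‖z.2‖ ^ j • c j z) (u, r • x)) :
    IsPolylog fun r : ℝ => V (u, r • x)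
      - r • ∑ j ∈ Finset.range (N + 1), Real.log r ^ j • c j (u, x) := by
  refine h1.congr ?_
  filter_upwards [eventually_gt_atTop 0] with r hr
  simp only [norm_smul, Real.norm_of_nonneg hr.le, norm_of_mem_S2 hx, mul_one, hom _ _ _ r hr]

theorem leading_radial_derivative (h : IsKillingNearInfinity T G V) {N : ℕ} {c : ℕ → E4 → E4}
    (hc : ∀ j, ∀ z : E4, z.2 ≠ 0 → DifferentiableAt ℝ (c j) z)
    (hom : ∀ j u y, ∀ s : ℝ, 0 < s → c j (u, s • y) = c j (u, y)) {u : ℝ} {x : E3} (hx : x ∈ S2)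
    (h1 : IsPolylog fun r : ℝ => fderiv ℝ (fun z : E4 => (fun z : E4 => V z - ‖z.2‖ •
          ∑ j ∈ Finset.range (N + 1), Real.log ‖z.2‖ ^ j • c j z) (z.1, r • z.2)) (u, x)) :
    IsPolylog fun r : ℝ => fderiv ℝ V (u, r • x) (0, r • x)
      - r • ∑ j ∈ Finset.range (N + 1),
        (Real.log r ^ j + j * Real.log r ^ (j - 1)) • c j (u, x) := by
  have hx0 := ne_zero_of_mem_S2 hx
  refine (h1.clm_apply (IsPolylog.const ((0 : ℝ), x))).congr ?_
  filter_upwards [eventually_gt_atTop 0, h.eventually_mem u hx0] with r hr hT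
  set Rem : E4 → E4 := fun z : E4 => V z - ‖z.2‖ •
          ∑ j ∈ Finset.range (N + 1), Real.log ‖z.2‖ ^ j • c j z with hRem
  have hr0 : r • x ≠ 0 := smul_ne_zero hr.ne' hx0
  have hdR : DifferentiableAt ℝ Rem (u, r • x) := by
    have hn : DifferentiableAt ℝ (fun z : E4 => ‖z.2‖) (u, r • x) :=
      differentiableAt_snd.norm ℝ hr0
    have hl : DifferentiableAt ℝ (fun z : E4 => Real.log ‖z.2‖) (u, r • x) :=
      hn.log (norm_ne_zero_iff.2 hr0)
    exact (h.diffV _ hT).sub (hn.smul (DifferentiableAt.fun_sum fun j _ =>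
      (hl.pow j).smul (hc j _ hr0)))
  rw [fderiv_radialScale hdR, ContinuousLinearMap.comp_apply, radialScale_apply]
  have hcurve : HasDerivAt (fun s : ℝ => (u, s • (r • x))) ((0 : ℝ), r • x) 1 := by
    simpa using (hasDerivAt_const (1 : ℝ) u).prodMk ((hasDerivAt_id (1 : ℝ)).smul_const (r • x))
  have hpt : (fun s : ℝ => (u, s • (r • x))) 1 = (u, r • x) := by simp
  have d1 : HasDerivAt (fun s : ℝ => Rem (u, s • (r • x))) (fderiv ℝ Rem (u, r • x) (0, r • x)) 1 :=
    HasFDerivAt.comp_hasDerivAt_of_eq 1 hdR.hasFDerivAt hcurve (by simp)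
  have d2 : HasDerivAt (fun s : ℝ => V (u, s • (r • x))) (fderiv ℝ V (u, r • x) (0, r • x)) 1 :=
    HasFDerivAt.comp_hasDerivAt_of_eq 1 (h.diffV _ hT).hasFDerivAt hcurve (by simp)
  have dl : HasDerivAt (fun s : ℝ => Real.log (s * r)) 1 1 := by
    have := ((hasDerivAt_id (1 : ℝ)).mul_const r).log (by simp [hr.ne'])
    simpa [hr.ne'] using this
  have d3 : HasDerivAt (fun s : ℝ => V (u, s • (r • x)) -
      (s * r) • ∑ j ∈ Finset.range (N + 1), Real.log (s * r) ^ j • c j (u, x))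
      (fderiv ℝ V (u, r • x) (0, r • x) - ((1 * r) • (∑ j ∈ Finset.range (N + 1),
        ((j : ℝ) * Real.log (1 * r) ^ (j - 1) * 1) • c j (u, x)) +
        (1 * r) • ∑ j ∈ Finset.range (N + 1), Real.log (1 * r) ^ j • c j (u, x))) 1 :=
    d2.sub (((hasDerivAt_id (1 : ℝ)).mul_const r).smul (HasDerivAt.fun_sum fun j _ =>
      (dl.pow j).smul_const _))
  have heq : (fun s : ℝ => Rem (u, s • (r • x))) =ᶠ[𝓝 1] fun s : ℝ => V (u, s • (r • x)) -
      (s * r) • ∑ j ∈ Finset.range (N + 1), Real.log (s * r) ^ j • c j (u, x) := by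
    filter_upwards [eventually_gt_nhds zero_lt_one] with s hs
    simp only [hRem, norm_smul, Real.norm_of_nonneg hr.le, Real.norm_of_nonneg hs.le,
      norm_of_mem_S2 hx, mul_one, hom _ _ _ s hs, hom _ _ _ r hr]
  rw [d1.unique (d3.congr_of_eventuallyEq heq)]
  simp only [one_mul, mul_one, ← smul_add, ← Finset.sum_add_distrib, ← add_smul]
  congr 2
  exact Finset.sum_congr rfl fun j _ => by rw [add_comm]

end IsKillingNearInfinity

theorem IsPolylog.snd {f : ℝ → E4} (hf : IsPolylog f) : IsPolylog fun r => (f r).2 :=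
  hf.norm.of_le (Eventually.of_forall fun r => norm_snd_le (f r))

/-- `F` is the `u`-component of `V` on null infinity. -/
def IsBoundaryTime (V : E4 → E4) (F : E4 → ℝ) : Prop :=
  ∀ z : E4, z.2 ≠ 0 → ∀ᶠ r : ℝ in atTop, ∀ᶠ z' in 𝓝 z, (V (z'.1, r • z'.2)).1 = F z'

namespace IsKillingNearInfinity

variable {T : Set E4} {G : E4 → E4 →L[ℝ] E4 →L[ℝ] ℝ} {V : E4 → E4} {F : E4 → ℝ}

theorem boundaryTime_fst (hF : IsBoundaryTime V F) (u : ℝ) {x : E3} (hx : x ≠ 0) :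
    ∀ᶠ r : ℝ in atTop, (V (u, r • x)).1 = F (u, x) := by
  filter_upwards [hF (u, x) hx] with r hr using hr.self_of_nhds

theorem boundaryTime_hasFDerivAt (h : IsKillingNearInfinity T G V) (hF : IsBoundaryTime V F)
    (u : ℝ) {x : E3} (hx : x ≠ 0) : ∀ᶠ r : ℝ in atTop,
    HasFDerivAt F ((ContinuousLinearMap.fst ℝ ℝ E3).comp
      ((fderiv ℝ V (u, r • x)).comp (radialScale r))) (u, x) := by
  filter_upwards [hF (u, x) hx, h.eventually_mem u hx] with r hr hT
  have h1 : HasFDerivAt (fun z : E4 => V (z.1, r • z.2))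
      ((fderiv ℝ V (u, r • x)).comp (radialScale r)) (u, x) := by
    rw [← fderiv_radialScale (h.diffV _ hT)]
    exact (differentiableAt_radialScale (h.diffV _ hT)).hasFDerivAt
  have h2 := (hasFDerivAt_fst (𝕜 := ℝ) (p := V (u, r • x))).comp (u, x) h1
  exact h2.congr_of_eventuallyEq (hr.mono fun z hz => hz.symm)

theorem boundaryTime_differentiableAt (h : IsKillingNearInfinity T G V) (hF : IsBoundaryTime V F)
    (u : ℝ) {x : E3} (hx : x ≠ 0) : DifferentiableAt ℝ F (u, x) :=
  (h.boundaryTime_hasFDerivAt hF u hx).exists.choose_spec.differentiableAt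

theorem boundaryTime_fderiv (h : IsKillingNearInfinity T G V) (hF : IsBoundaryTime V F)
    (u : ℝ) {x : E3} (hx : x ≠ 0) : ∀ᶠ r : ℝ in atTop, ∀ w : E4,
    (fderiv ℝ V (u, r • x) w).1 = fderiv ℝ F (u, x) (w.1, r⁻¹ • w.2) := by
  filter_upwards [h.boundaryTime_hasFDerivAt hF u hx, eventually_gt_atTop 0] with r hr hr0 w
  rw [hr.fderiv]
  simp [hr0.ne']

theorem leading_coefficients (h : IsKillingNearInfinity T G V) (hF : IsBoundaryTime V F)
    {N : ℕ} {c : ℕ → E4 → E4} {u : ℝ} {x : E3} (hx : x ∈ S2)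
    (h1 : IsPolylog fun r : ℝ => V (u, r • x)
      - r • ∑ j ∈ Finset.range (N + 1), Real.log r ^ j • c j (u, x))
    (h2 : IsPolylog fun r : ℝ => fderiv ℝ V (u, r • x) (0, r • x)
      - r • ∑ j ∈ Finset.range (N + 1),
        (Real.log r ^ j + j * Real.log r ^ (j - 1)) • c j (u, x)) :
    ⟪x, (c 0 (u, x)).2⟫ = -fderiv ℝ F (u, x) (1, 0) ∧
      ∀ j < N + 1, j ≠ 0 → (c j (u, x)).2 = 0 := by
  have hx0 := ne_zero_of_mem_S2 hx
  set e : ℝ → E3 := fun r =>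
    r⁻¹ • ((fderiv ℝ V (u, r • x) (0, r • x)).2 - (V (u, r • x)).2) with he
  have he0 : Tendsto (fun r => e r - ∑ j ∈ Finset.range (N + 1),
      (j * Real.log r ^ (j - 1)) • (c j (u, x)).2) atTop (𝓝 0) := by
    refine (h2.snd.add h1.snd.neg).tendsto_inv_smul.congr' ?_
    filter_upwards [eventually_gt_atTop 0] with r hr
    simp only [he, Prod.snd_sub, Prod.smul_snd, Prod.snd_sum, Prod.snd_add, add_smul,
      Finset.sum_add_distrib, smul_add, smul_sub, smul_neg, inv_smul_smul₀ hr.ne']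
    abel
  have heP : IsPolylog e := by
    have hq : IsPolylog fun r => e r - ∑ j ∈ Finset.range (N + 1),
        (j * Real.log r ^ (j - 1)) • (c j (u, x)).2 :=
      ⟨0, by simpa using he0.isBigO_one ℝ⟩
    refine (hq.add (IsPolylog.log_sum (N + 1) (fun j => (j : ℝ)) (fun j => j - 1)
      fun j => (c j (u, x)).2)).congr (Eventually.of_forall fun r => by simp)
  have hP : ∀ w : E4, Tendsto (fun r : ℝ =>
      (G (u, r • x) - minkowskiForm (u, r • x)) (0, e r) w) atTop (𝓝 0) := by
    intro w
    have p1 := ((h.flat.isPolylog u hx).1.clm_apply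
      ((IsPolylog.const (0 : ℝ)).prodMk heP)).clm_apply (IsPolylog.const w)
    refine p1.tendsto_inv_smul.congr' ?_
    filter_upwards [eventually_gt_atTop 0] with r hr
    simp [hr.ne']
  have heq : ∀ᶠ r : ℝ in atTop, ∀ w : E4,
      (G (u, r • x) - minkowskiForm (u, r • x)) (0, e r) w
        + (⟪x, e r⟫ * w.1 - (⟪e r, w.2⟫ - ⟪x, e r⟫ * ⟪x, w.2⟫))
        + ⟪x, r⁻¹ • (V (u, r • x)).2⟫ * w.1
        + fderiv ℝ F (u, x) (w.1, r⁻¹ • w.2) = 0 := by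
    filter_upwards [eventually_gt_atTop 0, h.eventually_mem u hx0,
      h.boundaryTime_fderiv hF u hx0] with r hr hT hd w
    have k1 := h.radial_equation hT (smul_ne_zero hr.ne' hx0) w
    have k2 := h.fderiv_radial_fst hT (smul_ne_zero hr.ne' hx0)
    have k3 : fderiv ℝ V (u, r • x) (0, r • x) - (0, (V (u, r • x)).2) = r • ((0 : ℝ), e r) := by
      refine Prod.ext ?_ ?_
      · simpa using k2
      · simp [he, hr.ne']
    have k4 := minkowskiForm_radial (u := u) hr hx (0, e r) w
    simp only [k3, hd, norm_smul, Real.norm_of_nonneg hr.le, norm_of_mem_S2 hx, mul_one,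
      real_inner_smul_left, map_smul, smul_apply, smul_eq_mul] at k1
    simp only [sub_apply, k4, real_inner_smul_right]
    have k5 : r * (G (u, r • x) (0, e r) w + r⁻¹ * ⟪x, (V (u, r • x)).2⟫ * w.1
        + fderiv ℝ F (u, x) (w.1, r⁻¹ • w.2)) = 0 := by
      refine Eq.trans ?_ k1
      field_simp
    have k6 := (mul_eq_zero.1 k5).resolve_left hr.ne'
    simp only [zero_mul, zero_add]
    linarith
  have hlim : ∀ w' : E3, Tendsto (fun r : ℝ => fderiv ℝ F (u, x) (0, r⁻¹ • w')) atTop (𝓝 0) := by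
    intro w'
    have := (IsPolylog.const (fderiv ℝ F (u, x) (0, w'))).tendsto_inv_smul
    refine this.congr fun r => ?_
    rw [← map_smul]
    simp
  have hrad : Tendsto (fun r : ℝ => ∑ j ∈ Finset.range (N + 1),
      (Real.log r ^ j + j * Real.log r ^ (j - 1)) * ⟪x, (c j (u, x)).2⟫) atTop
      (𝓝 (-fderiv ℝ F (u, x) (1, 0))) := by
    have a1 : Tendsto (fun r : ℝ => ⟪x, r⁻¹ • (fderiv ℝ V (u, r • x) (0, r • x)
      - r • ∑ j ∈ Finset.range (N + 1),
        (Real.log r ^ j + j * Real.log r ^ (j - 1)) • c j (u, x)).2⟫) atTop (𝓝 0) := by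
      have := ((innerSL ℝ x).continuous.tendsto 0).comp h2.snd.tendsto_inv_smul
      simpa [Function.comp_def] using this
    have a2 := (hP (1, 0)).neg.sub (a1.add_const (fderiv ℝ F (u, x) (1, 0)))
    refine (a2.congr' ?_).trans (by simp)
    filter_upwards [heq, eventually_gt_atTop 0] with r k hr
    have k := k (1, 0)
    simp only [he, inner_zero_right, mul_zero, smul_zero, real_inner_smul_right, inner_sub_right,
      mul_one, sub_zero] at k
    simp only [he, Prod.snd_sub, Prod.smul_snd, Prod.snd_sum, real_inner_smul_right,
      inner_sub_right, inner_sum, mul_sub, inv_mul_cancel_left₀ hr.ne']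
    linarith
  have htan : ∀ w' : E3, ⟪x, w'⟫ = 0 → Tendsto (fun r : ℝ => ∑ j ∈ Finset.range (N + 1),
      (j * Real.log r ^ (j - 1)) * ⟪w', (c j (u, x)).2⟫) atTop (𝓝 0) := by
    intro w' hw'
    have a1 : Tendsto (fun r => ⟪w', e r - ∑ j ∈ Finset.range (N + 1),
        (j * Real.log r ^ (j - 1)) • (c j (u, x)).2⟫) atTop (𝓝 0) := by
      have := ((innerSL ℝ w').continuous.tendsto 0).comp he0
      simpa [Function.comp_def] using this
    have a2 := ((hP (0, w')).add (hlim w')).sub a1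
    refine (a2.congr' ?_).trans (by simp)
    filter_upwards [heq] with r k
    have k := k (0, w')
    simp only [hw', mul_zero, sub_zero, real_inner_comm] at k
    simp only [inner_sub_right, inner_sum, real_inner_smul_right]
    linarith
  obtain ⟨r0, r1⟩ := coeff_eq_of_tendsto_add_derivative hrad
  refine ⟨r0, fun j hj hj0 => ?_⟩
  have t1 : ∀ w' : E3, ⟪x, w'⟫ = 0 → ⟪w', (c j (u, x)).2⟫ = 0 := fun w' hw' =>
    coeff_eq_zero_of_tendsto_derivative (htan w' hw') hj hj0
  have t2 := t1 (c j (u, x)).2 (r1 j hj hj0)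
  exact inner_self_eq_zero.1 t2

end IsKillingNearInfinity

namespace IsPolylog

variable {F : Type*} [NormedAddCommGroup F]

theorem tendsto_zero [NormedSpace ℝ F] {f : ℝ → F} (hf : IsPolylog fun r => r • f r) :
    Tendsto f atTop (𝓝 0) := by
  refine hf.tendsto_inv_smul.congr' ?_
  filter_upwards [eventually_gt_atTop 0] with r hr using inv_smul_smul₀ hr.ne' _

theorem of_tendsto {f : ℝ → F} {a : F} (hf : Tendsto f atTop (𝓝 a)) : IsPolylog f :=
  ⟨0, by simpa using hf.isBigO_one ℝ⟩

end IsPolylog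

theorem contDiffOn_minkowskiForm : ContDiffOn ℝ 1 minkowskiForm {z : E4 | z.2 ≠ 0} := by
  refine contDiffOn_clm_apply.2 fun v => contDiffOn_clm_apply.2 fun w => ?_
  simp only [minkowskiForm_apply]
  have hn : ContDiffOn ℝ 1 (fun z : E4 => ‖z.2‖⁻¹) {z : E4 | z.2 ≠ 0} :=
    (contDiffOn_snd.norm ℝ fun z hz => hz).inv fun z hz => norm_ne_zero_iff.2 hz
  have hq : ∀ y : E3, ContDiffOn ℝ 1 (fun z : E4 => ‖z.2‖⁻¹ * ⟪z.2, y⟫) {z : E4 | z.2 ≠ 0} :=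
    fun y => hn.mul (contDiffOn_snd.inner ℝ contDiffOn_const)
  exact ((contDiffOn_const.add (contDiffOn_const.mul (hq _))).add
    ((hq _).mul contDiffOn_const)).sub (contDiffOn_const.sub ((hq _).mul (hq _)))

theorem differentiableAt_minkowskiForm {z : E4} (hz : z.2 ≠ 0) :
    DifferentiableAt ℝ minkowskiForm z := by
  have hopen : IsOpen {z : E4 | z.2 ≠ 0} := isOpen_ne_fun continuous_snd continuous_const
  exact (contDiffOn_minkowskiForm.contDiffAt (hopen.mem_nhds hz)).differentiableAt (by simp)

theorem minkowskiForm_scale {r : ℝ} (hr : 0 < r) (z : E4) :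
    minkowskiForm (z.1, r • z.2) = minkowskiForm z := by
  have h : ∀ y : E3, ‖r • z.2‖⁻¹ * ⟪r • z.2, y⟫ = ‖z.2‖⁻¹ * ⟪z.2, y⟫ := by
    intro y
    rw [norm_smul, Real.norm_of_nonneg hr.le, real_inner_smul_left, mul_inv]
    field_simp
  refine ContinuousLinearMap.ext fun v => ContinuousLinearMap.ext fun w => ?_
  simp only [minkowskiForm_apply, h]

theorem fderiv_minkowskiForm_tangential (u : ℝ) {x v w : E3} (hx : x ≠ 0) (hv : ⟪x, v⟫ = 0)
    (hw : ⟪x, w⟫ = 0) (ζ : E4) : fderiv ℝ minkowskiForm (u, x) ζ (0, v) (0, w) = 0 := by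
  have h1 := (((differentiableAt_minkowskiForm (z := (u, x)) hx).hasFDerivAt.clm_apply
    (hasFDerivAt_const ((0 : ℝ), v) (u, x))).clm_apply (hasFDerivAt_const ((0 : ℝ), w) (u, x)))
  have hq : ∀ y : E3, DifferentiableAt ℝ (fun z : E4 => ‖z.2‖⁻¹ * ⟪z.2, y⟫) (u, x) := fun y =>
    ((differentiableAt_snd.norm ℝ hx).inv (norm_ne_zero_iff.2 hx)).mul
      (differentiableAt_snd.inner ℝ (differentiableAt_const y))
  have h2 := ((hq v).hasFDerivAt.mul (hq w).hasFDerivAt).const_sub ⟪v, w⟫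
  have h3 := h1.unique (h2.neg.congr_of_eventuallyEq (Eventually.of_forall fun z => by
    simp [minkowskiForm_apply]))
  have h4 := congrArg (fun L : E4 →L[ℝ] ℝ => L ζ) h3
  simpa [hv, hw] using h4

theorem fderiv_fun_sub_apply {F : Type*} [NormedAddCommGroup F] [NormedSpace ℝ F] {f g : E4 → F}
    {z : E4} (hf : DifferentiableAt ℝ f z) (hg : DifferentiableAt ℝ g z) (ζ : E4) :
    fderiv ℝ (fun z => f z - g z) z ζ = fderiv ℝ f z ζ - fderiv ℝ g z ζ := by
  rw [fderiv_fun_sub hf hg, sub_apply]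

theorem inv_smul_sub_smul_add {F : Type*} [AddCommGroup F] [Module ℝ F] {r : ℝ} (hr : r ≠ 0)
    (a b : F) : r⁻¹ • (a - r • b) + b = r⁻¹ • a := by
  rw [smul_sub, inv_smul_smul₀ hr, sub_add_cancel]

namespace IsKillingNearInfinity

variable {T : Set E4} {G : E4 → E4 →L[ℝ] E4 →L[ℝ] ℝ} {V : E4 → E4} {F : E4 → ℝ}

/-- The Killing equation, split into the contributions of the Minkowski metric and of the
perturbation. -/
theorem killing_split (h : IsKillingNearInfinity T G V) (u : ℝ) {x : E3} (hx : x ≠ 0) :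
    ∀ᶠ r : ℝ in atTop, ∀ v w : E4,
      fderiv ℝ minkowskiForm (u, x) ((V (u, r • x)).1, r⁻¹ • (V (u, r • x)).2) v w
      + fderiv ℝ (fun z : E4 => (fun z => G z - minkowskiForm z) (z.1, r • z.2)) (u, x)
          ((V (u, r • x)).1, r⁻¹ • (V (u, r • x)).2) v w
      + (minkowskiForm (u, r • x) (fderiv ℝ V (u, r • x) v) w
        + (G (u, r • x) - minkowskiForm (u, r • x)) (fderiv ℝ V (u, r • x) v) w)
      + (minkowskiForm (u, r • x) (fderiv ℝ V (u, r • x) w) v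
        + (G (u, r • x) - minkowskiForm (u, r • x)) (fderiv ℝ V (u, r • x) w) v) = 0 := by
  filter_upwards [eventually_gt_atTop 0, h.eventually_mem u hx] with r hr hT v w
  have hm := differentiableAt_minkowskiForm (z := (u, r • x)) (smul_ne_zero hr.ne' hx)
  have hS : radialScale r ((V (u, r • x)).1, r⁻¹ • (V (u, r • x)).2) = V (u, r • x) :=
    Prod.ext rfl (smul_inv_smul₀ hr.ne' _)
  have h1 := fderiv_radialScale (h := minkowskiForm) hm
  simp only [minkowskiForm_scale hr] at h1
  rw [fderiv_radialScale (h := fun z => G z - minkowskiForm z) ((h.diffG _ hT).sub hm)]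
  have h2 : fderiv ℝ minkowskiForm (u, x) = fderiv ℝ (fun z => minkowskiForm z) (u, x) := rfl
  rw [h2, h1]
  simp only [ContinuousLinearMap.comp_apply, hS, sub_apply]
  rw [fderiv_fun_sub_apply (F := E4 →L[ℝ] E4 →L[ℝ] ℝ) (h.diffG _ hT) hm]
  simp only [sub_apply]
  have h3 := h.killing _ hT v w
  rw [h.symm _ v] at h3
  linarith

theorem exists_angular_field (h : IsKillingNearInfinity T G V) (hF : IsBoundaryTime V F) :
    ∃ C : E4 → E3, (∀ z : E4, z.2 ≠ 0 → DifferentiableAt ℝ C z) ∧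
      (∀ u y, ∀ s : ℝ, 0 < s → C (u, s • y) = C (u, y)) ∧
      ∀ u, ∀ x ∈ S2, ⟪x, C (u, x)⟫ = -fderiv ℝ F (u, x) (1, 0) ∧
        Tendsto (fun r : ℝ => r⁻¹ • (V (u, r • x)).2) atTop (𝓝 (C (u, x))) ∧
        ∀ w : E4, ⟪x, w.2⟫ = 0 → Tendsto (fun r : ℝ =>
          r⁻¹ • (fderiv ℝ V (u, r • x) (w.1, r • w.2)).2) atTop (𝓝 (fderiv ℝ C (u, x) w)) := by
  obtain ⟨N, c, hc, hom, hpl⟩ := h.poly.exists_leading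
  have hlead : ∀ u, ∀ x ∈ S2, ⟪x, (c 0 (u, x)).2⟫ = -fderiv ℝ F (u, x) (1, 0) ∧
      ∀ j < N + 1, j ≠ 0 → (c j (u, x)).2 = 0 := fun u x hx =>
    h.leading_coefficients hF hx (leading_value hom hx (hpl u x hx).1)
      (h.leading_radial_derivative hc hom hx (hpl u x hx).2)
  have hvan : ∀ z : E4, z.2 ≠ 0 → ∀ j < N + 1, j ≠ 0 → (c j z).2 = 0 := by
    rintro ⟨u, y⟩ hy j hj hj0
    have hy' : 0 < ‖y‖ := norm_pos_iff.2 hy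
    have hx : ‖y‖⁻¹ • y ∈ S2 := by
      simp [S2, norm_smul, hy'.ne']
    rw [← (hlead u _ hx).2 j hj hj0, hom _ _ _ _ (inv_pos.2 hy')]
  obtain ⟨C, hCc⟩ : ∃ C : E4 → E3, ∀ z, C z = (c 0 z).2 := ⟨_, fun _ => rfl⟩
  have hsum : ∀ (z : E4) (l : ℝ), z.2 ≠ 0 →
      (∑ j ∈ Finset.range (N + 1), l ^ j • c j z).2 = C z := by
    intro z l hz
    rw [hCc, Prod.snd_sum, Finset.sum_eq_single 0]
    · simp
    · intro j hj hj0
      rw [Prod.smul_snd, hvan z hz j (Finset.mem_range.1 hj) hj0, smul_zero]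
    · simp
  have hC : ∀ z : E4, z.2 ≠ 0 → DifferentiableAt ℝ C z := fun z hz => by
    rw [funext hCc]
    exact (hc 0 z hz).snd
  refine ⟨C, hC, fun u y s hs => by rw [hCc, hCc, hom _ _ _ s hs],
    fun u x hx => ⟨by rw [hCc]; exact (hlead u x hx).1, ?_, fun w hw => ?_⟩⟩
  · have h0 : IsPolylog fun r : ℝ => V (u, r • x)
        - r • ∑ j ∈ Finset.range (N + 1), Real.log r ^ j • c j (u, x) :=
      leading_value hom hx (hpl u x hx).1
    have h1 := h0.snd.tendsto_inv_smul.add_const (C (u, x))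
    rw [zero_add] at h1
    refine h1.congr' ?_
    filter_upwards [eventually_gt_atTop 0] with r hr
    rw [Prod.snd_sub, Prod.smul_snd, hsum (u, x) _ (ne_zero_of_mem_S2 hx),
      inv_smul_sub_smul_add hr.ne']
  · have hx0 := ne_zero_of_mem_S2 hx
    have h1 := ((hpl u x hx).2.clm_apply (IsPolylog.const w)).snd.tendsto_inv_smul.add_const
      (fderiv ℝ C (u, x) w)
    rw [zero_add] at h1
    refine h1.congr' ?_
    filter_upwards [eventually_gt_atTop 0, h.eventually_mem u hx0] with r hr hT
    have hr0 : r • x ≠ 0 := smul_ne_zero hr.ne' hx0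
    have hdR : DifferentiableAt ℝ (fun z : E4 => V z - ‖z.2‖ •
          ∑ j ∈ Finset.range (N + 1), Real.log ‖z.2‖ ^ j • c j z) (u, r • x) := by
      have hn : DifferentiableAt ℝ (fun z : E4 => ‖z.2‖) (u, r • x) :=
        differentiableAt_snd.norm ℝ hr0
      have hl : DifferentiableAt ℝ (fun z : E4 => Real.log ‖z.2‖) (u, r • x) :=
        hn.log (norm_ne_zero_iff.2 hr0)
      exact (h.diffV _ hT).sub (hn.smul (DifferentiableAt.fun_sum fun j _ =>
        (hl.pow j).smul (hc j _ hr0)))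
    have d1 := (differentiableAt_radialScale hdR).hasFDerivAt.snd
    have d2 := (differentiableAt_radialScale (h.diffV _ hT)).hasFDerivAt.snd
    have hn : HasFDerivAt (fun z : E4 => r * ‖z.2‖) (r • (‖x‖⁻¹ • innerSL ℝ x).comp
        (ContinuousLinearMap.snd ℝ ℝ E3)) (u, x) :=
      ((hasFDerivAt_norm_of_ne_zero hx0).comp (u, x) hasFDerivAt_snd).const_mul r
    have d3 := d2.sub (hn.smul (hC (u, x) hx0).hasFDerivAt)
    have hne : ∀ᶠ z : E4 in 𝓝 (u, x), z.2 ≠ 0 :=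
      (isOpen_ne_fun continuous_snd continuous_const).mem_nhds hx0
    have d4 := d1.unique (d3.congr_of_eventuallyEq (hne.mono fun z hz => by
      simp only [Prod.snd_sub, Prod.smul_snd]
      rw [hsum (z.1, r • z.2) _ (smul_ne_zero hr.ne' hz), hCc, hom _ _ _ r hr, ← hCc,
        norm_smul, Real.norm_of_nonneg hr.le]
      rfl))
    have d5 := congrArg (fun L : E4 →L[ℝ] E3 => r⁻¹ • L w) d4
    rw [fderiv_radialScale (h.diffV _ hT)] at d5
    simp [hw, norm_of_mem_S2 hx, smul_sub, hr.ne'] at d5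
    rw [d5, sub_add_cancel]

end IsKillingNearInfinity

theorem IsPolylog.map_clm {F F' : Type*} [NormedAddCommGroup F] [NormedAddCommGroup F']
    [NormedSpace ℝ F] [NormedSpace ℝ F'] {f : ℝ → F} (hf : IsPolylog f) (L : F →L[ℝ] F') :
    IsPolylog fun r => L (f r) :=
  (IsPolylog.const L).clm_apply hf

namespace IsKillingNearInfinity

variable {T : Set E4} {G : E4 → E4 →L[ℝ] E4 →L[ℝ] ℝ} {V : E4 → E4} {F : E4 → ℝ} {C : E4 → E3}

theorem perturbation_tendsto_zero (h : IsKillingNearInfinity T G V) (u : ℝ) {x : E3} (hx : x ∈ S2)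
    {a : ℝ → E4} (ha : IsPolylog a) (w : E4) :
    Tendsto (fun r : ℝ => (G (u, r • x) - minkowskiForm (u, r • x)) (a r) w) atTop (𝓝 0) := by
  have p1 := ((h.flat.isPolylog u hx).1.clm_apply ha).clm_apply (IsPolylog.const w)
  refine IsPolylog.tendsto_zero (p1.congr (Eventually.of_forall fun r => ?_))
  simp

theorem perturbation_fderiv_tendsto_zero (h : IsKillingNearInfinity T G V) (u : ℝ) {x : E3}
    (hx : x ∈ S2) {ζ : ℝ → E4} (hζ : IsPolylog ζ) (v w : E4) :
    Tendsto (fun r : ℝ => fderiv ℝ (fun z : E4 => (fun z => G z - minkowskiForm z)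
      (z.1, r • z.2)) (u, x) (ζ r) v w) atTop (𝓝 0) := by
  have p1 := (((h.flat.isPolylog u hx).2.clm_apply hζ).clm_apply (IsPolylog.const v)).clm_apply
    (IsPolylog.const w)
  refine IsPolylog.tendsto_zero (p1.congr (Eventually.of_forall fun r => ?_))
  simp

theorem scaled_isPolylog (hF : IsBoundaryTime V F) {u : ℝ} {x : E3} (hx : x ∈ S2)
    (hlim : Tendsto (fun r : ℝ => r⁻¹ • (V (u, r • x)).2) atTop (𝓝 (C (u, x)))) :
    IsPolylog fun r : ℝ => ((V (u, r • x)).1, r⁻¹ • (V (u, r • x)).2) :=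
  (((IsPolylog.const (F (u, x))).congr
    (boundaryTime_fst hF u (ne_zero_of_mem_S2 hx))).prodMk (IsPolylog.of_tendsto hlim))

theorem tangential_derivative_tendsto
    (h : IsKillingNearInfinity T G V) (hF : IsBoundaryTime V F) {u : ℝ} {x : E3} (hx : x ∈ S2)
    (hder : ∀ w : E4, ⟪x, w.2⟫ = 0 → Tendsto (fun r : ℝ =>
      r⁻¹ • (fderiv ℝ V (u, r • x) (w.1, r • w.2)).2) atTop (𝓝 (fderiv ℝ C (u, x) w)))
    {v : E3} (hv : ⟪x, v⟫ = 0) :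
    Tendsto (fun r : ℝ => fderiv ℝ V (u, r • x) (0, v)) atTop
      (𝓝 ((0 : ℝ), fderiv ℝ C (u, x) (0, v))) := by
  refine Tendsto.prodMk_nhds (f := atTop) ?_ ?_
  · refine (IsPolylog.const (fderiv ℝ F (u, x) (0, v))).tendsto_inv_smul.congr' ?_
    filter_upwards [h.boundaryTime_fderiv hF u (ne_zero_of_mem_S2 hx)] with r hr
    change r⁻¹ • _ = (fderiv ℝ V (u, r • x) (0, v)).1
    rw [hr, ← map_smul]
    simp
  · refine (hder (0, v) hv).congr' ?_
    filter_upwards [eventually_gt_atTop 0] with r hr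
    have : ((0 : ℝ), r • v) = r • ((0 : ℝ), v) := by simp
    simp only [this, map_smul, Prod.smul_snd, inv_smul_smul₀ hr.ne']
    rfl

theorem conformal_equation
    (h : IsKillingNearInfinity T G V) (hF : IsBoundaryTime V F) {u : ℝ} {x : E3} (hx : x ∈ S2)
    (hlim : Tendsto (fun r : ℝ => r⁻¹ • (V (u, r • x)).2) atTop (𝓝 (C (u, x))))
    (hder : ∀ w : E4, ⟪x, w.2⟫ = 0 → Tendsto (fun r : ℝ =>
      r⁻¹ • (fderiv ℝ V (u, r • x) (w.1, r • w.2)).2) atTop (𝓝 (fderiv ℝ C (u, x) w)))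
    {v w : E3} (hv : ⟪x, v⟫ = 0) (hw : ⟪x, w⟫ = 0) :
    ⟪fderiv ℝ C (u, x) (0, v), w⟫ + ⟪v, fderiv ℝ C (u, x) (0, w)⟫ = 0 := by
  have a := h.tangential_derivative_tendsto hF hx hder hv
  have b := h.tangential_derivative_tendsto hF hx hder hw
  have a2 : Tendsto (fun r : ℝ => ⟪(fderiv ℝ V (u, r • x) (0, v)).2, w⟫) atTop
      (𝓝 ⟪fderiv ℝ C (u, x) (0, v), w⟫) :=
    ((continuous_snd.tendsto _).comp a).inner tendsto_const_nhds
  have b2 : Tendsto (fun r : ℝ => ⟪v, (fderiv ℝ V (u, r • x) (0, w)).2⟫) atTop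
      (𝓝 ⟪v, fderiv ℝ C (u, x) (0, w)⟫) :=
    tendsto_const_nhds.inner ((continuous_snd.tendsto _).comp b)
  have p := h.perturbation_fderiv_tendsto_zero u hx (scaled_isPolylog hF hx hlim) (0, v) (0, w)
  have pa := h.perturbation_tendsto_zero u hx (IsPolylog.of_tendsto a) (0, w)
  have pb := h.perturbation_tendsto_zero u hx (IsPolylog.of_tendsto b) (0, v)
  have l := (p.add pa).add pb
  simp only [add_zero] at l
  refine tendsto_nhds_unique ((a2.add b2).congr' ?_) l
  have hx0 := ne_zero_of_mem_S2 hx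
  filter_upwards [h.killing_split u hx0, eventually_gt_atTop 0] with r hr hr0
  have k := hr (0, v) (0, w)
  rw [fderiv_minkowskiForm_tangential u hx0 hv hw, minkowskiForm_radial hr0 hx,
    minkowskiForm_radial hr0 hx] at k
  simp only [hv, hw, mul_zero, add_zero, sub_zero] at k
  rw [real_inner_comm _ v]
  linarith

theorem stationary_equation
    (h : IsKillingNearInfinity T G V) (hF : IsBoundaryTime V F) {u : ℝ} {x : E3} (hx : x ∈ S2)
    (hlim : Tendsto (fun r : ℝ => r⁻¹ • (V (u, r • x)).2) atTop (𝓝 (C (u, x))))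
    (hder : ∀ w : E4, ⟪x, w.2⟫ = 0 → Tendsto (fun r : ℝ =>
      r⁻¹ • (fderiv ℝ V (u, r • x) (w.1, r • w.2)).2) atTop (𝓝 (fderiv ℝ C (u, x) w)))
    {w : E3} (hw : ⟪x, w⟫ = 0) :
    ⟪fderiv ℝ C (u, x) (1, 0), w⟫ = 0 := by
  have hx0 := ne_zero_of_mem_S2 hx
  have b := h.tangential_derivative_tendsto hF hx hder hw
  have a : Tendsto (fun r : ℝ => r⁻¹ • fderiv ℝ V (u, r • x) (1, 0)) atTop
      (𝓝 ((0 : ℝ), fderiv ℝ C (u, x) (1, 0))) := by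
    refine Tendsto.prodMk_nhds (f := atTop) ?_ ?_
    · refine (IsPolylog.const (fderiv ℝ F (u, x) (1, 0))).tendsto_inv_smul.congr' ?_
      filter_upwards [h.boundaryTime_fderiv hF u hx0] with r hr
      simp [hr]
    · refine (hder (1, 0) (by simp)).congr' ?_
      filter_upwards [eventually_gt_atTop 0] with r hr
      simp
  have a2 : Tendsto (fun r : ℝ => ⟪(r⁻¹ • fderiv ℝ V (u, r • x) (1, 0)).2, w⟫) atTop
      (𝓝 ⟪fderiv ℝ C (u, x) (1, 0), w⟫) :=
    ((continuous_snd.tendsto _).comp a).inner tendsto_const_nhds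
  have hζ := scaled_isPolylog hF hx hlim
  have p1 := ((hζ.map_clm (fderiv ℝ minkowskiForm (u, x))).clm_apply
    (IsPolylog.const ((1 : ℝ), (0 : E3)))).clm_apply (IsPolylog.const ((0 : ℝ), w))
  have p2 := IsPolylog.of_tendsto
    (h.perturbation_fderiv_tendsto_zero u hx hζ (1, 0) (0, w))
  have p3 := IsPolylog.of_tendsto
    (h.perturbation_tendsto_zero u hx (IsPolylog.of_tendsto b) (1, 0))
  have p4 : IsPolylog fun r : ℝ => (fderiv ℝ V (u, r • x) (0, w)).1
      + ⟪x, (fderiv ℝ V (u, r • x) (0, w)).2⟫ :=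
    IsPolylog.of_tendsto (((continuous_fst.tendsto _).comp b).add
      (tendsto_const_nhds.inner ((continuous_snd.tendsto _).comp b)))
  have pa := h.perturbation_tendsto_zero u hx (IsPolylog.of_tendsto a) (0, w)
  have l := (((p1.add p2).add (p3.add p4)).tendsto_inv_smul).add pa
  simp only [add_zero] at l
  refine tendsto_nhds_unique (a2.congr' ?_) l
  filter_upwards [h.killing_split u hx0, eventually_gt_atTop 0] with r hr hr0
  have k := hr (1, 0) (0, w)
  rw [minkowskiForm_radial hr0 hx, minkowskiForm_radial hr0 hx] at k
  simp only [hw, mul_zero, add_zero, sub_zero, inner_zero_right, mul_one] at k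
  simp only [map_smul, smul_apply, smul_eq_mul, Prod.smul_snd, real_inner_smul_left,
    ← mul_add]
  congr 1
  linarith

/-- The restriction of a Killing field to null infinity is given by a function `F` and a field `C`
of vectors of `ℝ³` which satisfy the conformal Killing equations of null infinity. -/
theorem exists_boundary_field (h : IsKillingNearInfinity T G V) :
    ∃ (F : E4 → ℝ) (C : E4 → E3), (∀ z : E4, z.2 ≠ 0 → DifferentiableAt ℝ F z) ∧
      (∀ z : E4, z.2 ≠ 0 → DifferentiableAt ℝ C z) ∧
      (∀ u y, ∀ s : ℝ, 0 < s → C (u, s • y) = C (u, y)) ∧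
      ∀ u, ∀ x ∈ S2, Tendsto (fun r : ℝ => (V (u, r • x)).1) atTop (𝓝 (F (u, x))) ∧
        Tendsto (fun r : ℝ => r⁻¹ • (V (u, r • x)).2) atTop (𝓝 (C (u, x))) ∧
        ⟪x, C (u, x)⟫ = -fderiv ℝ F (u, x) (1, 0) ∧
        (∀ w, ⟪x, w⟫ = 0 → ⟪fderiv ℝ C (u, x) (1, 0), w⟫ = 0) ∧
        ∀ v w, ⟪x, v⟫ = 0 → ⟪x, w⟫ = 0 →
          ⟪fderiv ℝ C (u, x) (0, v), w⟫ + ⟪v, fderiv ℝ C (u, x) (0, w)⟫ = 0 := by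
  obtain ⟨F, hF⟩ := h.exists_boundary_time
  obtain ⟨C, hC, hom, hCx⟩ := h.exists_angular_field hF
  refine ⟨F, C, fun z hz => h.boundaryTime_differentiableAt hF z.1 hz, hC, hom, fun u x hx => ?_⟩
  obtain ⟨h1, h2, h3⟩ := hCx u x hx
  refine ⟨?_, h2, h1, fun w hw => h.stationary_equation hF hx h2 h3 hw,
    fun v w hv hw => h.conformal_equation hF hx h2 h3 hv hw⟩
  exact tendsto_const_nhds.congr'
    ((boundaryTime_fst hF u (ne_zero_of_mem_S2 hx)).mono fun r hr => hr.symm)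

end IsKillingNearInfinity

/-! ### Conformal Killing fields of the sphere -/

theorem inner_vec3 (a b c : ℝ) (y : E3) : ⟪!₂[a, b, c], y⟫ = a * y 0 + b * y 1 + c * y 2 := by
  simp [PiLp.inner_apply, Fin.sum_univ_three]
  ring

theorem inner_vec3_right (a b c : ℝ) (y : E3) :
    ⟪y, !₂[a, b, c]⟫ = a * y 0 + b * y 1 + c * y 2 := by
  rw [real_inner_comm, inner_vec3]

theorem vec3_eq_sum (a b c : ℝ) : (!₂[a, b, c] : E3) =
    a • EuclideanSpace.single 0 1 + b • EuclideanSpace.single 1 1 + c • EuclideanSpace.single 2 1 := by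
  ext i
  fin_cases i <;> simp

theorem hasDerivAt_vec3 {f g h : ℝ → ℝ} {f' g' h' t : ℝ} (hf : HasDerivAt f f' t)
    (hg : HasDerivAt g g' t) (hh : HasDerivAt h h' t) :
    HasDerivAt (fun t => (!₂[f t, g t, h t] : E3)) !₂[f', g', h'] t := by
  simp only [vec3_eq_sum]
  exact ((hf.smul_const _).add (hg.smul_const _)).add (hh.smul_const _)

theorem exists_orthonormalBasis_two {q : E3} (hq : q ∈ S2) :
    ∃ e : OrthonormalBasis (Fin 3) ℝ E3, e 2 = q := by
  have h : Orthonormal ℝ (({2} : Set (Fin 3)).domRestrict fun _ : Fin 3 => q) := by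
    refine ⟨fun i => norm_of_mem_S2 hq, fun i j hij => ?_⟩
    exact absurd (Subsingleton.elim i j) hij
  obtain ⟨e, he⟩ := h.exists_orthonormalBasis_extension_of_card_eq (by simp)
  exact ⟨e, he 2 rfl⟩

/-- The vector field `c` along the sphere, a homogeneous function of degree zero, satisfies the
conformal Killing equation, its radial component being minus the conformal factor. -/
structure IsConformalField (c : E3 → E3) : Prop where
  diff : ∀ y, y ≠ 0 → DifferentiableAt ℝ c y
  hom : ∀ y, ∀ s : ℝ, 0 < s → c (s • y) = c y
  conformal : ∀ x ∈ S2, ∀ v w, ⟪x, v⟫ = 0 → ⟪x, w⟫ = 0 →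
    ⟪fderiv ℝ c x v, w⟫ + ⟪v, fderiv ℝ c x w⟫ = 0

/-- The vector `(2 Re z, 2 Im z, |z|² - 1)` in the direction of the point with stereographic
coordinate `z`. -/
def stereoDir (z : ℂ) : E3 := !₂[2 * z.re, 2 * z.im, z.re ^ 2 + z.im ^ 2 - 1]

/-- A tangent vector to the sphere in the direction of the real axis of the stereographic chart. -/
def stereoRe (z : ℂ) : E3 := !₂[(1 - z.re ^ 2 + z.im ^ 2) / 2, -(z.re * z.im), z.re]

/-- A tangent vector to the sphere in the direction of the imaginary axis of the stereographic
chart. -/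
def stereoIm (z : ℂ) : E3 := !₂[-(z.re * z.im), (1 + z.re ^ 2 - z.im ^ 2) / 2, z.im]

theorem norm_stereoDir (z : ℂ) : ‖stereoDir z‖ = 1 + z.re ^ 2 + z.im ^ 2 := by
  rw [stereoDir, EuclideanSpace.norm_eq, Real.sqrt_eq_iff_mul_self_eq (by positivity) (by positivity)]
  simp [Fin.sum_univ_three]
  ring

theorem stereoDir_ne_zero (z : ℂ) : stereoDir z ≠ 0 := by
  rw [← norm_ne_zero_iff, norm_stereoDir]
  positivity

/-- The inverse of the stereographic projection. -/
def stereoPoint (z : ℂ) : E3 := (1 + z.re ^ 2 + z.im ^ 2)⁻¹ • stereoDir z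

theorem stereoPoint_mem (z : ℂ) : stereoPoint z ∈ S2 := by
  have h : 0 < 1 + z.re ^ 2 + z.im ^ 2 := by positivity
  simp [S2, stereoPoint, norm_smul, norm_stereoDir, abs_of_pos h, h.ne']

theorem inner_stereoPoint_stereoRe (z : ℂ) : ⟪stereoPoint z, stereoRe z⟫ = 0 := by
  rw [stereoPoint, real_inner_smul_left, stereoDir, inner_vec3]
  simp [stereoRe]
  right
  ring

theorem inner_stereoPoint_stereoIm (z : ℂ) : ⟪stereoPoint z, stereoIm z⟫ = 0 := by
  rw [stereoPoint, real_inner_smul_left, stereoDir, inner_vec3]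
  simp [stereoIm]
  right
  ring

/-- The stereographic coordinates of a field of vectors along the sphere. -/
def stereoField (c : E3 → E3) (z : ℂ) : ℂ :=
  ((⟪stereoRe z, c (stereoDir z)⟫ : ℝ) : ℂ) + ((⟪stereoIm z, c (stereoDir z)⟫ : ℝ) : ℂ) * Complex.I

namespace IsConformalField

variable {c : E3 → E3}

theorem fderiv_smul (h : IsConformalField c) {y : E3} (hy : y ≠ 0) {s : ℝ} (hs : 0 < s) :
    fderiv ℝ c y = s • fderiv ℝ c (s • y) := by
  have h1 : HasFDerivAt (fun y : E3 => s • y) (s • ContinuousLinearMap.id ℝ E3) y :=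
    (hasFDerivAt_id y).const_smul s
  have h2 := (h.diff (s • y) (smul_ne_zero hs.ne' hy)).hasFDerivAt.comp y h1
  have h3 : c ∘ (fun y : E3 => s • y) = c := funext fun y => h.hom y s hs
  rw [h3] at h2
  rw [h2.fderiv]
  ext v
  simp

theorem fderiv_self (h : IsConformalField c) {y : E3} (hy : y ≠ 0) : fderiv ℝ c y y = 0 := by
  have h1 : HasDerivAt (fun s : ℝ => s • y) y 1 := by
    simpa using (hasDerivAt_id (1 : ℝ)).smul_const y
  have h2 : HasDerivAt (fun s : ℝ => c (s • y)) (fderiv ℝ c y y) 1 :=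
    HasFDerivAt.comp_hasDerivAt_of_eq 1 (h.diff y hy).hasFDerivAt h1 (by simp)
  refine h2.unique ((hasDerivAt_const 1 (c y)).congr_of_eventuallyEq ?_)
  filter_upwards [eventually_gt_nhds zero_lt_one] with s hs using h.hom y s hs

theorem conformal_stereo (h : IsConformalField c) (z : ℂ) {v w : E3}
    (hv : ⟪stereoPoint z, v⟫ = 0) (hw : ⟪stereoPoint z, w⟫ = 0) :
    ⟪fderiv ℝ c (stereoDir z) v, w⟫ + ⟪v, fderiv ℝ c (stereoDir z) w⟫ = 0 := by
  have h1 : 0 < (1 + z.re ^ 2 + z.im ^ 2)⁻¹ := by positivity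
  rw [h.fderiv_smul (stereoDir_ne_zero z) h1]
  simp only [smul_apply, real_inner_smul_left, real_inner_smul_right, ← mul_add]
  have := h.conformal _ (stereoPoint_mem z) v w hv hw
  rw [stereoPoint] at this
  rw [this, mul_zero]

theorem differentiable_stereoField (h : IsConformalField c) :
    Differentiable ℝ (stereoField c) := by
  have hN : Differentiable ℝ stereoDir := differentiable_euclidean.2 fun i => by
    fin_cases i <;> simp [stereoDir] <;> fun_prop
  have h1 : Differentiable ℝ stereoRe := differentiable_euclidean.2 fun i => by
    fin_cases i <;> simp [stereoRe] <;> fun_prop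
  have h2 : Differentiable ℝ stereoIm := differentiable_euclidean.2 fun i => by
    fin_cases i <;> simp [stereoIm] <;> fun_prop
  have h3 : Differentiable ℝ fun z => c (stereoDir z) := fun z =>
    (h.diff _ (stereoDir_ne_zero z)).comp z (hN z)
  have h4 : Differentiable ℝ fun z => ⟪stereoRe z, c (stereoDir z)⟫ := h1.inner ℝ h3
  have h5 : Differentiable ℝ fun z => ⟪stereoIm z, c (stereoDir z)⟫ := h2.inner ℝ h3
  exact (Complex.ofRealCLM.differentiable.comp h4).add
    ((Complex.ofRealCLM.differentiable.comp h5).mul_const _)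

end IsConformalField

namespace IsConformalField

variable {c : E3 → E3}

theorem fderiv_stereoField (h : IsConformalField c) {z w : ℂ} {N' R' I' : E3}
    (hN : HasDerivAt (fun t : ℝ => stereoDir (z + t • w)) N' 0)
    (hR : HasDerivAt (fun t : ℝ => stereoRe (z + t • w)) R' 0)
    (hI : HasDerivAt (fun t : ℝ => stereoIm (z + t • w)) I' 0) :
    fderiv ℝ (stereoField c) z w =
      ((⟪stereoRe z, fderiv ℝ c (stereoDir z) N'⟫ + ⟪R', c (stereoDir z)⟫ : ℝ) : ℂ)
      + ((⟪stereoIm z, fderiv ℝ c (stereoDir z) N'⟫ + ⟪I', c (stereoDir z)⟫ : ℝ) : ℂ)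
        * Complex.I := by
  have h1 := (h.differentiable_stereoField z).hasFDerivAt.hasLineDerivAt w
  have h2 : HasDerivAt (fun t : ℝ => c (stereoDir (z + t • w)))
      (fderiv ℝ c (stereoDir z) N') 0 :=
    HasFDerivAt.comp_hasDerivAt_of_eq 0 (h.diff _ (stereoDir_ne_zero z)).hasFDerivAt hN (by simp)
  have h3 := (hR.inner ℝ h2).ofReal_comp.add ((hI.inner ℝ h2).ofReal_comp.mul_const Complex.I)
  have h4 := HasDerivAt.unique h1 h3
  simpa using h4

theorem differentiable_complex_stereoField (h : IsConformalField c) :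
    Differentiable ℂ (stereoField c) := by
  intro z
  refine differentiableAt_complex_iff_differentiableAt_real.2
    ⟨h.differentiable_stereoField z, ?_⟩
  have hid : HasDerivAt (fun t : ℝ => t) 1 0 := hasDerivAt_id 0
  have hre : HasDerivAt (fun t : ℝ => z.re + t) 1 0 := hid.const_add _
  have him : HasDerivAt (fun t : ℝ => z.im + t) 1 0 := hid.const_add _
  have cre : HasDerivAt (fun _ : ℝ => z.re) 0 0 := hasDerivAt_const _ _
  have cim : HasDerivAt (fun _ : ℝ => z.im) 0 0 := hasDerivAt_const _ _
  have e1 := h.fderiv_stereoField (z := z) (w := 1) (N' := !₂[2, 0, 2 * z.re])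
    (R' := !₂[-z.re, -z.im, 1]) (I' := !₂[-z.im, z.re, 0])
    (by
      simpa [stereoDir] using! hasDerivAt_vec3 (hre.const_mul 2) (cim.const_mul 2)
        (((hre.pow 2).add (cim.pow 2)).sub_const 1))
    (by
      have := hasDerivAt_vec3 ((((hre.pow 2).const_sub 1).add (cim.pow 2)).div_const 2)
        (hre.mul cim).neg hre
      simpa [stereoRe, neg_div] using! this)
    (by
      have := hasDerivAt_vec3 (hre.mul cim).neg ((((hre.pow 2).const_add 1).sub
        (cim.pow 2)).div_const 2) cim
      simpa [stereoIm] using! this)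
  have e2 := h.fderiv_stereoField (z := z) (w := Complex.I) (N' := !₂[0, 2, 2 * z.im])
    (R' := !₂[z.im, -z.re, 0]) (I' := !₂[-z.re, -z.im, 1])
    (by
      simpa [stereoDir] using! hasDerivAt_vec3 (cre.const_mul 2) (him.const_mul 2)
        (((cre.pow 2).add (him.pow 2)).sub_const 1))
    (by
      have := hasDerivAt_vec3 ((((cre.pow 2).const_sub 1).add (him.pow 2)).div_const 2)
        (cre.mul him).neg cre
      simpa [stereoRe] using! this)
    (by
      have := hasDerivAt_vec3 (cre.mul him).neg ((((cre.pow 2).const_add 1).sub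
        (him.pow 2)).div_const 2) him
      simpa [stereoIm, neg_div] using! this)
  set D : ℝ := 1 + z.re ^ 2 + z.im ^ 2 with hD
  have hD0 : D ≠ 0 := by positivity
  have n1 : (!₂[2, 0, 2 * z.re] : E3) = (4 / D) • stereoRe z + (2 * z.re / D) • stereoDir z := by
    ext i
    fin_cases i <;> simp [stereoRe, stereoDir] <;> field_simp <;> simp only [hD] <;> ring
  have n2 : (!₂[0, 2, 2 * z.im] : E3) = (4 / D) • stereoIm z + (2 * z.im / D) • stereoDir z := by
    ext i
    fin_cases i <;> simp [stereoIm, stereoDir] <;> field_simp <;> simp only [hD] <;> ring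
  have hz := h.fderiv_self (stereoDir_ne_zero z)
  have k1 := h.conformal_stereo z (inner_stereoPoint_stereoRe z) (inner_stereoPoint_stereoRe z)
  have k2 := h.conformal_stereo z (inner_stereoPoint_stereoIm z) (inner_stereoPoint_stereoIm z)
  have k3 := h.conformal_stereo z (inner_stereoPoint_stereoRe z) (inner_stereoPoint_stereoIm z)
  rw [n1] at e1
  rw [n2] at e2
  rw [real_inner_comm] at k1 k2 k3
  have a1 : ⟪stereoIm z, fderiv ℝ c (stereoDir z) (stereoIm z)⟫ = 0 := by linarith
  have a2 : ⟪stereoRe z, fderiv ℝ c (stereoDir z) (stereoRe z)⟫ = 0 := by linarith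
  have a3 : ⟪stereoIm z, fderiv ℝ c (stereoDir z) (stereoRe z)⟫ =
    -⟪stereoRe z, fderiv ℝ c (stereoDir z) (stereoIm z)⟫ := by linarith
  rw [e1, e2]
  simp only [map_add, map_smul, hz, smul_zero, add_zero, inner_vec3, inner_smul_right, a1, a2, a3]
  apply Complex.ext
  · simp
    ring
  · simp

theorem exists_bound (h : IsConformalField c) : ∃ M : ℝ, 0 ≤ M ∧ ∀ y, y ≠ 0 → ‖c y‖ ≤ M := by
  have hc : ContinuousOn c S2 := fun x hx =>
    (h.diff x (ne_zero_of_mem_S2 hx)).continuousAt.continuousWithinAt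
  obtain ⟨M, hM⟩ := (isCompact_sphere (0 : E3) 1).exists_bound_of_continuousOn hc
  refine ⟨|M|, abs_nonneg _, fun y hy => ?_⟩
  have hy' : 0 < ‖y‖ := norm_pos_iff.2 hy
  rw [← h.hom y _ (inv_pos.2 hy')]
  refine (hM _ ?_).trans (le_abs_self _)
  simp [norm_smul, hy'.ne']

end IsConformalField

theorem norm_stereoRe (z : ℂ) : ‖stereoRe z‖ = (1 + z.re ^ 2 + z.im ^ 2) / 2 := by
  rw [stereoRe, EuclideanSpace.norm_eq, Real.sqrt_eq_iff_mul_self_eq (by positivity) (by positivity)]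
  simp [Fin.sum_univ_three]
  ring

theorem norm_stereoIm (z : ℂ) : ‖stereoIm z‖ = (1 + z.re ^ 2 + z.im ^ 2) / 2 := by
  rw [stereoIm, EuclideanSpace.norm_eq, Real.sqrt_eq_iff_mul_self_eq (by positivity) (by positivity)]
  simp [Fin.sum_univ_three]
  ring

theorem IsConformalField.exists_stereoField_bound {c : E3 → E3} (h : IsConformalField c) :
    ∃ M : ℝ, ∀ z, ‖stereoField c z‖ ≤ M * (1 + ‖z‖ ^ 2) := by
  obtain ⟨M, hM0, hM⟩ := h.exists_bound
  refine ⟨M, fun z => ?_⟩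
  have hz : ‖z‖ ^ 2 = z.re ^ 2 + z.im ^ 2 := by
    rw [Complex.sq_norm, Complex.normSq_apply]; ring
  have hc := hM _ (stereoDir_ne_zero z)
  have h1 : |⟪stereoRe z, c (stereoDir z)⟫| ≤ (1 + z.re ^ 2 + z.im ^ 2) / 2 * M :=
    (abs_real_inner_le_norm _ _).trans (by rw [norm_stereoRe]; gcongr)
  have h2 : |⟪stereoIm z, c (stereoDir z)⟫| ≤ (1 + z.re ^ 2 + z.im ^ 2) / 2 * M :=
    (abs_real_inner_le_norm _ _).trans (by rw [norm_stereoIm]; gcongr)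
  refine (norm_add_le _ _).trans ?_
  rw [norm_mul, Complex.norm_I, mul_one, Complex.norm_real, Complex.norm_real, Real.norm_eq_abs,
    Real.norm_eq_abs, hz]
  linarith

/-- An entire function of at most quadratic growth is a quadratic polynomial. -/
theorem Differentiable.exists_eq_quadratic {f : ℂ → ℂ} (hf : Differentiable ℂ f) {M : ℝ}
    (hM : ∀ z, ‖f z‖ ≤ M * (1 + ‖z‖ ^ 2)) :
    ∃ α β γ : ℂ, ∀ z, f z = α + β * z + γ * z ^ 2 := by
  have hvan : ∀ n, 3 ≤ n → iteratedDeriv n f 0 = 0 := by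
    intro n hn
    have hb : ∀ R : ℝ, 0 < R → ‖iteratedDeriv n f 0‖ ≤ n.factorial * (M * (1 + R ^ 2)) / R ^ n := by
      intro R hR
      refine Complex.norm_iteratedDeriv_le_of_forall_mem_sphere_norm_le n hR hf.diffContOnCl ?_
      intro z hz
      have : ‖z‖ = R := by simpa using hz
      rw [← this]
      exact hM z
    have hlim : Tendsto (fun R : ℝ => n.factorial * (M * (1 + R ^ 2)) / R ^ n) atTop (𝓝 0) := by
      have e : ∀ᶠ R : ℝ in atTop, (n.factorial * M) * ((R ^ n)⁻¹ + (R ^ (n - 2))⁻¹)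
          = n.factorial * (M * (1 + R ^ 2)) / R ^ n := by
        filter_upwards [eventually_gt_atTop 0] with R hR
        have : R ^ n = R ^ (n - 2) * R ^ 2 := by rw [← pow_add]; congr 1; omega
        rw [this]
        field_simp
      refine Tendsto.congr' e ?_
      have t1 : Tendsto (fun R : ℝ => (R ^ n)⁻¹) atTop (𝓝 0) :=
        (tendsto_pow_atTop (by omega)).inv_tendsto_atTop
      have t2 : Tendsto (fun R : ℝ => (R ^ (n - 2))⁻¹) atTop (𝓝 0) :=
        (tendsto_pow_atTop (by omega)).inv_tendsto_atTop
      simpa using (t1.add t2).const_mul (n.factorial * M)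
    have h0 : ‖iteratedDeriv n f 0‖ ≤ 0 :=
      ge_of_tendsto hlim ((eventually_gt_atTop 0).mono hb)
    exact norm_le_zero_iff.1 h0
  refine ⟨iteratedDeriv 0 f 0, iteratedDeriv 1 f 0, 2⁻¹ * iteratedDeriv 2 f 0, fun z => ?_⟩
  rw [← Complex.taylorSeries_eq_of_entire' 0 z hf, tsum_eq_sum (s := Finset.range 3)]
  · simp [Finset.sum_range_succ]
  · intro n hn
    rw [hvan n (by simpa using hn)]
    simp

/-- `A` is an infinitesimal rotation. -/
def IsSkew (A : E3 →L[ℝ] E3) : Prop := ∀ x y, ⟪A x, y⟫ = -⟪x, A y⟫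

theorem IsSkew.inner_self {A : E3 →L[ℝ] E3} (hA : IsSkew A) (x : E3) : ⟪x, A x⟫ = 0 := by
  have := hA x x
  rw [real_inner_comm] at this
  linarith

/-- The vector product with `a`. -/
def crossMap (a : E3) : E3 →L[ℝ] E3 :=
  LinearMap.toContinuousLinearMap
    { toFun := fun x => !₂[a 1 * x 2 - a 2 * x 1, a 2 * x 0 - a 0 * x 2, a 0 * x 1 - a 1 * x 0]
      map_add' := fun x y => by ext i; fin_cases i <;> simp <;> ring
      map_smul' := fun s x => by ext i; fin_cases i <;> simp <;> ring }

theorem crossMap_apply (a x : E3) : crossMap a x =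
    !₂[a 1 * x 2 - a 2 * x 1, a 2 * x 0 - a 0 * x 2, a 0 * x 1 - a 1 * x 0] := rfl

theorem isSkew_crossMap (a : E3) : IsSkew (crossMap a) := by
  intro x y
  rw [crossMap_apply, crossMap_apply, inner_vec3, inner_vec3_right]
  ring

theorem inner_stereoRe_crossMap (a : E3) (z : ℂ) :
    ⟪stereoRe z, crossMap a (stereoPoint z)⟫ = -⟪a, stereoIm z⟫ := by
  have h : 1 + z.re ^ 2 + z.im ^ 2 ≠ 0 := by positivity
  rw [crossMap_apply, stereoRe, stereoIm, inner_vec3, inner_vec3_right]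
  simp [stereoPoint, stereoDir]
  field_simp
  ring

theorem inner_stereoIm_crossMap (a : E3) (z : ℂ) :
    ⟪stereoIm z, crossMap a (stereoPoint z)⟫ = ⟪a, stereoRe z⟫ := by
  have h : 1 + z.re ^ 2 + z.im ^ 2 ≠ 0 := by positivity
  rw [crossMap_apply, stereoRe, stereoIm, inner_vec3, inner_vec3_right]
  simp [stereoPoint, stereoDir]
  field_simp
  ring

/-- The orthogonal decomposition in the frame of the stereographic chart. -/
theorem stereo_decomposition (z : ℂ) (y : E3) :
    (1 + z.re ^ 2 + z.im ^ 2) ^ 2 • y = (4 * ⟪stereoRe z, y⟫) • stereoRe z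
      + (4 * ⟪stereoIm z, y⟫) • stereoIm z + ⟪stereoDir z, y⟫ • stereoDir z := by
  simp only [stereoRe, stereoIm, stereoDir, inner_vec3]
  ext i
  fin_cases i <;> simp <;> ring

theorem eq_stereoPoint {x : E3} (hx : x ∈ S2) (h2 : x 2 ≠ 1) :
    x = stereoPoint ⟨x 0 / (1 - x 2), x 1 / (1 - x 2)⟩ := by
  have h := inner_self_of_mem_S2 hx
  simp only [PiLp.inner_apply, Fin.sum_univ_three] at h
  simp at h
  have hd : 1 - x 2 ≠ 0 := sub_ne_zero.2 h2.symm
  have key : 1 + (x 0 / (1 - x 2)) ^ 2 + (x 1 / (1 - x 2)) ^ 2 = 2 / (1 - x 2) := by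
    field_simp
    linear_combination h
  have key2 : (x 0 / (1 - x 2)) ^ 2 + (x 1 / (1 - x 2)) ^ 2 - 1 = 2 * x 2 / (1 - x 2) := by
    have : 2 * x 2 / (1 - x 2) = 2 / (1 - x 2) - 2 := by field_simp; ring
    rw [this, ← key]
    ring
  rw [stereoPoint, stereoDir]
  simp only [key, key2]
  ext i
  fin_cases i <;> simp <;> field_simp

namespace IsConformalField

variable {c : E3 → E3}

theorem exists_tangential_eq (h : IsConformalField c) : ∃ a b : E3,
    ∀ x ∈ S2, ∀ v, ⟪x, v⟫ = 0 → ⟪v, c x⟫ = ⟪v, crossMap a x + b⟫ := by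
  obtain ⟨M, hM⟩ := h.exists_stereoField_bound
  obtain ⟨α, β, γ, hf⟩ := h.differentiable_complex_stereoField.exists_eq_quadratic hM
  set B₀ := α - γ with hB₀
  set B₁ := -(α + γ) * Complex.I with hB₁
  set a : E3 := !₂[B₀.im, B₁.im, β.im] with ha
  set b : E3 := !₂[B₀.re, B₁.re, β.re] with hb
  have hpt : ∀ z, c (stereoPoint z) = c (stereoDir z) := fun z =>
    h.hom _ _ (by positivity)
  have hz : ∀ z, ⟪stereoRe z, c (stereoPoint z) - (crossMap a (stereoPoint z) + b)⟫ = 0 ∧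
      ⟪stereoIm z, c (stereoPoint z) - (crossMap a (stereoPoint z) + b)⟫ = 0 := by
    intro z
    have h1 := hf z
    have h2 := congrArg Complex.re h1
    have h3 := congrArg Complex.im h1
    simp [stereoField, pow_two] at h2 h3
    rw [inner_sub_right, inner_sub_right, inner_add_right, inner_add_right,
      inner_stereoRe_crossMap, inner_stereoIm_crossMap, hpt, h2, h3]
    simp only [ha, hb, stereoRe, stereoIm, inner_vec3]
    simp [hB₀, hB₁]
    constructor <;> ring
  have hgen : ∀ x ∈ S2, x 2 ≠ 1 → (c x - (crossMap a x + b))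
      - ⟪x, c x - (crossMap a x + b)⟫ • x = 0 := by
    intro x hx h2
    rw [eq_stereoPoint hx h2]
    set z : ℂ := ⟨x 0 / (1 - x 2), x 1 / (1 - x 2)⟩
    set y := c (stereoPoint z) - (crossMap a (stereoPoint z) + b) with hy
    have h1 := stereo_decomposition z y
    rw [(hz z).1, (hz z).2] at h1
    have hD : 1 + z.re ^ 2 + z.im ^ 2 ≠ 0 := by positivity
    rw [stereoPoint, real_inner_smul_left, smul_smul]
    have h3 := congrArg (fun v => ((1 + z.re ^ 2 + z.im ^ 2) ^ 2)⁻¹ • v) h1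
    simp only [inv_smul_smul₀ (pow_ne_zero 2 hD), mul_zero, zero_smul, zero_add, smul_smul] at h3
    nth_rewrite 1 [h3]
    rw [sub_eq_zero]
    congr 1
    field_simp
  have hall : ∀ x ∈ S2, (c x - (crossMap a x + b))
      - ⟪x, c x - (crossMap a x + b)⟫ • x = 0 := by
    intro x hx
    by_cases h2 : x 2 = 1
    · have hs := inner_self_of_mem_S2 hx
      simp only [PiLp.inner_apply, Fin.sum_univ_three] at hs
      simp [h2] at hs
      have h0 : x 0 = 0 := by nlinarith [sq_nonneg (x 0), sq_nonneg (x 1)]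
      have h1 : x 1 = 0 := by nlinarith [sq_nonneg (x 0), sq_nonneg (x 1)]
      set p : ℝ → E3 := fun t => !₂[Real.sin t, 0, Real.cos t] with hp
      have hp0 : p 0 = x := by
        ext i
        fin_cases i <;> simp [hp, h0, h1, h2]
      have hpc : Continuous p := by
        refine continuous_iff_continuousAt.2 fun t => (hasDerivAt_vec3
          (Real.hasDerivAt_sin t) (hasDerivAt_const t 0) (Real.hasDerivAt_cos t)).continuousAt
      have hpS : ∀ t, p t ∈ S2 := by
        intro t
        rw [S2, mem_sphere_zero_iff_norm, ← sq_eq_sq₀ (norm_nonneg _) zero_le_one,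
          ← real_inner_self_eq_norm_sq, hp, inner_vec3]
        simp
        nlinarith [Real.sin_sq_add_cos_sq t]
      have hcc : ContinuousAt (fun t => c (p t)) 0 :=
        ContinuousAt.comp (g := c) (h.diff _ (ne_zero_of_mem_S2 (hpS 0))).continuousAt
          hpc.continuousAt
      have hcont : ContinuousAt (fun t => (c (p t) - (crossMap a (p t) + b))
          - ⟪p t, c (p t) - (crossMap a (p t) + b)⟫ • p t) 0 := by
        have e1 : ContinuousAt (fun t => c (p t) - (crossMap a (p t) + b)) 0 :=
          hcc.sub (((crossMap a).continuous.comp hpc).continuousAt.add continuousAt_const)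
        exact e1.sub (ContinuousAt.fun_smul (ContinuousAt.inner (𝕜 := ℝ) hpc.continuousAt e1)
          hpc.continuousAt)
      have hlim := hcont.tendsto.mono_left (nhdsWithin_le_nhds (s := {0}ᶜ))
      rw [hp0] at hlim
      refine tendsto_nhds_unique hlim (tendsto_const_nhds.congr' ?_)
      have hev : ∀ᶠ t : ℝ in 𝓝[≠] 0, Real.sin t ≠ 0 := by
        have := (Real.hasDerivAt_sin 0).eventually_ne (c := 0) (by simp)
        exact this
      filter_upwards [hev] with t ht
      refine (hgen _ (hpS t) ?_).symm
      intro hc1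
      have : Real.cos t = 1 := by simpa [hp] using hc1
      exact ht (Real.sin_eq_zero_iff_cos_eq.2 (Or.inl this))
    · exact hgen x hx h2
  refine ⟨a, b, fun x hx v hv => ?_⟩
  have h1 := congrArg (fun y => ⟪v, y⟫) (hall x hx)
  simp only [inner_sub_right, inner_smul_right, inner_zero_right, real_inner_comm x v, hv,
    mul_zero, sub_zero] at h1
  linarith

theorem eq_of_tangential_eq (h : IsConformalField c) {A : E3 →L[ℝ] E3} {b : E3} (hA : IsSkew A)
    (ht : ∀ x ∈ S2, ∀ v, ⟪x, v⟫ = 0 → ⟪v, c x⟫ = ⟪v, A x + b⟫) {x : E3} (hx : x ∈ S2) :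
    c x = A x + b := by
  obtain ⟨e, he⟩ := exists_orthonormalBasis_two hx
  set v := e 0 with hv
  have hxv : ⟪x, v⟫ = 0 := by rw [← he]; exact e.orthonormal.2 (by decide)
  have hvv : ⟪v, v⟫ = 1 := by rw [real_inner_self_eq_norm_sq, hv, e.orthonormal.1, one_pow]
  have hxx := inner_self_of_mem_S2 hx
  set p : ℝ → E3 := fun t => Real.cos t • x + Real.sin t • v with hp
  have hp' : HasDerivAt p v 0 := by
    have := ((Real.hasDerivAt_cos 0).smul_const x).add ((Real.hasDerivAt_sin 0).smul_const v)
    simpa using! this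
  have hp0 : p 0 = x := by simp [hp]
  have hpS : ∀ t, p t ∈ S2 := by
    intro t
    rw [S2, mem_sphere_zero_iff_norm, ← sq_eq_sq₀ (norm_nonneg _) zero_le_one,
      ← real_inner_self_eq_norm_sq, hp]
    simp only [inner_add_left, inner_add_right, real_inner_smul_left, real_inner_smul_right,
      hxx, hvv, hxv, real_inner_comm x v]
    nlinarith [Real.sin_sq_add_cos_sq t]
  have hd : HasDerivAt (fun t => c (p t) - (A (p t) + b)) (fderiv ℝ c x v - A v) 0 := by
    have d1 : HasDerivAt (fun t => c (p t)) (fderiv ℝ c x v) 0 :=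
      HasFDerivAt.comp_hasDerivAt_of_eq 0 (h.diff x (ne_zero_of_mem_S2 hx)).hasFDerivAt hp' hp0.symm
    have d2 : HasDerivAt (fun t => A (p t)) (A v) 0 := A.hasFDerivAt.comp_hasDerivAt 0 hp'
    exact d1.sub (d2.add_const b)
  have hrad : ∀ t, ⟪v, c (p t) - (A (p t) + b)⟫
      = ⟪p t, c (p t) - (A (p t) + b)⟫ * Real.sin t := by
    intro t
    have hps := inner_self_of_mem_S2 (hpS t)
    have hvp : ⟪v, p t⟫ = Real.sin t := by
      simp only [hp, inner_add_right, real_inner_smul_right, hvv, real_inner_comm x v, hxv,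
        mul_zero, zero_add, mul_one]
    have := ht _ (hpS t) (v - ⟪v, p t⟫ • p t) (by
      rw [inner_sub_right, real_inner_smul_right, hps, real_inner_comm]; ring)
    rw [← sub_eq_zero, ← inner_sub_right, inner_sub_left, real_inner_smul_left, hvp] at this
    linarith
  have d3 := (hasDerivAt_const (0 : ℝ) v).inner ℝ hd
  have d4 := (hp'.inner ℝ hd).mul (Real.hasDerivAt_sin 0)
  have d5 := d3.unique (d4.congr_of_eventuallyEq (Eventually.of_forall hrad))
  have hk := h.conformal x hx v v hxv hxv
  rw [real_inner_comm] at hk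
  simp [hp0, inner_sub_right, hA.inner_self] at d5
  have hxc : ⟪x, c x - (A x + b)⟫ = 0 := by
    rw [inner_sub_right]
    simp only [inner_add_right, hA.inner_self] at d5 ⊢
    linarith
  have := ht x hx _ hxc
  rw [← sub_eq_zero, ← inner_sub_right] at this
  exact sub_eq_zero.1 (inner_self_eq_zero.1 this)

end IsConformalField

/-! ### Orbits of conformal Killing fields of the sphere -/

/-- The conformal Killing field with rotation `A` and boost `b`. -/
def confField (A : E3 →L[ℝ] E3) (b x : E3) : E3 := A x + b - ⟪b, x⟫ • x

/-- The complete integral curves of `confField A b` on the sphere. -/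
def IsSphereOrbit (A : E3 →L[ℝ] E3) (b : E3) (σ : ℝ → E3) : Prop :=
  ∀ t, σ t ∈ S2 ∧ HasDerivAt σ (confField A b (σ t)) t

/-- The zeros of `confField A b` on the sphere. -/
def confZeros (A : E3 →L[ℝ] E3) (b : E3) : Set E3 := {x | x ∈ S2 ∧ confField A b x = 0}

theorem IsSphereOrbit.reverse {A : E3 →L[ℝ] E3} {b : E3} {σ : ℝ → E3}
    (h : IsSphereOrbit A b σ) : IsSphereOrbit (-A) (-b) fun t => σ (-t) := by
  intro t
  refine ⟨(h (-t)).1, ?_⟩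
  have h1 := HasDerivAt.scomp t (h (-t)).2 (hasDerivAt_neg t)
  refine h1.congr_deriv ?_
  simp [confField]
  abel

theorem confZeros_neg (A : E3 →L[ℝ] E3) (b : E3) : confZeros (-A) (-b) = confZeros A b := by
  ext x
  have : confField (-A) (-b) x = -confField A b x := by
    simp [confField]
    abel
  simp [confZeros, this]

theorem IsSkew.neg {A : E3 →L[ℝ] E3} (hA : IsSkew A) : IsSkew (-A) := by
  intro x y
  simp [hA x y]

/-- The linear vector field on Minkowski space that induces `confField A b` on the sphere of null
directions. -/
def lorentzLift (A : E3 →L[ℝ] E3) (b : E3) : E4 →L[ℝ] E4 :=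
  ((innerSL ℝ b).comp (ContinuousLinearMap.snd ℝ ℝ E3)).prod
    (A.comp (ContinuousLinearMap.snd ℝ ℝ E3) + (ContinuousLinearMap.fst ℝ ℝ E3).smulRight b)

theorem exists_linear_flow {E : Type*} [NormedAddCommGroup E] [NormedSpace ℝ E] [CompleteSpace E]
    (L : E →L[ℝ] E) (v : E) : ∃ φ : ℝ → E, φ 0 = v ∧ (∀ t, HasDerivAt φ (L (φ t)) t) ∧
      ∀ t, φ t = 0 → v = 0 := by
  refine ⟨fun t => NormedSpace.exp (t • L) v, by simp, fun t => ?_, fun t ht => ?_⟩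
  · exact ((hasDerivAt_exp_smul_const' (𝕂 := ℝ) L t).clm_apply (hasDerivAt_const t v)).congr_deriv
      (by simp)
  · have h5 : NormedSpace.exp (-(t • L)) * NormedSpace.exp (t • L) = 1 := by
      have hcomm : Commute (-(t • L)) (t • L) := Commute.neg_left (Commute.refl _)
      let _ : NormedAlgebra ℚ (E →L[ℝ] E) := NormedAlgebra.restrictScalars ℚ ℝ _
      rw [← NormedSpace.exp_add_of_commute hcomm, neg_add_cancel, NormedSpace.exp_zero]
    have h6 : NormedSpace.exp (-(t • L)) (NormedSpace.exp (t • L) v) = v :=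
      congrArg (fun M : E →L[ℝ] E => M v) h5
    replace ht : NormedSpace.exp (t • L) v = 0 := ht
    rw [← h6, ht, map_zero]

theorem exists_lorentz_flow {A : E3 →L[ℝ] E3} (hA : IsSkew A) (b : E3) {x : E3} (hx : x ∈ S2) :
    ∃ (s : ℝ → ℝ) (y : ℝ → E3), s 0 = 1 ∧ y 0 = x ∧ (∀ t, HasDerivAt s ⟪b, y t⟫ t) ∧
      (∀ t, HasDerivAt y (A (y t) + s t • b) t) ∧ (∀ t, ⟪y t, y t⟫ = s t ^ 2) ∧ ∀ t, s t ≠ 0 := by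
  set L := lorentzLift A b with hL
  obtain ⟨φ, hφ0, hd, hφ⟩ := exists_linear_flow L ((1 : ℝ), x)
  have hs : ∀ t, HasDerivAt (fun t => (φ t).1) ⟪b, (φ t).2⟫ t := fun t =>
    (hasFDerivAt_fst (𝕜 := ℝ) (p := φ t)).comp_hasDerivAt t (hd t)
  have hy : ∀ t, HasDerivAt (fun t => (φ t).2) (A (φ t).2 + (φ t).1 • b) t := fun t =>
    (hasFDerivAt_snd (𝕜 := ℝ) (p := φ t)).comp_hasDerivAt t (hd t)
  have hcons : ∀ t, ⟪(φ t).2, (φ t).2⟫ - (φ t).1 ^ 2 = 0 := by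
    have h1 : ∀ t, HasDerivAt (fun t => ⟪(φ t).2, (φ t).2⟫ - (φ t).1 ^ 2) 0 t := by
      intro t
      refine (((hy t).inner ℝ (hy t)).sub ((hs t).pow 2)).congr_deriv ?_
      have e1 : ⟪A (φ t).2 + (φ t).1 • b, (φ t).2⟫ = (φ t).1 * ⟪b, (φ t).2⟫ := by
        rw [inner_add_left, real_inner_smul_left, real_inner_comm, hA.inner_self, zero_add]
      rw [real_inner_comm _ (φ t).2, e1]
      push_cast
      ring
    intro t
    have h2 := is_const_of_deriv_eq_zero (fun t => (h1 t).differentiableAt)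
      (fun t => (h1 t).deriv) t 0
    rw [h2, hφ0, inner_self_of_mem_S2 hx]
    norm_num
  refine ⟨fun t => (φ t).1, fun t => (φ t).2, by simp [hφ0], by simp [hφ0], hs, hy,
    fun t => by linarith [hcons t], fun t h0 => ?_⟩
  replace h0 : (φ t).1 = 0 := h0
  have h1 := hcons t
  rw [h0] at h1
  have h2 : (φ t).2 = 0 := by
    rw [← inner_self_eq_zero (𝕜 := ℝ)]
    linarith
  have h3 : φ t = 0 := Prod.ext h0 h2
  exact one_ne_zero (congrArg Prod.fst (hφ t h3))

theorem exists_orbit {A : E3 →L[ℝ] E3} (hA : IsSkew A) (b : E3) {α : E3 → ℝ}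
    (hα : ContinuousOn α S2) {x : E3} (hx : x ∈ S2) (u₀ : ℝ) :
    ∃ (u : ℝ → ℝ) (σ : ℝ → E3), u 0 = u₀ ∧ σ 0 = x ∧ IsSphereOrbit A b σ ∧
      ∀ t, HasDerivAt u (α (σ t) - u t * ⟪b, σ t⟫) t := by
  obtain ⟨s, y, hs0, hy0, hs, hy, hn, hne⟩ := exists_lorentz_flow hA b hx
  have hσS : ∀ t, (s t)⁻¹ • y t ∈ S2 := by
    intro t
    rw [S2, mem_sphere_zero_iff_norm, ← sq_eq_sq₀ (norm_nonneg _) zero_le_one,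
      ← real_inner_self_eq_norm_sq, real_inner_smul_left, real_inner_smul_right, hn]
    have := hne t
    field_simp
  have hσ : IsSphereOrbit A b fun t => (s t)⁻¹ • y t := by
    refine fun t => ⟨hσS t, ?_⟩
    refine (((hs t).inv (hne t)).smul (hy t)).congr_deriv ?_
    simp only [confField, map_smul, smul_add, real_inner_smul_right, Pi.inv_apply]
    rw [inv_smul_smul₀ (hne t), smul_smul, sub_eq_add_neg, ← neg_smul]
    congr 2
    have := hne t
    field_simp
  have hcont : Continuous fun t => α ((s t)⁻¹ • y t) * s t := by
    have h1 : Continuous fun t => (s t)⁻¹ • y t :=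
      continuous_iff_continuousAt.2 fun t => (hσ t).2.continuousAt
    have h2 : Continuous s := continuous_iff_continuousAt.2 fun t => (hs t).continuousAt
    exact (hα.comp_continuous h1 hσS).mul h2
  have hint : ∀ t, HasDerivAt (fun t => u₀ + ∫ v in (0 : ℝ)..t, α ((s v)⁻¹ • y v) * s v)
      (α ((s t)⁻¹ • y t) * s t) t := fun t =>
    (hcont.integral_hasStrictDerivAt 0 t).hasDerivAt.const_add u₀
  refine ⟨fun t => (s t)⁻¹ * (u₀ + ∫ v in (0 : ℝ)..t, α ((s v)⁻¹ • y v) * s v),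
    fun t => (s t)⁻¹ • y t, by simp [hs0], by simp [hs0, hy0], hσ, fun t => ?_⟩
  refine (((hs t).inv (hne t)).mul (hint t)).congr_deriv ?_
  have := hne t
  rw [real_inner_smul_right, Pi.inv_apply]
  field_simp
  ring

/-! ### The stereographic coordinate with a zero of the field at infinity -/

/-- The stereographic coordinate with pole `e 2`. -/
def stereo (e : OrthonormalBasis (Fin 3) ℝ E3) (x : E3) : ℂ :=
  ⟨⟪e 0, x⟫ / (1 - ⟪e 2, x⟫), ⟪e 1, x⟫ / (1 - ⟪e 2, x⟫)⟩

/-- The linear coefficient of a conformal Killing field in the stereographic coordinate. -/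
def confRate (A : E3 →L[ℝ] E3) (b : E3) (e : OrthonormalBasis (Fin 3) ℝ E3) : ℂ :=
  ⟨⟪b, e 2⟫, ⟪e 1, A (e 0)⟫⟩

/-- The constant coefficient of a conformal Killing field in the stereographic coordinate. -/
def confDrift (b : E3) (e : OrthonormalBasis (Fin 3) ℝ E3) : ℂ := ⟨⟪e 0, b⟫, ⟪e 1, b⟫⟩

section Frame

variable (e : OrthonormalBasis (Fin 3) ℝ E3)

theorem frame_mem (i : Fin 3) : e i ∈ S2 := by
  simp [S2]

theorem frame_sum (x : E3) : ⟪e 0, x⟫ • e 0 + ⟪e 1, x⟫ • e 1 + ⟪e 2, x⟫ • e 2 = x := by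
  have := e.sum_repr' x
  rwa [Fin.sum_univ_three] at this

theorem frame_inner (x y : E3) :
    ⟪x, y⟫ = ⟪e 0, x⟫ * ⟪e 0, y⟫ + ⟪e 1, x⟫ * ⟪e 1, y⟫ + ⟪e 2, x⟫ * ⟪e 2, y⟫ := by
  conv_lhs => rw [← frame_sum e x]
  simp only [inner_add_left, real_inner_smul_left]

theorem frame_inner_self (i : Fin 3) : ⟪e i, e i⟫ = 1 := inner_self_of_mem_S2 (frame_mem e i)

theorem frame_inner_of_ne {i j : Fin 3} (h : i ≠ j) : ⟪e i, e j⟫ = 0 := e.orthonormal.2 h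

theorem frame_sq {x : E3} (hx : x ∈ S2) : ⟪e 0, x⟫ ^ 2 + ⟪e 1, x⟫ ^ 2 + ⟪e 2, x⟫ ^ 2 = 1 := by
  rw [← inner_self_of_mem_S2 hx, frame_inner e x x]
  ring

theorem inner_pole_lt_one {x : E3} (hx : x ∈ S2) (hne : x ≠ e 2) : ⟪e 2, x⟫ < 1 :=
  inner_lt_one_iff_real_of_norm_eq_one (norm_of_mem_S2 (frame_mem e 2)) (norm_of_mem_S2 hx) |>.2
    hne.symm

theorem one_add_normSq_stereo {x : E3} (hx : x ∈ S2) (hne : x ≠ e 2) :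
    1 + (stereo e x).re ^ 2 + (stereo e x).im ^ 2 = 2 / (1 - ⟪e 2, x⟫) := by
  have h := frame_sq e hx
  have hd : 1 - ⟪e 2, x⟫ ≠ 0 := by linarith [inner_pole_lt_one e hx hne]
  simp only [stereo]
  field_simp
  linear_combination h

theorem stereo_injOn {x y : E3} (hx : x ∈ S2) (hxe : x ≠ e 2) (hy : y ∈ S2) (hye : y ≠ e 2)
    (h : stereo e x = stereo e y) : x = y := by
  have h1 := one_add_normSq_stereo e hx hxe
  rw [h, one_add_normSq_stereo e hy hye] at h1
  have hdx : 1 - ⟪e 2, x⟫ ≠ 0 := by linarith [inner_pole_lt_one e hx hxe]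
  have hdy : 1 - ⟪e 2, y⟫ ≠ 0 := by linarith [inner_pole_lt_one e hy hye]
  have h2 : ⟪e 2, x⟫ = ⟪e 2, y⟫ := by
    rw [div_eq_div_iff hdy hdx] at h1
    linarith
  have h3 : ⟪e 0, x⟫ = ⟪e 0, y⟫ := by
    have := congrArg Complex.re h
    simp only [stereo, h2] at this
    exact (div_left_inj' hdy).1 this
  have h4 : ⟪e 1, x⟫ = ⟪e 1, y⟫ := by
    have := congrArg Complex.im h
    simp only [stereo, h2] at this
    exact (div_left_inj' hdy).1 this
  rw [← frame_sum e x, ← frame_sum e y, h2, h3, h4]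

theorem exists_stereo_eq (z : ℂ) : ∃ x ∈ S2, x ≠ e 2 ∧ stereo e x = z := by
  have hD : 0 < 1 + z.re ^ 2 + z.im ^ 2 := by positivity
  set D := 1 + z.re ^ 2 + z.im ^ 2 with hDdef
  set x := (2 * z.re / D) • e 0 + (2 * z.im / D) • e 1 + (1 - 2 / D) • e 2 with hx
  have h0 : ⟪e 0, x⟫ = 2 * z.re / D := by
    simp [hx, inner_add_right, real_inner_smul_right, frame_inner_of_ne e (show (0 : Fin 3) ≠ 1 by decide),
      frame_inner_of_ne e (show (0 : Fin 3) ≠ 2 by decide)]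
  have h1 : ⟪e 1, x⟫ = 2 * z.im / D := by
    simp [hx, inner_add_right, real_inner_smul_right, frame_inner_of_ne e (show (1 : Fin 3) ≠ 0 by decide),
      frame_inner_of_ne e (show (1 : Fin 3) ≠ 2 by decide)]
  have h2 : ⟪e 2, x⟫ = 1 - 2 / D := by
    simp [hx, inner_add_right, real_inner_smul_right, frame_inner_of_ne e (show (2 : Fin 3) ≠ 0 by decide),
      frame_inner_of_ne e (show (2 : Fin 3) ≠ 1 by decide)]
  refine ⟨x, ?_, ?_, ?_⟩
  · rw [S2, mem_sphere_zero_iff_norm, ← sq_eq_sq₀ (norm_nonneg _) zero_le_one,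
      ← real_inner_self_eq_norm_sq, frame_inner e, h0, h1, h2]
    field_simp
    rw [hDdef]
    ring
  · intro h
    rw [h, frame_inner_self] at h2
    have : 0 < 2 / D := by positivity
    linarith
  · apply Complex.ext
    · simp only [stereo, h0, h2]
      field_simp
      ring
    · simp only [stereo, h1, h2]
      field_simp
      ring

end Frame

section Coordinate

variable {A : E3 →L[ℝ] E3} {b : E3} {e : OrthonormalBasis (Fin 3) ℝ E3} {σ : ℝ → E3}

theorem map_pole (he : e 2 ∈ confZeros A b) : A (e 2) = ⟪b, e 2⟫ • e 2 - b := by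
  have := he.2
  rw [confField, sub_eq_zero] at this
  rw [← this, add_sub_cancel_right]

theorem inner_pole_map (hA : IsSkew A) (he : e 2 ∈ confZeros A b) (x : E3) :
    ⟪e 2, A x⟫ = ⟪b, x⟫ - ⟪b, e 2⟫ * ⟪e 2, x⟫ := by
  have := hA (e 2) x
  rw [map_pole he, inner_sub_left, real_inner_smul_left] at this
  linarith

theorem inner_zero_map (hA : IsSkew A) (he : e 2 ∈ confZeros A b) (x : E3) :
    ⟪e 0, A x + b⟫ = -⟪e 1, A (e 0)⟫ * ⟪e 1, x⟫ + (1 - ⟪e 2, x⟫) * ⟪e 0, b⟫ := by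
  conv_lhs => rw [← frame_sum e x]
  have h1 := hA (e 0) (e 1)
  rw [real_inner_comm] at h1
  have h2 := frame_inner_of_ne e (show (0 : Fin 3) ≠ 2 by decide)
  simp only [map_add, map_smul, inner_add_right, real_inner_smul_right, hA.inner_self, map_pole he,
    inner_sub_right, h1, h2]
  ring

theorem inner_one_map (hA : IsSkew A) (he : e 2 ∈ confZeros A b) (x : E3) :
    ⟪e 1, A x + b⟫ = ⟪e 1, A (e 0)⟫ * ⟪e 0, x⟫ + (1 - ⟪e 2, x⟫) * ⟪e 1, b⟫ := by
  conv_lhs => rw [← frame_sum e x]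
  have h2 := frame_inner_of_ne e (show (1 : Fin 3) ≠ 2 by decide)
  simp only [map_add, map_smul, inner_add_right, real_inner_smul_right, hA.inner_self, map_pole he,
    inner_sub_right, h2]
  ring

theorem IsSphereOrbit.hasDerivAt_height (hσ : IsSphereOrbit A b σ) (hA : IsSkew A)
    (he : e 2 ∈ confZeros A b) (t : ℝ) : HasDerivAt (fun t => 1 - ⟪e 2, σ t⟫)
      (-(⟪b, e 2⟫ + ⟪b, σ t⟫) * (1 - ⟪e 2, σ t⟫)) t := by
  refine (((hasDerivAt_const t (e 2)).inner ℝ (hσ t).2).const_sub 1).congr_deriv ?_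
  rw [confField, inner_sub_right, inner_add_right, inner_pole_map hA he, real_inner_smul_right,
    inner_zero_left, real_inner_comm b (e 2)]
  ring

theorem IsSphereOrbit.continuous (hσ : IsSphereOrbit A b σ) : Continuous σ :=
  continuous_iff_continuousAt.2 fun t => (hσ t).2.continuousAt

theorem IsSphereOrbit.ne_pole (hσ : IsSphereOrbit A b σ) (hA : IsSkew A)
    (he : e 2 ∈ confZeros A b) (h0 : σ 0 ≠ e 2) (t : ℝ) : σ t ≠ e 2 := by
  have hc : Continuous fun t => ⟪b, e 2⟫ + ⟪b, σ t⟫ :=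
    continuous_const.add (continuous_const.inner hσ.continuous)
  have hS : ∀ t, HasDerivAt (fun t => ∫ v in (0 : ℝ)..t, ⟪b, e 2⟫ + ⟪b, σ v⟫)
      (⟪b, e 2⟫ + ⟪b, σ t⟫) t := fun t => (hc.integral_hasStrictDerivAt 0 t).hasDerivAt
  have hd : ∀ t, HasDerivAt (fun t => (1 - ⟪e 2, σ t⟫) *
      Real.exp (∫ v in (0 : ℝ)..t, ⟪b, e 2⟫ + ⟪b, σ v⟫)) 0 t := fun t =>
    ((hσ.hasDerivAt_height hA he t).mul (hS t).exp).congr_deriv (by ring)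
  have h1 := is_const_of_deriv_eq_zero (fun t => (hd t).differentiableAt)
      (fun t => (hd t).deriv) t 0
  intro ht
  rw [ht, frame_inner_self] at h1
  have := inner_pole_lt_one e (hσ 0).1 h0
  simp at h1
  linarith

theorem IsSphereOrbit.hasDerivAt_stereo (hσ : IsSphereOrbit A b σ) (hA : IsSkew A)
    (he : e 2 ∈ confZeros A b) (h0 : σ 0 ≠ e 2) (t : ℝ) : HasDerivAt (fun t => stereo e (σ t))
      (confRate A b e * stereo e (σ t) + confDrift b e) t := by
  have hd : 1 - ⟪e 2, σ t⟫ ≠ 0 := by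
    linarith [inner_pole_lt_one e (hσ t).1 (hσ.ne_pole hA he h0 t)]
  have hh := hσ.hasDerivAt_height hA he t
  have hre := (((hasDerivAt_const t (e 0)).inner ℝ (hσ t).2).div hh hd).ofReal_comp
  have him := (((hasDerivAt_const t (e 1)).inner ℝ (hσ t).2).div hh hd).ofReal_comp
  have h1 := hre.add (him.mul_const Complex.I)
  refine (h1.congr_of_eventuallyEq (Eventually.of_forall fun t => ?_)).congr_deriv ?_
  · exact Complex.mk_eq_add_mul_I _ _
  · have k0 := inner_zero_map hA he (σ t)
    have k1 := inner_one_map hA he (σ t)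
    simp only [confField, inner_sub_right _ (_ + _), k0, k1, real_inner_smul_right, inner_zero_left,
      add_zero]
    apply Complex.ext
    · simp [confRate, confDrift, stereo, -Complex.ofReal_div, -Complex.ofReal_mul]
      field_simp
      ring
    · simp [confRate, confDrift, stereo, -Complex.ofReal_div, -Complex.ofReal_mul]
      field_simp
      ring

end Coordinate

section Solution

variable {A : E3 →L[ℝ] E3} {b : E3} {e : OrthonormalBasis (Fin 3) ℝ E3} {σ : ℝ → E3}

theorem IsSphereOrbit.stereo_eq_exp (hσ : IsSphereOrbit A b σ) (hA : IsSkew A)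
    (he : e 2 ∈ confZeros A b) (h0 : σ 0 ≠ e 2) (hβ : confRate A b e ≠ 0) (t : ℝ) :
    stereo e (σ t) + confDrift b e / confRate A b e
      = (stereo e (σ 0) + confDrift b e / confRate A b e) * Complex.exp (confRate A b e * t) := by
  set β := confRate A b e
  set γ := confDrift b e
  have hexp : ∀ t : ℝ, HasDerivAt (fun t : ℝ => Complex.exp (-β * t))
      (Complex.exp (-β * t) * (-β)) t := by
    intro t
    have h1 : HasDerivAt (fun t : ℝ => (t : ℂ)) 1 t := (hasDerivAt_id t).ofReal_comp
    simpa using (h1.const_mul (-β)).cexp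
  have hd : ∀ t : ℝ, HasDerivAt (fun t : ℝ => (stereo e (σ t) + γ / β) * Complex.exp (-β * t))
      0 t := by
    intro t
    refine (((hσ.hasDerivAt_stereo hA he h0 t).add_const (γ / β)).mul (hexp t)).congr_deriv ?_
    field_simp
    ring
  have h1 := is_const_of_deriv_eq_zero (fun t => (hd t).differentiableAt)
      (fun t => (hd t).deriv) t 0
  simp only [Complex.ofReal_zero, mul_zero, Complex.exp_zero, mul_one] at h1
  rw [← h1, mul_assoc, ← Complex.exp_add]
  simp

theorem IsSphereOrbit.stereo_eq_linear (hσ : IsSphereOrbit A b σ) (hA : IsSkew A)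
    (he : e 2 ∈ confZeros A b) (h0 : σ 0 ≠ e 2) (hβ : confRate A b e = 0) (t : ℝ) :
    stereo e (σ t) = stereo e (σ 0) + confDrift b e * t := by
  have hd : ∀ t : ℝ, HasDerivAt (fun t : ℝ => stereo e (σ t) - confDrift b e * t) 0 t := by
    intro t
    have h1 : HasDerivAt (fun t : ℝ => (t : ℂ)) 1 t := (hasDerivAt_id t).ofReal_comp
    refine ((hσ.hasDerivAt_stereo hA he h0 t).sub (h1.const_mul (confDrift b e))).congr_deriv ?_
    rw [hβ]
    ring
  have h1 := is_const_of_deriv_eq_zero (fun t => (hd t).differentiableAt)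
      (fun t => (hd t).deriv) t 0
  simp only [Complex.ofReal_zero, mul_zero, sub_zero] at h1
  rw [← h1]
  ring

theorem exists_sphereOrbit (hA : IsSkew A) (b : E3) {x : E3} (hx : x ∈ S2) :
    ∃ σ : ℝ → E3, σ 0 = x ∧ IsSphereOrbit A b σ := by
  obtain ⟨u, σ, -, h1, h2, -⟩ := exists_orbit hA b (α := fun _ => 0) continuousOn_const hx 0
  exact ⟨σ, h1, h2⟩

theorem mem_confZeros_iff (hA : IsSkew A) (he : e 2 ∈ confZeros A b) {x : E3} (hx : x ∈ S2)
    (hne : x ≠ e 2) :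
    x ∈ confZeros A b ↔ confRate A b e * stereo e x + confDrift b e = 0 := by
  constructor
  · intro h
    have hσ : IsSphereOrbit A b fun _ => x := fun t => ⟨hx, by
      rw [h.2]
      exact hasDerivAt_const t x⟩
    exact (hσ.hasDerivAt_stereo hA he hne 0).unique (hasDerivAt_const 0 _)
  · intro h
    obtain ⟨σ, hσ0, hσ⟩ := exists_sphereOrbit hA b hx
    have h0 : σ 0 ≠ e 2 := by rwa [hσ0]
    have hst : ∀ t, stereo e (σ t) = stereo e x := by
      intro t
      by_cases hβ : confRate A b e = 0
      · rw [hβ, zero_mul, zero_add] at h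
        rw [hσ.stereo_eq_linear hA he h0 hβ, h, hσ0]
        ring
      · have h1 := hσ.stereo_eq_exp hA he h0 hβ t
        have h2 : stereo e x + confDrift b e / confRate A b e = 0 := by
          field_simp
          linear_combination h
        rw [hσ0, h2, zero_mul] at h1
        linear_combination h1 - h2
    have hconst : σ = fun _ => x := funext fun t =>
      stereo_injOn e (hσ t).1 (hσ.ne_pole hA he h0 t) hx hne (hst t)
    have h3 := (hσ 0).2
    rw [hconst] at h3
    exact ⟨hx, h3.unique (hasDerivAt_const 0 x)⟩

theorem exists_second_zero (hA : IsSkew A) (he : e 2 ∈ confZeros A b)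
    (hβ : confRate A b e ≠ 0) : ∃ p ∈ S2, p ≠ e 2 ∧
      stereo e p = -(confDrift b e / confRate A b e) ∧ confZeros A b = {p, e 2} := by
  obtain ⟨p, hp, hpe, hz⟩ := exists_stereo_eq e (-(confDrift b e / confRate A b e))
  refine ⟨p, hp, hpe, hz, ?_⟩
  ext x
  simp only [mem_insert_iff, mem_singleton_iff]
  constructor
  · intro hx
    by_cases hxe : x = e 2
    · exact Or.inr hxe
    · left
      have h1 := (mem_confZeros_iff hA he hx.1 hxe).1 hx
      refine stereo_injOn e hx.1 hxe hp hpe ?_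
      rw [hz]
      field_simp
      linear_combination h1
  · rintro (rfl | rfl)
    · refine (mem_confZeros_iff hA he hp hpe).2 ?_
      rw [hz]
      field_simp
      ring
    · exact he

theorem inner_boost_second_zero (hA : IsSkew A) {p q : E3} (hp : p ∈ confZeros A b)
    (hq : q ∈ confZeros A b) (hpq : p ≠ q) : ⟪b, p⟫ = -⟪b, q⟫ := by
  have h1 : A p = ⟪b, p⟫ • p - b := by
    have := hp.2
    rw [confField, sub_eq_zero] at this
    rw [← this, add_sub_cancel_right]
  have h2 : A q = ⟪b, q⟫ • q - b := by
    have := hq.2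
    rw [confField, sub_eq_zero] at this
    rw [← this, add_sub_cancel_right]
  have h3 := hA q p
  rw [h1, h2, inner_sub_left, inner_sub_right, real_inner_smul_left, real_inner_smul_right,
    real_inner_comm b q] at h3
  have h4 : ⟪q, p⟫ < 1 := (inner_lt_one_iff_real_of_norm_eq_one (norm_of_mem_S2 hq.1)
    (norm_of_mem_S2 hp.1)).2 hpq.symm
  have h5 : (⟪b, p⟫ + ⟪b, q⟫) * (⟪q, p⟫ - 1) = 0 := by linarith
  rcases mul_eq_zero.1 h5 with h | h <;> linarith

theorem tendsto_pole {l : Filter ℝ} (hS : ∀ t, σ t ∈ S2) (hne : ∀ t, σ t ≠ e 2)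
    (h : Tendsto (fun t => ‖stereo e (σ t)‖) l atTop) : Tendsto σ l (𝓝 (e 2)) := by
  rw [tendsto_iff_norm_sub_tendsto_zero]
  have h1 : ∀ t, ‖σ t - e 2‖ = Real.sqrt (4 / (1 + ‖stereo e (σ t)‖ ^ 2)) := by
    intro t
    have hd : 0 < 1 - ⟪e 2, σ t⟫ := by linarith [inner_pole_lt_one e (hS t) (hne t)]
    rw [eq_comm, Real.sqrt_eq_iff_mul_self_eq (by positivity) (norm_nonneg _),
      ← real_inner_self_eq_norm_mul_norm, inner_sub_left, inner_sub_right, inner_sub_right,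
      inner_self_of_mem_S2 (hS t), frame_inner_self, real_inner_comm (e 2) (σ t), Complex.sq_norm,
      Complex.normSq_apply, ← pow_two, ← pow_two, ← add_assoc,
      one_add_normSq_stereo e (hS t) (hne t)]
    field_simp
    ring
  simp only [h1]
  rw [← Real.sqrt_zero]
  refine (Real.continuous_sqrt.tendsto 0).comp ?_
  have h2 : Tendsto (fun t => 1 + ‖stereo e (σ t)‖ ^ 2) l atTop :=
    tendsto_atTop_add_const_left _ _ ((tendsto_pow_atTop two_ne_zero).comp h)
  simpa [div_eq_mul_inv] using h2.inv_tendsto_atTop.const_mul 4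

theorem IsSphereOrbit.ne_pole_of_notMem (he : e 2 ∈ confZeros A b) (h0 : σ 0 ∉ confZeros A b) :
    σ 0 ≠ e 2 := fun h => h0 (h ▸ he)

theorem IsSphereOrbit.stereo_ne (hσ : IsSphereOrbit A b σ) (hA : IsSkew A)
    (he : e 2 ∈ confZeros A b) (h0 : σ 0 ∉ confZeros A b) (hβ : confRate A b e ≠ 0) :
    stereo e (σ 0) + confDrift b e / confRate A b e ≠ 0 := by
  intro h
  refine h0 ((mem_confZeros_iff hA he (hσ 0).1 (ne_pole_of_notMem he h0)).2 ?_)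
  have : stereo e (σ 0) = -(confDrift b e / confRate A b e) := eq_neg_of_add_eq_zero_left h
  rw [this]
  field_simp
  ring

theorem IsSphereOrbit.tendsto_attractor (hσ : IsSphereOrbit A b σ) (hA : IsSkew A)
    (he : e 2 ∈ confZeros A b) (h0 : σ 0 ∉ confZeros A b) (hre : 0 < ⟪b, e 2⟫) :
    Tendsto σ atTop (𝓝 (e 2)) := by
  have hne := ne_pole_of_notMem he h0
  have hβ : confRate A b e ≠ 0 := fun h => hre.ne' (congrArg Complex.re h)
  refine tendsto_pole (fun t => (hσ t).1) (hσ.ne_pole hA he hne) ?_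
  have hd := norm_pos_iff.2 (hσ.stereo_ne hA he h0 hβ)
  have h1 : Tendsto (fun t : ℝ => ‖stereo e (σ 0) + confDrift b e / confRate A b e‖ *
      Real.exp (⟪b, e 2⟫ * t) + -‖confDrift b e / confRate A b e‖) atTop atTop :=
    tendsto_atTop_add_const_right _ _ ((Real.tendsto_exp_atTop.comp
      (tendsto_id.const_mul_atTop hre)).const_mul_atTop hd)
  refine tendsto_atTop_mono (fun t => ?_) h1
  have h2 : ‖stereo e (σ t) + confDrift b e / confRate A b e‖ =
      ‖stereo e (σ 0) + confDrift b e / confRate A b e‖ * Real.exp (⟪b, e 2⟫ * t) := by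
    rw [hσ.stereo_eq_exp hA he hne hβ t, norm_mul, Complex.norm_exp]
    simp [confRate]
  rw [← h2]
  linarith [norm_add_le (stereo e (σ t)) (confDrift b e / confRate A b e)]

theorem IsSphereOrbit.tendsto_parabolic (hσ : IsSphereOrbit A b σ) (hA : IsSkew A)
    (he : e 2 ∈ confZeros A b) (h0 : σ 0 ≠ e 2) (hβ : confRate A b e = 0)
    (hγ : confDrift b e ≠ 0) : Tendsto σ atTop (𝓝 (e 2)) := by
  refine tendsto_pole (fun t => (hσ t).1) (hσ.ne_pole hA he h0) ?_
  have h1 : Tendsto (fun t : ℝ => ‖confDrift b e‖ * t + -‖stereo e (σ 0)‖) atTop atTop :=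
    tendsto_atTop_add_const_right _ _ (tendsto_id.const_mul_atTop (norm_pos_iff.2 hγ))
  refine tendsto_atTop_mono (fun t => ?_) h1
  have h2 : confDrift b e * t = stereo e (σ t) - stereo e (σ 0) := by
    rw [hσ.stereo_eq_linear hA he h0 hβ t]
    ring
  have h3 : ‖confDrift b e‖ * t ≤ ‖confDrift b e * t‖ := by
    rw [norm_mul, Complex.norm_real]
    gcongr
    exact le_abs_self t
  rw [h2] at h3
  linarith [norm_sub_le (stereo e (σ t)) (stereo e (σ 0))]

end Solution

/-! ### Circles in the stereographic coordinate -/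

theorem exists_normalization {n : E3} {c : ℝ} (h : c ^ 2 < ⟪n, n⟫) :
    ∃ s : ℝ, 0 < s ∧ ‖s • n‖ = 1 ∧ |s * c| < 1 := by
  have hn : 0 < ‖n‖ := by
    rw [real_inner_self_eq_norm_sq] at h
    by_contra h0
    have : ‖n‖ = 0 := le_antisymm (not_lt.1 h0) (norm_nonneg _)
    rw [this] at h
    nlinarith [sq_nonneg c]
  refine ⟨‖n‖⁻¹, inv_pos.2 hn, ?_, ?_⟩
  · rw [norm_smul, norm_inv, norm_norm, inv_mul_cancel₀ hn.ne']
  · rw [abs_mul, abs_of_pos (inv_pos.2 hn), ← div_eq_inv_mul, div_lt_one hn]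
    rw [real_inner_self_eq_norm_sq] at h
    exact abs_lt_of_sq_lt_sq h hn.le

section Circles

variable (e : OrthonormalBasis (Fin 3) ℝ E3)

theorem inner_frame_combination (m₀ m₁ m₂ : ℝ) (x : E3) :
    ⟪m₀ • e 0 + m₁ • e 1 + m₂ • e 2, x⟫ = m₀ * ⟪e 0, x⟫ + m₁ * ⟪e 1, x⟫ + m₂ * ⟪e 2, x⟫ := by
  simp only [inner_add_left, real_inner_smul_left]

theorem frame_coordinates (m₀ m₁ m₂ : ℝ) :
    ⟪e 0, m₀ • e 0 + m₁ • e 1 + m₂ • e 2⟫ = m₀ ∧ ⟪e 1, m₀ • e 0 + m₁ • e 1 + m₂ • e 2⟫ = m₁ ∧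
      ⟪e 2, m₀ • e 0 + m₁ • e 1 + m₂ • e 2⟫ = m₂ := by
  simp only [inner_add_right, real_inner_smul_right, frame_inner_self,
    frame_inner_of_ne e (show (0 : Fin 3) ≠ 1 by decide),
    frame_inner_of_ne e (show (0 : Fin 3) ≠ 2 by decide),
    frame_inner_of_ne e (show (1 : Fin 3) ≠ 0 by decide),
    frame_inner_of_ne e (show (1 : Fin 3) ≠ 2 by decide),
    frame_inner_of_ne e (show (2 : Fin 3) ≠ 0 by decide),
    frame_inner_of_ne e (show (2 : Fin 3) ≠ 1 by decide)]
  simp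

/-- Lines in the stereographic coordinate are circles through the pole. -/
theorem exists_circle_of_line {d : ℂ} (hd : d ≠ 0) (z₀ : ℂ) : ∃ (n : E3) (c : ℝ),
    ‖n‖ = 1 ∧ |c| < 1 ∧ ⟪n, d.re • e 0 + d.im • e 1⟫ = 0 ∧ e 2 ∈ circleOnSphere n c ∧
      ∀ x ∈ S2, x ≠ e 2 → (x ∈ circleOnSphere n c ↔ ∃ t : ℝ, stereo e x = z₀ + d * t) := by
  set k := -d.im * z₀.re + d.re * z₀.im with hk
  set n := (-d.im) • e 0 + d.re • e 1 + k • e 2 with hn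
  have hin := inner_frame_combination e (-d.im) d.re k
  obtain ⟨f0, f1, f2⟩ := frame_coordinates e (-d.im) d.re k
  have hd2 : 0 < d.re ^ 2 + d.im ^ 2 := by
    have := Complex.normSq_pos.2 hd
    rw [Complex.normSq_apply] at this
    linarith
  have hlt : k ^ 2 < ⟪n, n⟫ := by
    rw [hin, f0, f1, f2]
    linarith
  obtain ⟨s, hs, hn1, hc1⟩ := exists_normalization hlt
  refine ⟨s • n, s * k, hn1, hc1, ?_, ⟨frame_mem e 2, ?_⟩, fun x hx hxe => ?_⟩
  · obtain ⟨g0, g1, g2⟩ := frame_coordinates e d.re d.im 0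
    rw [zero_smul, add_zero] at g0 g1 g2
    rw [real_inner_smul_left, hin, g0, g1, g2]
    ring
  · rw [real_inner_smul_left, hin, frame_inner_self,
      frame_inner_of_ne e (show (0 : Fin 3) ≠ 2 by decide),
      frame_inner_of_ne e (show (1 : Fin 3) ≠ 2 by decide)]
    ring
  · have hμ : 0 < 1 - ⟪e 2, x⟫ := by linarith [inner_pole_lt_one e hx hxe]
    have hkey : ⟪n, x⟫ - k = (1 - ⟪e 2, x⟫) *
        (-d.im * (stereo e x).re + d.re * (stereo e x).im - k) := by
      rw [hin]
      simp only [stereo]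
      field_simp
      ring
    have h1 : x ∈ circleOnSphere (s • n) (s * k) ↔
        -d.im * (stereo e x).re + d.re * (stereo e x).im = k := by
      rw [circleOnSphere, mem_ofPred_eq, real_inner_smul_left, mul_right_inj' hs.ne',
        ← sub_eq_zero, hkey, mul_eq_zero, or_iff_right hμ.ne', sub_eq_zero]
      exact and_iff_right hx
    rw [h1]
    constructor
    · intro h
      refine ⟨(d.re * ((stereo e x).re - z₀.re) + d.im * ((stereo e x).im - z₀.im))
        / (d.re ^ 2 + d.im ^ 2), ?_⟩
      rw [hk] at h
      apply Complex.ext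
      · simp only [Complex.add_re, Complex.re_mul_ofReal]
        field_simp
        linear_combination -d.im * h
      · simp only [Complex.add_im, Complex.im_mul_ofReal]
        field_simp
        linear_combination d.re * h
    · rintro ⟨t, ht⟩
      rw [ht, hk]
      simp only [Complex.add_re, Complex.add_im, Complex.re_mul_ofReal, Complex.im_mul_ofReal]
      ring

/-- Circles in the stereographic coordinate are circles that separate the pole from the center. -/
theorem exists_circle_of_circle (z₀ : ℂ) {R : ℝ} (hR : 0 < R) : ∃ (n : E3) (c : ℝ),
    ‖n‖ = 1 ∧ |c| < 1 ∧ c < ⟪n, e 2⟫ ∧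
      ∀ x ∈ S2, x ≠ e 2 → (⟪n, x⟫ = c ↔ ‖stereo e x - z₀‖ = R) ∧
        (‖stereo e x - z₀‖ < R → ⟪n, x⟫ < c) := by
  set K := z₀.re ^ 2 + z₀.im ^ 2 - R ^ 2 with hK
  set n := (-2 * z₀.re) • e 0 + (-2 * z₀.im) • e 1 + (1 - K) • e 2 with hn
  have hin := inner_frame_combination e (-2 * z₀.re) (-2 * z₀.im) (1 - K)
  obtain ⟨f0, f1, f2⟩ := frame_coordinates e (-2 * z₀.re) (-2 * z₀.im) (1 - K)
  have hR2 : 0 < R ^ 2 := by positivity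
  have hlt : (-(1 + K)) ^ 2 < ⟪n, n⟫ := by
    rw [hin, f0, f1, f2]
    have h : (z₀.re ^ 2 + z₀.im ^ 2) = K + R ^ 2 := by rw [hK]; ring
    nlinarith
  obtain ⟨s, hs, hn1, hc1⟩ := exists_normalization hlt
  have hkey : ∀ x ∈ S2, x ≠ e 2 → ⟪s • n, x⟫ - s * -(1 + K) =
      (s * (1 - ⟪e 2, x⟫)) * (‖stereo e x - z₀‖ ^ 2 - R ^ 2) := by
    intro x hx hxe
    have hμ : 0 < 1 - ⟪e 2, x⟫ := by linarith [inner_pole_lt_one e hx hxe]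
    have h1 := one_add_normSq_stereo e hx hxe
    rw [eq_div_iff hμ.ne'] at h1
    have h2 : ⟪e 0, x⟫ = (1 - ⟪e 2, x⟫) * (stereo e x).re := by
      simp only [stereo]
      field_simp
    have h3 : ⟪e 1, x⟫ = (1 - ⟪e 2, x⟫) * (stereo e x).im := by
      simp only [stereo]
      field_simp
    rw [real_inner_smul_left, hin, h2, h3, Complex.sq_norm, Complex.normSq_apply, Complex.sub_re,
      Complex.sub_im, hK]
    linear_combination (-s) * h1
  refine ⟨s • n, s * -(1 + K), hn1, hc1, ?_, fun x hx hxe => ?_⟩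
  · rw [real_inner_smul_left, hin, frame_inner_self,
      frame_inner_of_ne e (show (0 : Fin 3) ≠ 2 by decide),
      frame_inner_of_ne e (show (1 : Fin 3) ≠ 2 by decide)]
    refine mul_lt_mul_of_pos_left ?_ hs
    linarith
  · have hμ : 0 < s * (1 - ⟪e 2, x⟫) :=
      mul_pos hs (by linarith [inner_pole_lt_one e hx hxe])
    have h1 := hkey x hx hxe
    constructor
    · rw [← sub_eq_zero, h1, mul_eq_zero, or_iff_right hμ.ne', sub_eq_zero,
        sq_eq_sq₀ (norm_nonneg _) hR.le]
    · intro h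
      have h2 : ‖stereo e x - z₀‖ ^ 2 < R ^ 2 := by gcongr
      nlinarith

end Circles

section Cases

variable {A : E3 →L[ℝ] E3} {b : E3} {e : OrthonormalBasis (Fin 3) ℝ E3} {σ : ℝ → E3}

theorem IsSphereOrbit.spiralsInto (hσ : IsSphereOrbit A b σ) (hA : IsSkew A)
    (he : e 2 ∈ confZeros A b) (h0 : σ 0 ∉ confZeros A b) (hre : 0 < ⟪b, e 2⟫)
    (him : ⟪e 1, A (e 0)⟫ ≠ 0) : SpiralsInto σ (e 2) := by
  refine ⟨hσ.tendsto_attractor hA he h0 hre, ?_⟩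
  have hne := ne_pole_of_notMem he h0
  have hβ : confRate A b e ≠ 0 := fun h => hre.ne' (congrArg Complex.re h)
  set β := confRate A b e with hβdef
  set ζ := confDrift b e / β with hζ
  set d := stereo e (σ 0) + ζ with hd
  have hd0 : d ≠ 0 := hσ.stereo_ne hA he h0 hβ
  set ν := ⟪e 1, A (e 0)⟫ with hν
  have hβre : β.re = ⟪b, e 2⟫ := rfl
  have hβim : β.im = ν := rfl
  have hsol : ∀ t : ℝ, stereo e (σ t) = d * Complex.exp (β * t) - ζ := fun t => by
    rw [eq_sub_iff_add_eq]
    exact hσ.stereo_eq_exp hA he hne hβ t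
  set w : ℝ → ℂ := fun t => -(ζ / d) * Complex.exp (-(β * t)) with hw
  have hfac : ∀ t : ℝ, stereo e (σ t) = d * Complex.exp (β * t) * (1 + w t) := by
    intro t
    simp only [hsol, hw, Complex.exp_neg]
    have := Complex.exp_ne_zero (β * t)
    field_simp
    ring
  have hw0 : Tendsto (fun t => ‖w t‖) atTop (𝓝 0) := by
    have h1 : ∀ t, ‖w t‖ = ‖ζ / d‖ * Real.exp (-(⟪b, e 2⟫ * t)) := by
      intro t
      rw [hw, norm_mul, norm_neg, Complex.norm_exp]
      simp [hβre]
    simp only [h1]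
    have h2 : Tendsto (fun t : ℝ => Real.exp (-(⟪b, e 2⟫ * t))) atTop (𝓝 0) :=
      Real.tendsto_exp_neg_atTop_nhds_zero.comp (tendsto_id.const_mul_atTop hre)
    simpa using h2.const_mul ‖ζ / d‖
  obtain ⟨T, hT⟩ := eventually_atTop.1 (hw0.eventually_lt_const zero_lt_one)
  have hwc : Continuous w := by
    simp only [hw]
    fun_prop
  have hslit : ∀ t ≥ T, 1 + w t ∈ Complex.slitPlane := fun t ht =>
    Complex.mem_slitPlane_of_norm_lt_one (hT t ht)
  refine ⟨e 0, e 1, T,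
    fun t => (1 - ⟪e 2, σ t⟫) * (‖d‖ * Real.exp (⟪b, e 2⟫ * t) * ‖1 + w t‖),
    fun t => d.arg + ν * t + (1 + w t).arg,
    norm_of_mem_S2 (frame_mem e 0), norm_of_mem_S2 (frame_mem e 1),
    frame_inner_of_ne e (by decide), frame_inner_of_ne e (by decide),
    frame_inner_of_ne e (by decide), ?_, ?_, ?_⟩
  · refine ((continuous_const.add (continuous_const.mul continuous_id)).continuousOn).add ?_
    intro t ht
    have h1 : ContinuousAt (fun t => 1 + w t) t := (continuous_const.add hwc).continuousAt
    exact (ContinuousAt.comp (f := fun t => 1 + w t) (g := Complex.arg) (Complex.continuousAt_arg (hslit t ht))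
      h1).continuousWithinAt
  · intro t ht
    have hμ : 0 < 1 - ⟪e 2, σ t⟫ := by
      linarith [inner_pole_lt_one e (hσ t).1 (hσ.ne_pole hA he hne t)]
    have hw1 : 0 < ‖1 + w t‖ := norm_pos_iff.2 (Complex.slitPlane_ne_zero (hslit t ht))
    have hd1 : 0 < ‖d‖ := norm_pos_iff.2 hd0
    refine ⟨by positivity, ?_⟩
    have hpolar : stereo e (σ t) = ((‖d‖ * Real.exp (⟪b, e 2⟫ * t) * ‖1 + w t‖ : ℝ) : ℂ) *
        Complex.exp (((d.arg + ν * t + (1 + w t).arg : ℝ) : ℂ) * Complex.I) := by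
      rw [hfac]
      have hexp : Complex.exp (β * t) = ((Real.exp (⟪b, e 2⟫ * t) : ℝ) : ℂ) *
          Complex.exp (((ν * t : ℝ) : ℂ) * Complex.I) := by
        rw [Complex.ofReal_exp, ← Complex.exp_add]
        congr 1
        apply Complex.ext
        · simp [hβre]
        · simp [hβim]
      conv_lhs => rw [← Complex.norm_mul_exp_arg_mul_I d, ← Complex.norm_mul_exp_arg_mul_I (1 + w t),
        hexp]
      push_cast
      simp only [add_mul, Complex.exp_add]
      ring
    have hre' := congrArg Complex.re hpolar
    have him' := congrArg Complex.im hpolar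
    rw [Complex.re_ofReal_mul, Complex.exp_ofReal_mul_I_re] at hre'
    rw [Complex.im_ofReal_mul, Complex.exp_ofReal_mul_I_im] at him'
    simp only [stereo] at hre' him'
    rw [div_eq_iff hμ.ne'] at hre' him'
    have hsum := frame_sum e (σ t)
    nth_rewrite 1 [← hsum]
    rw [add_sub_cancel_right, hre', him', smul_add, smul_smul, smul_smul]
    congr 2 <;> ring
  · have hν0 : 0 < |ν| := abs_pos.2 him
    have h1 : Tendsto (fun t : ℝ => |ν| * t + -(2 * Real.pi)) atTop atTop :=
      tendsto_atTop_add_const_right _ _ (tendsto_id.const_mul_atTop hν0)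
    refine tendsto_atTop_mono' _ ?_ h1
    filter_upwards [eventually_ge_atTop 0] with t ht
    have k1 := Complex.abs_arg_le_pi d
    have k2 := Complex.abs_arg_le_pi (1 + w t)
    have k3 : |ν * t| = |ν| * t := by rw [abs_mul, abs_of_nonneg ht]
    have k4 : |ν * t| ≤ |d.arg + ν * t + (1 + w t).arg| + |d.arg| + |(1 + w t).arg| := by
      have : ν * t = (d.arg + ν * t + (1 + w t).arg) - d.arg - (1 + w t).arg := by ring
      calc |ν * t| = |(d.arg + ν * t + (1 + w t).arg) - d.arg - (1 + w t).arg| := by rw [← this]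
        _ ≤ |(d.arg + ν * t + (1 + w t).arg) - d.arg| + |(1 + w t).arg| := abs_sub _ _
        _ ≤ _ := by gcongr; exact abs_sub _ _
    linarith

/-- Without rotation about the pole, the orbits lie on circles through the pole. -/
theorem IsSphereOrbit.exists_circle (hσ : IsSphereOrbit A b σ) (hA : IsSkew A)
    (he : e 2 ∈ confZeros A b) (h0 : σ 0 ∉ confZeros A b) (hre : 0 < ⟪b, e 2⟫)
    (him : ⟪e 1, A (e 0)⟫ = 0) :
    ∃ (n : E3) (c : ℝ), ‖n‖ = 1 ∧ |c| < 1 ∧ range σ ⊆ circleOnSphere n c := by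
  have hne := ne_pole_of_notMem he h0
  have hβ : confRate A b e ≠ 0 := fun h => hre.ne' (congrArg Complex.re h)
  have hd0 := hσ.stereo_ne hA he h0 hβ
  obtain ⟨n, c, hn, hc, -, -, h⟩ :=
    exists_circle_of_line e hd0 (-(confDrift b e / confRate A b e))
  refine ⟨n, c, hn, hc, ?_⟩
  rintro x ⟨t, rfl⟩
  refine (h _ (hσ t).1 (hσ.ne_pole hA he hne t)).2 ⟨Real.exp (⟪b, e 2⟫ * t), ?_⟩
  have h1 := hσ.stereo_eq_exp hA he hne hβ t
  have h2 : confRate A b e = ((⟪b, e 2⟫ : ℝ) : ℂ) := Complex.ext rfl (by simp [confRate, him])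
  rw [← sub_eq_iff_eq_add', sub_neg_eq_add, h1, Complex.ofReal_exp, Complex.ofReal_mul, ← h2]

theorem not_spiralsInto_of_circle {q n : E3} {c : ℝ} (hS : ∀ t, σ t ∈ S2) (hq : q ∈ S2)
    (hspiral : SpiralsInto σ q) (hn : ‖n‖ = 1) (hc : |c| < 1)
    (hσ : range σ ⊆ circleOnSphere n c) : False := by
  obtain ⟨hlim, e₁, e₂, T, ρ, θ, h1, h2, h12, hq1, hq2, hθ, hρ, hinf⟩ := hspiral
  have hσc : ∀ t, ⟪n, σ t⟫ = c := fun t => (hσ ⟨t, rfl⟩).2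
  have hnq : ⟪n, q⟫ = c := by
    have := (tendsto_const_nhds (x := n)).inner (𝕜 := ℝ) hlim
    simp only [hσc] at this
    exact tendsto_nhds_unique this tendsto_const_nhds
  set a₁ := ⟪n, e₁⟫ with ha₁
  set a₂ := ⟪n, e₂⟫ with ha₂
  have hnn : c ^ 2 + a₁ ^ 2 + a₂ ^ 2 = 1 := by
    have horth : Orthonormal ℝ ![e₁, e₂, q] := by
      rw [orthonormal_iff_ite]
      intro i j
      fin_cases i <;> fin_cases j <;>
        simp [h1, h2, h12, hq1, hq2, norm_of_mem_S2 hq, real_inner_comm q, real_inner_comm e₁ e₂]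
    obtain ⟨f, hf⟩ : ∃ f : OrthonormalBasis (Fin 3) ℝ E3, ⇑f = ![e₁, e₂, q] := by
      have hcard : Fintype.card (Fin 3) = Module.finrank ℝ E3 := by simp
      refine ⟨(basisOfOrthonormalOfCardEqFinrank horth hcard).toOrthonormalBasis ?_, ?_⟩
      · simpa using horth
      · simp
    have f0 : f 0 = e₁ := by rw [hf]; rfl
    have f1 : f 1 = e₂ := by rw [hf]; rfl
    have f2 : f 2 = q := by rw [hf]; rfl
    have := frame_inner f n n
    rw [f0, f1, f2, real_inner_self_eq_norm_sq, hn, real_inner_comm n e₁, real_inner_comm n e₂,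
      real_inner_comm n q, hnq] at this
    linarith
  have ha : 0 < a₁ ^ 2 + a₂ ^ 2 := by
    have := (sq_lt_one_iff_abs_lt_one c).2 hc
    linarith
  set z : ℂ := ⟨a₁, a₂⟩ with hz
  have hz0 : 0 < ‖z‖ := by
    refine norm_pos_iff.2 fun h => ?_
    have k1 : a₁ = 0 := congrArg Complex.re h
    have k2 : a₂ = 0 := congrArg Complex.im h
    rw [k1, k2] at ha
    norm_num at ha
  have hinner : ∀ φ : ℝ, a₁ * Real.cos φ + a₂ * Real.sin φ = ‖z‖ * Real.cos (φ - z.arg) := by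
    intro φ
    have k1 : ‖z‖ * Real.cos z.arg = a₁ := Complex.norm_mul_cos_arg z
    have k2 : ‖z‖ * Real.sin z.arg = a₂ := Complex.norm_mul_sin_arg z
    rw [Real.cos_sub, ← k1, ← k2]
    ring
  have hplane : ∀ t ≥ T, ρ t * (‖z‖ * Real.cos (θ t - z.arg)) = c * (1 - ⟪q, σ t⟫) := by
    intro t ht
    have := congrArg (fun y => ⟪n, y⟫) (hρ t ht).2
    simp only [inner_sub_right, real_inner_smul_right, inner_add_right, hσc, hnq] at this
    rw [← hinner]
    linarith
  have hattain : ∀ s : ℝ, ∃ t ≥ T, Real.cos (θ t - z.arg) = Real.cos s := by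
    intro s
    obtain ⟨t₁, ht₁, hlarge⟩ : ∃ t₁ ≥ T, |θ T| + 2 * Real.pi + |z.arg| + |s| + 2 * Real.pi ≤ |θ t₁| := by
      obtain ⟨t₁, k1, k2⟩ := ((hinf.eventually_ge_atTop _).and (eventually_ge_atTop T)).exists
      exact ⟨t₁, k2, k1⟩
    have hivt : uIcc (θ T) (θ t₁) ⊆ θ '' uIcc T t₁ :=
      intermediate_value_uIcc (hθ.mono fun v hv => by
        rw [uIcc_of_le ht₁] at hv
        exact hv.1)
    have hex : ∃ k : ℤ, z.arg + s + k * (2 * Real.pi) ∈ uIcc (θ T) (θ t₁) := by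
      have hpi : 0 < 2 * Real.pi := by positivity
      rcases le_total (θ T) (θ t₁) with hle | hle
      · refine ⟨⌈(θ T - z.arg - s) / (2 * Real.pi)⌉, ?_⟩
        have k1 := Int.le_ceil ((θ T - z.arg - s) / (2 * Real.pi))
        have k2 := (Int.ceil_lt_add_one ((θ T - z.arg - s) / (2 * Real.pi))).le
        rw [div_le_iff₀ hpi] at k1
        rw [← sub_le_iff_le_add, le_div_iff₀ hpi] at k2
        rw [uIcc_of_le hle]
        refine ⟨by linarith, ?_⟩
        have k3 : 0 ≤ θ t₁ := by
          by_contra hneg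
          rw [abs_of_neg (not_le.1 hneg)] at hlarge
          linarith [neg_abs_le (θ T), abs_nonneg z.arg, abs_nonneg s]
        rw [abs_of_nonneg k3] at hlarge
        linarith [le_abs_self (θ T), abs_nonneg z.arg, abs_nonneg s]
      · refine ⟨⌊(θ T - z.arg - s) / (2 * Real.pi)⌋, ?_⟩
        have k1 := Int.floor_le ((θ T - z.arg - s) / (2 * Real.pi))
        have k2 := (Int.lt_floor_add_one ((θ T - z.arg - s) / (2 * Real.pi))).le
        rw [le_div_iff₀ hpi] at k1
        rw [div_le_iff₀ hpi] at k2
        rw [uIcc_of_ge hle]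
        refine ⟨?_, by linarith⟩
        have k3 : θ t₁ ≤ 0 := by
          by_contra hpos
          rw [abs_of_pos (not_le.1 hpos)] at hlarge
          linarith [le_abs_self (θ T), abs_nonneg z.arg, abs_nonneg s]
        rw [abs_of_nonpos k3] at hlarge
        linarith [neg_abs_le (θ T), abs_nonneg z.arg, abs_nonneg s]
    obtain ⟨k, hk⟩ := hex
    obtain ⟨t, ht, hθt⟩ := hivt hk
    rw [uIcc_of_le ht₁] at ht
    refine ⟨t, ht.1, ?_⟩
    rw [hθt, show z.arg + s + k * (2 * Real.pi) - z.arg = s + k * (2 * Real.pi) by ring,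
      Real.cos_add_int_mul_two_pi]
  have hle : ∀ t, 0 ≤ 1 - ⟪q, σ t⟫ := fun t => by
    have := real_inner_le_norm q (σ t)
    rw [norm_of_mem_S2 hq, norm_of_mem_S2 (hS t), one_mul] at this
    linarith
  rcases le_total 0 c with h | h
  · obtain ⟨t, ht, hcos⟩ := hattain Real.pi
    have h3 := hplane t ht
    rw [hcos, Real.cos_pi] at h3
    nlinarith [mul_pos (hρ t ht).1 hz0, mul_nonneg h (hle t)]
  · obtain ⟨t, ht, hcos⟩ := hattain 0
    have h3 := hplane t ht
    rw [hcos, Real.cos_zero] at h3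
    nlinarith [mul_pos (hρ t ht).1 hz0, mul_nonneg (neg_nonneg.2 h) (hle t)]

end Cases

/-! ### The classification -/

/-- Every conformal Killing field of the sphere has a zero. -/
theorem confZeros_nonempty (a b : E3) : (confZeros (crossMap a) b).Nonempty := by
  set γ : ℂ := (-(⟨b 0, a 0⟩ : ℂ) + Complex.I * ⟨b 1, a 1⟩) with hγ
  by_cases h0 : γ = 0
  · have hre := congrArg Complex.re h0
    have him := congrArg Complex.im h0
    simp [hγ] at hre him
    refine ⟨!₂[0, 0, 1], ?_, ?_⟩
    · rw [S2, mem_sphere_zero_iff_norm, ← sq_eq_sq₀ (norm_nonneg _) zero_le_one,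
        ← real_inner_self_eq_norm_sq, inner_vec3]
      simp
    · rw [confField, crossMap_apply, inner_vec3_right]
      ext i
      fin_cases i <;> simp <;> linarith
  · obtain ⟨z, hz⟩ : ∃ z : ℂ, γ * (z * z) + (2 * ⟨b 2, a 2⟩) * z
        + ((⟨b 0, a 0⟩ : ℂ) + Complex.I * ⟨b 1, a 1⟩) = 0 := by
      refine exists_quadratic_eq_zero h0 ?_
      obtain ⟨s, hs⟩ := IsAlgClosed.exists_pow_nat_eq (discrim γ (2 * ⟨b 2, a 2⟩)
        ((⟨b 0, a 0⟩ : ℂ) + Complex.I * ⟨b 1, a 1⟩)) (n := 2) (by norm_num)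
      exact ⟨s, by rw [← hs, pow_two]⟩
    have hre := congrArg Complex.re hz
    have him := congrArg Complex.im hz
    simp [hγ] at hre him
    have h1 : ⟪stereoRe z, confField (crossMap a) b (stereoPoint z)⟫ = 0 := by
      rw [confField, inner_sub_right, inner_add_right, inner_stereoRe_crossMap,
        real_inner_smul_right, real_inner_comm (stereoPoint z) (stereoRe z), inner_stereoPoint_stereoRe,
        stereoIm, stereoRe,
        inner_vec3_right, inner_vec3]
      linarith
    have h2 : ⟪stereoIm z, confField (crossMap a) b (stereoPoint z)⟫ = 0 := by
      rw [confField, inner_sub_right, inner_add_right, inner_stereoIm_crossMap,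
        real_inner_smul_right, real_inner_comm (stereoPoint z) (stereoIm z), inner_stereoPoint_stereoIm,
        stereoIm, stereoRe,
        inner_vec3_right, inner_vec3]
      linarith
    have hS := stereoPoint_mem z
    have hD : 0 < 1 + z.re ^ 2 + z.im ^ 2 := by positivity
    have hdir : stereoDir z = (1 + z.re ^ 2 + z.im ^ 2) • stereoPoint z := by
      rw [stereoPoint, smul_inv_smul₀ hD.ne']
    have h3 : ⟪stereoDir z, confField (crossMap a) b (stereoPoint z)⟫ = 0 := by
      rw [hdir, real_inner_smul_left, confField, inner_sub_right, inner_add_right,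
        (isSkew_crossMap a).inner_self, real_inner_smul_right, inner_self_of_mem_S2 hS,
        real_inner_comm b]
      ring
    have h4 := stereo_decomposition z (confField (crossMap a) b (stereoPoint z))
    rw [h1, h2, h3] at h4
    simp only [mul_zero, zero_smul, add_zero] at h4
    exact ⟨stereoPoint z, hS, (smul_eq_zero.1 h4).resolve_left (pow_ne_zero 2 hD.ne')⟩

theorem eq_of_periodic_of_tendsto {σ : ℝ → E3} {q : E3} {T : ℝ} (hT : 0 < T)
    (hper : Function.Periodic σ T) (hlim : Tendsto σ atTop (𝓝 q)) : σ 0 = q := by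
  have h1 : Tendsto (fun n : ℕ => σ (n * T)) atTop (𝓝 q) :=
    hlim.comp (tendsto_natCast_atTop_atTop.atTop_mul_const hT)
  have h2 : ∀ n : ℕ, σ (n * T) = σ 0 := fun n => by simpa using hper.nat_mul n 0
  simp only [h2] at h1
  exact tendsto_nhds_unique tendsto_const_nhds h1

theorem tendsto_atBot_of_reverse {σ : ℝ → E3} {q : E3}
    (h : Tendsto (fun t => σ (-t)) atTop (𝓝 q)) : Tendsto σ atBot (𝓝 q) := by
  simpa [Function.comp_def] using h.comp tendsto_neg_atBot_atTop

section Describe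

variable {A : E3 →L[ℝ] E3} {b : E3} {X : E4 → E4}

theorem describes_periodic (hA : IsSkew A) (hcrit : criticalPoints X = confZeros A b)
    (horb : ∀ σ, IsRegularOrbit X σ → IsSphereOrbit A b σ ∧ σ 0 ∉ confZeros A b)
    {e : OrthonormalBasis (Fin 3) ℝ E3} (he : e 2 ∈ confZeros A b) (hre : ⟪b, e 2⟫ = 0)
    (him : ⟪e 1, A (e 0)⟫ ≠ 0) : OrbitClass.periodic.Describes X := by
  set ν := ⟪e 1, A (e 0)⟫ with hν
  have hβ : confRate A b e ≠ 0 := fun h => him (congrArg Complex.im h)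
  have hβν : confRate A b e = (ν : ℂ) * Complex.I := by
    apply Complex.ext <;> simp [confRate, hre, hν]
  obtain ⟨p, hp, hpe, hsp, hz⟩ := exists_second_zero hA he hβ
  refine ⟨e 2, p, hpe.symm, by rw [hcrit, hz, pair_comm], fun σ hσr => ?_⟩
  obtain ⟨hσ, h0⟩ := horb σ hσr
  have hne := IsSphereOrbit.ne_pole_of_notMem he h0
  have hnet := hσ.ne_pole hA he hne
  have hd := hσ.stereo_ne hA he h0 hβ
  have hsol : ∀ t, stereo e (σ t) - stereo e p =
      (stereo e (σ 0) + confDrift b e / confRate A b e) * Complex.exp (((ν * t : ℝ) : ℂ) * Complex.I) := by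
    intro t
    rw [hsp, sub_neg_eq_add, hσ.stereo_eq_exp hA he hne hβ t]
    congr 2
    rw [hβν]
    push_cast
    ring
  set d := stereo e (σ 0) + confDrift b e / confRate A b e with hdd
  constructor
  · have hν0 : 0 < |ν| := abs_pos.2 him
    have hνC : (ν : ℂ) ≠ 0 := Complex.ofReal_ne_zero.2 him
    refine ⟨2 * Real.pi / |ν|, by positivity, fun t => ?_⟩
    refine stereo_injOn e (hσ _).1 (hnet _) (hσ t).1 (hnet t) ?_
    have hexp : Complex.exp (((ν * (t + 2 * Real.pi / |ν|) : ℝ) : ℂ) * Complex.I)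
        = Complex.exp (((ν * t : ℝ) : ℂ) * Complex.I) := by
      rw [Complex.exp_eq_exp_iff_exists_int]
      rcases le_or_gt 0 ν with h | h
      · rw [abs_of_nonneg h]
        refine ⟨1, ?_⟩
        push_cast
        field_simp
      · rw [abs_of_neg h]
        refine ⟨-1, ?_⟩
        push_cast
        field_simp
    rw [← sub_left_inj (a := stereo e p), hsol, hsol, hexp]
  · obtain ⟨n, c, hn, hc, hq, hcirc⟩ := exists_circle_of_circle e (stereo e p)
      (norm_pos_iff.2 hd)
    refine ⟨n, c, hn, hc, ?_, hq, (hcirc p hp hpe).2 (by simpa using hd)⟩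
    ext x
    constructor
    · rintro ⟨t, rfl⟩
      refine ⟨(hσ t).1, ((hcirc _ (hσ t).1 (hnet t)).1).2 ?_⟩
      rw [hsol, norm_mul, Complex.norm_exp_ofReal_mul_I, mul_one]
    · rintro ⟨hx, hxc⟩
      have hxe : x ≠ e 2 := by
        rintro rfl
        exact hq.ne' hxc
      have h1 := ((hcirc x hx hxe).1).1 hxc
      refine ⟨((stereo e x - stereo e p) / d).arg / ν, ?_⟩
      refine stereo_injOn e (hσ _).1 (hnet _) hx hxe ?_
      rw [← sub_left_inj (a := stereo e p), hsol, mul_div_cancel₀ _ him]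
      have h2 := Complex.norm_mul_exp_arg_mul_I ((stereo e x - stereo e p) / d)
      rw [norm_div, h1, div_self (norm_ne_zero_iff.2 hd), Complex.ofReal_one, one_mul] at h2
      rw [h2, mul_div_cancel₀ _ hd]

theorem describes_tangent (hA : IsSkew A) (hcrit : criticalPoints X = confZeros A b)
    (horb : ∀ σ, IsRegularOrbit X σ → IsSphereOrbit A b σ ∧ σ 0 ∉ confZeros A b)
    (hreg : ∃ x ∈ S2, x ∉ confZeros A b)
    {e : OrthonormalBasis (Fin 3) ℝ E3} (he : e 2 ∈ confZeros A b) (hβ : confRate A b e = 0) :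
    OrbitClass.tangent.Describes X := by
  have hzero : ∀ x ∈ S2, x ≠ e 2 → (x ∈ confZeros A b ↔ confDrift b e = 0) := by
    intro x hx hxe
    rw [mem_confZeros_iff hA he hx hxe, hβ, zero_mul, zero_add]
  have hγ : confDrift b e ≠ 0 := by
    intro h
    obtain ⟨x, hx, hxz⟩ := hreg
    by_cases hxe : x = e 2
    · exact hxz (hxe ▸ he)
    · exact hxz ((hzero x hx hxe).2 h)
  have hz : confZeros A b = {e 2} := by
    ext x
    rw [mem_singleton_iff]
    refine ⟨fun hx => ?_, fun hx => hx ▸ he⟩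
    by_contra hxe
    exact hγ ((hzero x hx.1 hxe).1 hx)
  obtain ⟨g0, g1, -⟩ := frame_coordinates e (confDrift b e).re (confDrift b e).im 0
  rw [zero_smul, add_zero] at g0 g1
  refine ⟨e 2, by rw [hcrit, hz], (confDrift b e).re • e 0 + (confDrift b e).im • e 1, ?_, ?_,
    fun σ hσr => ?_⟩
  · intro h
    rw [h, inner_zero_right] at g0 g1
    exact hγ (Complex.ext g0.symm g1.symm)
  · rw [inner_add_right, real_inner_smul_right, real_inner_smul_right,
      frame_inner_of_ne e (show (2 : Fin 3) ≠ 0 by decide),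
      frame_inner_of_ne e (show (2 : Fin 3) ≠ 1 by decide)]
    ring
  · obtain ⟨hσ, h0⟩ := horb σ hσr
    have hne := IsSphereOrbit.ne_pole_of_notMem he h0
    have hnet := hσ.ne_pole hA he hne
    refine ⟨tendsto_atBot_of_reverse ?_, hσ.tendsto_parabolic hA he hne hβ hγ, ?_⟩
    · refine hσ.reverse.tendsto_parabolic hA.neg (e := e) (by rwa [confZeros_neg])
        (by simpa using hne) ?_ ?_
      · have h1 := congrArg Complex.re hβ
        have h2 := congrArg Complex.im hβ
        simp [confRate] at h1 h2
        apply Complex.ext <;> simp [confRate, h1, h2]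
      · intro h
        have h1 := congrArg Complex.re h
        have h2 := congrArg Complex.im h
        simp [confDrift] at h1 h2
        exact hγ (Complex.ext h1 h2)
    · obtain ⟨n, c, hn, hc, hτ, hq, hcirc⟩ := exists_circle_of_line e hγ (stereo e (σ 0))
      refine ⟨n, c, hn, hc, ?_, hτ⟩
      ext x
      rw [mem_insert_iff]
      constructor
      · rintro (rfl | ⟨t, rfl⟩)
        · exact hq
        · exact (hcirc _ (hσ t).1 (hnet t)).2 ⟨t, hσ.stereo_eq_linear hA he hne hβ t⟩
      · intro hx
        by_cases hxe : x = e 2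
        · exact Or.inl hxe
        · obtain ⟨t, ht⟩ := (hcirc x hx.1 hxe).1 hx
          refine Or.inr ⟨t, stereo_injOn e (hσ t).1 (hnet t) hx.1 hxe ?_⟩
          rw [hσ.stereo_eq_linear hA he hne hβ t, ht]

theorem describes_of_expanding (hA : IsSkew A) (hcrit : criticalPoints X = confZeros A b)
    (horb : ∀ σ, IsRegularOrbit X σ → IsSphereOrbit A b σ ∧ σ 0 ∉ confZeros A b)
    (hreg : ∃ x ∈ S2, x ∉ confZeros A b)
    {e : OrthonormalBasis (Fin 3) ℝ E3} (he : e 2 ∈ confZeros A b) (hre : 0 < ⟪b, e 2⟫) :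
    ∃ k : OrbitClass, k.Describes X := by
  have hβ : confRate A b e ≠ 0 := fun h => hre.ne' (congrArg Complex.re h)
  obtain ⟨p, hp, hpe, -, hz⟩ := exists_second_zero hA he hβ
  have hpz : p ∈ confZeros A b := by simp [hz]
  obtain ⟨f, rfl⟩ := exists_orthonormalBasis_two hp
  have hf : f 2 ∈ confZeros (-A) (-b) := by rwa [confZeros_neg]
  have hfre : 0 < ⟪-b, f 2⟫ := by
    rw [inner_neg_left, inner_boost_second_zero hA hpz he hpe, neg_neg]
    exact hre
  have hrev : ∀ σ, IsSphereOrbit A b σ → σ 0 ∉ confZeros A b →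
      IsSphereOrbit (-A) (-b) (fun t => σ (-t)) ∧ σ (-0) ∉ confZeros (-A) (-b) :=
    fun σ h h0 => ⟨h.reverse, by rwa [confZeros_neg, neg_zero]⟩
  by_cases him : ⟪e 1, A (e 0)⟫ = 0
  · refine ⟨.dipole, f 2, e 2, hpe, by rw [hcrit, hz], fun σ hσr => ?_⟩
    obtain ⟨hσ, h0⟩ := horb σ hσr
    obtain ⟨r1, r2⟩ := hrev σ hσ h0
    exact ⟨tendsto_atBot_of_reverse (r1.tendsto_attractor hA.neg hf r2 hfre),
      hσ.tendsto_attractor hA he h0 hre, hσ.exists_circle hA he h0 hre him⟩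
  · have hfim : ⟪f 1, (-A) (f 0)⟫ ≠ 0 := by
      intro hf0
      obtain ⟨x, hx, hxz⟩ := hreg
      obtain ⟨σ, hσ0, hσ⟩ := exists_sphereOrbit hA b hx
      have h0 : σ 0 ∉ confZeros A b := by rwa [hσ0]
      obtain ⟨r1, r2⟩ := hrev σ hσ h0
      obtain ⟨n, c, hn, hc, hsub⟩ := r1.exists_circle hA.neg hf r2 hfre hf0
      refine not_spiralsInto_of_circle (fun t => (hσ t).1) he.1
        (hσ.spiralsInto hA he h0 hre him) hn hc ?_
      rintro y ⟨t, rfl⟩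
      exact hsub ⟨-t, by simp⟩
    refine ⟨.spiral, f 2, e 2, hpe, by rw [hcrit, hz], fun σ hσr => ?_⟩
    obtain ⟨hσ, h0⟩ := horb σ hσr
    obtain ⟨r1, r2⟩ := hrev σ hσ h0
    exact ⟨r1.spiralsInto hA.neg hf r2 hfre hfim, hσ.spiralsInto hA he h0 hre him⟩

theorem exists_describes (hA : IsSkew A) (hcrit : criticalPoints X = confZeros A b)
    (horb : ∀ σ, IsRegularOrbit X σ → IsSphereOrbit A b σ ∧ σ 0 ∉ confZeros A b)
    (hreg : ∃ x ∈ S2, x ∉ confZeros A b) (hne : (confZeros A b).Nonempty) :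
    ∃ k : OrbitClass, k.Describes X := by
  obtain ⟨q, hq⟩ := hne
  obtain ⟨e, rfl⟩ := exists_orthonormalBasis_two hq.1
  rcases lt_trichotomy ⟪b, e 2⟫ 0 with h | h | h
  · have hβ : confRate A b e ≠ 0 := fun h' => h.ne (congrArg Complex.re h')
    obtain ⟨p, hp, hpe, -, hz⟩ := exists_second_zero hA hq hβ
    have hpz : p ∈ confZeros A b := by simp [hz]
    obtain ⟨f, rfl⟩ := exists_orthonormalBasis_two hp
    refine describes_of_expanding hA hcrit horb hreg hpz ?_
    rw [inner_boost_second_zero hA hpz hq hpe]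
    exact neg_pos.2 h
  · by_cases him : ⟪e 1, A (e 0)⟫ = 0
    · exact ⟨_, describes_tangent hA hcrit horb hreg hq (Complex.ext h him)⟩
    · exact ⟨_, describes_periodic hA hcrit horb hq h him⟩
  · exact describes_of_expanding hA hcrit horb hreg hq h

theorem IsRegularOrbit.mem_S2 {σ : ℝ → E3} (h : IsRegularOrbit X σ) (t : ℝ) : σ t ∈ S2 := by
  obtain ⟨⟨γ, hγ, hσ⟩, -⟩ := h
  rw [hσ]
  exact (hγ t).1

theorem pair_ne_singleton {p q r : E3} (h : p ≠ q) : ({p, q} : Set E3) ≠ {r} := by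
  intro h'
  have hp : p ∈ ({r} : Set E3) := h' ▸ mem_insert _ _
  have hq : q ∈ ({r} : Set E3) := h' ▸ mem_insert_of_mem _ rfl
  exact h (hp.trans hq.symm)

theorem describes_unique (hreg : ∃ σ, IsRegularOrbit X σ) {k l : OrbitClass}
    (hk : k.Describes X) (hl : l.Describes X) : k = l := by
  obtain ⟨σ, hσ⟩ := hreg
  have h_sd : OrbitClass.spiral.Describes X → OrbitClass.dipole.Describes X → False := by
    rintro ⟨p, q, -, hc, h⟩ ⟨p', q', -, -, h'⟩
    obtain ⟨-, -, n, c, hn, hcc, hsub⟩ := h' σ hσ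
    have hq : q ∈ criticalPoints X := by rw [hc]; simp
    exact not_spiralsInto_of_circle hσ.mem_S2 hq.1 (h σ hσ).2 hn hcc hsub
  have h_per : OrbitClass.periodic.Describes X →
      ∀ q ∈ criticalPoints X, ¬ Tendsto σ atTop (𝓝 q) := by
    rintro ⟨p', q', -, -, h'⟩ q hq hlim
    obtain ⟨⟨T, hT, hper⟩, -⟩ := h' σ hσ
    exact hσ.2 (eq_of_periodic_of_tendsto hT hper hlim ▸ hq)
  have h_sp : OrbitClass.spiral.Describes X → OrbitClass.periodic.Describes X → False := by
    rintro ⟨p, q, -, hc, h⟩ hp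
    exact h_per hp q (by rw [hc]; simp) (h σ hσ).2.1
  have h_dp : OrbitClass.dipole.Describes X → OrbitClass.periodic.Describes X → False := by
    rintro ⟨p, q, -, hc, h⟩ hp
    exact h_per hp q (by rw [hc]; simp) (h σ hσ).2.1
  have h_st : OrbitClass.spiral.Describes X → OrbitClass.tangent.Describes X → False := by
    rintro ⟨p, q, hpq, hc, -⟩ ⟨r, hr, -⟩
    exact pair_ne_singleton hpq (hc.symm.trans hr)
  have h_dt : OrbitClass.dipole.Describes X → OrbitClass.tangent.Describes X → False := by
    rintro ⟨p, q, hpq, hc, -⟩ ⟨r, hr, -⟩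
    exact pair_ne_singleton hpq (hc.symm.trans hr)
  have h_pt : OrbitClass.periodic.Describes X → OrbitClass.tangent.Describes X → False := by
    rintro ⟨p, q, hpq, hc, -⟩ ⟨r, hr, -⟩
    exact pair_ne_singleton hpq (hc.symm.trans hr)
  cases k <;> cases l <;> first | rfl | (exfalso; tauto)

end Describe

/-! ### The boundary value of a Killing field -/

namespace IsKillingNearInfinity

variable {T : Set E4} {G : E4 → E4 →L[ℝ] E4 →L[ℝ] ℝ} {V : E4 → E4}

/-- At null infinity a Killing field is the sum of a supertranslation and of a Lorentz
transformation. -/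
theorem exists_boundary_value (h : IsKillingNearInfinity T G V) :
    ∃ (α : E3 → ℝ) (a b : E3), ContinuousOn α S2 ∧ ∀ u, ∀ x ∈ S2,
      Tendsto (fun r : ℝ => (V (u, r • x)).1) atTop (𝓝 (α x - u * ⟪b, x⟫)) ∧
      Tendsto (fun r : ℝ => r⁻¹ • (V (u, r • x)).2) atTop (𝓝 (crossMap a x + b)) := by
  obtain ⟨F, C, hF, hC, hom, hlim⟩ := h.exists_boundary_field
  have slice : ∀ (u : ℝ) (x : E3), HasFDerivAt (fun y : E3 => ((u, y) : E4))
      (ContinuousLinearMap.inr ℝ ℝ E3) x := fun u x => hasFDerivAt_prodMk_right u x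
  have hCy : ∀ u y, y ≠ 0 → HasFDerivAt (fun y => C (u, y))
      ((fderiv ℝ C (u, y)).comp (ContinuousLinearMap.inr ℝ ℝ E3)) y := fun u y hy =>
    (hC (u, y) hy).hasFDerivAt.comp y (slice u y)
  have hcf : ∀ u, IsConformalField fun y => C (u, y) := by
    refine fun u => ⟨fun y hy => (hCy u y hy).differentiableAt, hom u, fun x hx v w hv hw => ?_⟩
    rw [(hCy u x (ne_zero_of_mem_S2 hx)).fderiv]
    exact (hlim u x hx).2.2.2.2 v w hv hw
  have time : ∀ (u : ℝ) (x : E3), HasDerivAt (fun u : ℝ => ((u, x) : E4)) (1, 0) u := fun u x =>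
    (hasDerivAt_id u).prodMk (hasDerivAt_const u x)
  obtain ⟨a, b, hab⟩ := (hcf 0).exists_tangential_eq
  have hCx : ∀ u, ∀ x ∈ S2, C (u, x) = crossMap a x + b := by
    intro u x hx
    refine (hcf u).eq_of_tangential_eq (isSkew_crossMap a) (fun x hx v hv => ?_) hx
    have hd : ∀ s, HasDerivAt (fun s => ⟪v, C (s, x)⟫) 0 s := by
      intro s
      have h1 := (hC (s, x) (ne_zero_of_mem_S2 hx)).hasFDerivAt.comp_hasDerivAt s (time s x)
      refine ((hasDerivAt_const s v).inner ℝ h1).congr_deriv ?_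
      rw [inner_zero_left, add_zero, real_inner_comm]
      exact (hlim s x hx).2.2.2.1 v hv
    rw [← hab x hx v hv]
    exact is_const_of_deriv_eq_zero (fun s => (hd s).differentiableAt) (fun s => (hd s).deriv) u 0
  have hFx : ∀ u, ∀ x ∈ S2, F (u, x) = F (0, x) - u * ⟪b, x⟫ := by
    intro u x hx
    have hd : ∀ s, HasDerivAt (fun s => F (s, x) + s * ⟪b, x⟫) 0 s := by
      intro s
      have h1 := (hF (s, x) (ne_zero_of_mem_S2 hx)).hasFDerivAt.comp_hasDerivAt s (time s x)
      refine (h1.add ((hasDerivAt_id s).mul_const ⟪b, x⟫)).congr_deriv ?_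
      have h2 := (hlim s x hx).2.2.1
      rw [hCx s x hx, inner_add_right, (isSkew_crossMap a).inner_self, real_inner_comm] at h2
      linarith
    have := is_const_of_deriv_eq_zero (fun s => (hd s).differentiableAt) (fun s => (hd s).deriv) u 0
    rw [zero_mul, add_zero] at this
    exact eq_sub_of_add_eq this
  refine ⟨fun x => F (0, x), a, b, fun x hx => ?_, fun u x hx => ⟨?_, ?_⟩⟩
  · exact ((hF (0, x) (ne_zero_of_mem_S2 hx)).hasFDerivAt.comp x
      (slice 0 x)).continuousAt.continuousWithinAt
  · rw [← hFx u x hx]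
    exact (hlim u x hx).1
  · rw [← hCx u x hx]
    exact (hlim u x hx).2.1

end IsKillingNearInfinity

theorem exists_notMem_confZeros {A : E3 →L[ℝ] E3} {b : E3}
    (h : ¬ ((∀ x ∈ S2, A x = 0) ∧ b = 0)) : ∃ x ∈ S2, x ∉ confZeros A b := by
  by_contra! hz
  have hneg : ∀ x ∈ S2, -x ∈ S2 := fun x hx => by simpa [S2] using hx
  have hb : ∀ x ∈ S2, b = ⟪b, x⟫ • x := by
    intro x hx
    have h1 := (hz x hx).2
    have h2 := (hz _ (hneg x hx)).2
    simp only [confField, map_neg, inner_neg_right, neg_smul, smul_neg, neg_neg] at h1 h2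
    have h3 : (2 : ℝ) • (b - ⟪b, x⟫ • x) = 0 := by
      rw [two_smul]
      calc _ = (A x + b - ⟪b, x⟫ • x) + (-A x + b - ⟪b, x⟫ • x) := by abel
        _ = 0 := by rw [h1, h2, add_zero]
    exact sub_eq_zero.1 ((smul_eq_zero.1 h3).resolve_left two_ne_zero)
  refine h ⟨fun x hx => ?_, ?_⟩
  · have h1 := (hz x hx).2
    rwa [confField, ← hb x hx, add_sub_cancel_right] at h1
  · have e := EuclideanSpace.basisFun (Fin 3) ℝ
    have he : ∀ i, e i ∈ S2 := fun i => by simp [S2]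
    have h1 : ⟪b, e 0⟫ = 0 := by
      rw [hb _ (he 1), real_inner_smul_left, e.orthonormal.2 (by decide), mul_zero]
    rw [hb _ (he 0), h1, zero_smul]

section Spacetime

variable {M : Type*} [TopologicalSpace M] [ChartedSpace E4 M]

theorem AsymptoticallyFlat.isKillingNearInfinity {g : LorentzMetric M} (A : AsymptoticallyFlat g)
    (hA : A.IsComplete) {ξ : (p : M) → TangentSpace 𝓘(ℝ, E4) p} (hξ : IsKilling g ξ)
    (hpoly : IsPolyhomogeneous A.times 1 (vectorInChart A.chart ξ)) :
    IsKillingNearInfinity A.chart.target (formInChart A.chart g.form)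
      (vectorInChart A.chart ξ) := by
  have hI : A.times = univ := hA
  have hflat := A.flat
  rw [hI] at hflat hpoly
  refine ⟨A.chart.open_target, fun K hK => A.covers K (hI ▸ subset_univ K) hK, fun z hz => ?_,
    fun z hz => ?_, fun z v w => ?_, hξ.2 _ A.chart_mem, A.gauge, hflat, hpoly⟩
  · exact ((g.smooth _ A.chart_mem).differentiableOn (by simp)).differentiableAt
      (A.chart.open_target.mem_nhds hz)
  · exact ((hξ.1 _ A.chart_mem).differentiableOn (by simp)).differentiableAt
      (A.chart.open_target.mem_nhds hz)
  · exact g.symm (A.chart.symm z) (mfderiv 𝓘(ℝ, E4) 𝓘(ℝ, E4) A.chart.symm z v)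
      (mfderiv 𝓘(ℝ, E4) 𝓘(ℝ, E4) A.chart.symm z w)

theorem tendsto_boundaryComponents {g : LorentzMetric M} {A : AsymptoticallyFlat g}
    {ξ : (p : M) → TangentSpace 𝓘(ℝ, E4) p} {u : ℝ} {x : E3} {f : ℝ} {c : E3}
    (h1 : Tendsto (fun r : ℝ => (vectorInChart A.chart ξ (u, r • x)).1) atTop (𝓝 f))
    (h2 : Tendsto (fun r : ℝ => r⁻¹ • (vectorInChart A.chart ξ (u, r • x)).2) atTop (𝓝 c)) :
    Tendsto (A.boundaryComponents ξ u x) atTop (𝓝 (f, c - ⟪x, c⟫ • x)) := by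
  refine h1.prodMk_nhds ?_
  have h3 := h2.sub ((tendsto_const_nhds.inner h2 (𝕜 := ℝ) (x := x)).smul_const x)
  refine h3.congr fun r => ?_
  rw [real_inner_smul_right, smul_sub, smul_smul]

end Spacetime

end

theorem mainTheorem1 {M : Type*} [TopologicalSpace M] [ChartedSpace E4 M]
    [IsManifold 𝓘(ℝ, E4) ∞ M]
    (g : LorentzMetric M) (A : AsymptoticallyFlat g) (hA : A.IsComplete)
    (ξ : (p : M) → TangentSpace 𝓘(ℝ, E4) p) (hξ : IsKilling g ξ)
    (hpoly : IsPolyhomogeneous A.times 1 (vectorInChart A.chart ξ))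
    (hsup : ¬ A.IsSupertranslational ξ) :
    ∃ X : E4 → E4, A.IsRestriction ξ X ∧
      (∀ u u' : ℝ, ∀ x ∈ S2, (X (u, x)).2 = (X (u', x)).2) ∧
      (∀ u : ℝ, ∀ x ∈ S2, ∃ γ : ℝ → E4, IsOrbit X γ ∧ γ 0 = (u, x)) ∧
      ∃! k : OrbitClass, k.Describes X := by
  obtain ⟨α, a, b, hα, hlim⟩ := (A.isKillingNearInfinity hA hξ hpoly).exists_boundary_value
  have hskew := isSkew_crossMap a
  set X : E4 → E4 := fun z => (α z.2 - z.1 * ⟪b, z.2⟫, confField (crossMap a) b z.2) with hX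
  have hres : A.IsRestriction ξ X := by
    intro u _ x hx
    have h1 := tendsto_boundaryComponents (hlim u x hx).1 (hlim u x hx).2
    rwa [inner_add_right, hskew.inner_self, zero_add, real_inner_comm b] at h1
  have horbit : ∀ u : ℝ, ∀ x ∈ S2, ∃ γ : ℝ → E4, IsOrbit X γ ∧ γ 0 = (u, x) := by
    intro u₀ x hx
    obtain ⟨u, σ, hu0, hσ0, hσ, hu⟩ := exists_orbit hskew b hα hx u₀
    exact ⟨fun t => (u t, σ t), fun t => ⟨(hσ t).1, (hu t).prodMk (hσ t).2⟩, by simp [hu0, hσ0]⟩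
  have hcrit : criticalPoints X = confZeros (crossMap a) b := by
    ext x
    simp [criticalPoints, confZeros, hX]
  have horb : ∀ σ, IsRegularOrbit X σ →
      IsSphereOrbit (crossMap a) b σ ∧ σ 0 ∉ confZeros (crossMap a) b := by
    rintro σ ⟨⟨γ, hγ, hσ⟩, h0⟩
    obtain rfl : σ = fun t => (γ t).2 := funext hσ
    exact ⟨fun t => ⟨(hγ t).1, (hasFDerivAt_snd (𝕜 := ℝ) (p := γ t)).comp_hasDerivAt t (hγ t).2⟩, hcrit ▸ h0⟩
  have hreg : ∃ x ∈ S2, x ∉ confZeros (crossMap a) b := by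
    refine exists_notMem_confZeros fun ⟨hza, hb⟩ => hsup ⟨α, fun u hu x hx => ?_⟩
    simpa [hX, confField, hb, hza x hx] using hres u hu x hx
  have hex : ∃ σ, IsRegularOrbit X σ := by
    obtain ⟨x, hx, hxz⟩ := hreg
    obtain ⟨γ, hγ, hγ0⟩ := horbit 0 x hx
    exact ⟨fun t => (γ t).2, ⟨γ, hγ, fun _ => rfl⟩, by simpa only [hcrit, hγ0] using hxz⟩
  obtain ⟨k, hk⟩ := exists_describes hskew hcrit horb hreg (confZeros_nonempty a b)
  exact ⟨X, hres, fun _ _ _ _ => rfl, horbit, k, hk, fun l hl => describes_unique hex hl hk⟩
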